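/- **Theorem.** Let $k\ge 1$. An instance of the $k$-star query is a tuple $\mathcal R=(R_1,\dots,R_k)$ of finite binary relations $R_i(A_i,B)$; its input size is $N=\sum_{i=1}^k|R_i|$, its query result is $$\pi_{A_1,\dots,A_k}(R_1\bowtie\cdots\bowtie R_k)=\{(a_1,\dots,a_k)\;:\;\exists b\ \forall i\ (a_i,b)\in R_i\},$$ and its output size $\mathrm{OUT}$ is the number of tuples in the query result. A number $v$ is an $\epsilon$-approximation of $\mathrm{OUT}$ if $(1-\epsilon)\,\mathrm{OUT}\le v\le(1+\epsilon)\,\mathrm{OUT}$. Algorithms are programs for a randomized word RAM: words have $w$ bits, arithmetic on words, memory access and drawing a uniform random integer from a range $[a,b]$ cost one unit of time each. The instance is accessed, again at unit cost, through the primitives of the property testing model: sample a uniform tuple of $R_i$; return the degree $|R_i\ltimes t|$ of a (partial, possibly empty) tuple $t$; return the $j$-th element of the neighbor list of $t$ in $R_i$ under a fixed, arbitrary ordering; test whether a tuple belongs to $R_i$. For all constants $k\ge 1$, $0<\epsilon<1$ and $0<\delta<1$ there are a program and constants $C,c$, depending only on $k,\epsilon,\delta$, such that the following holds for every instance $\mathcal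 R$ with $N\ge1$, every ordering of the neighbor lists, and every word length $w\ge c\,(\lfloor\log_2 N\rfloor+1)$ for which all domain values occurring in $\mathcal R$ are less than $2^w$: with probability at least $1-\delta$, the program, which is not given $\mathrm{OUT}$, halts within $$C\cdot\frac{N}{\max\{1,\mathrm{OUT}\}^{1/k}}$$ units of time and returns an $\epsilon$-approximation of $\mathrm{OUT}$. -/

import Mathlib

/-! ## The star query -/

/-- An instance of the `k`-star query: for every `i`, a finite relation `R i` over the attributes
`(Aᵢ, B)`. The pair `(a, b)` is the tuple with `Aᵢ`-value `a` and `B`-value `b`; domain values are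
natural numbers. -/
abbrev StarInstance (k : ℕ) : Type := Fin k → Finset (ℕ × ℕ)

namespace StarInstance

variable {k : ℕ}

/-- The input size `N`, the total number of tuples. -/
def size (R : StarInstance k) : ℕ := ∑ i, (R i).card

/-- The query result: the projection of the join `R₁(A₁, B) ⋈ ⋯ ⋈ R_k(A_k, B)` onto
`A₁, …, A_k`. -/
def result (R : StarInstance k) : Set (Fin k → ℕ) :=
  {a | ∃ b : ℕ, ∀ i, (a i, b) ∈ R i}

/-- The output size `OUT`, the number of distinct tuples in the query result. -/
noncomputable def out (R : StarInstance k) : ℕ := R.result.ncard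

/-- Every domain value that occurs in the instance fits into a word of `w` bits. -/
def FitsIn (R : StarInstance k) (w : ℕ) : Prop :=
  ∀ i, ∀ p ∈ R i, p.1 < 2 ^ w ∧ p.2 < 2 ^ w

/-- `R i ⋉ a` for an `Aᵢ`-value `a`: the tuples of `R i` whose `Aᵢ`-value is `a`. -/
def semijoinA (R : StarInstance k) (i : Fin k) (a : ℕ) : Finset (ℕ × ℕ) :=
  (R i).filter fun p => p.1 = a

/-- `R i ⋉ b` for a `B`-value `b`: the tuples of `R i` whose `B`-value is `b`. -/
def semijoinB (R : StarInstance k) (i : Fin k) (b : ℕ) : Finset (ℕ × ℕ) :=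
  (R i).filter fun p => p.2 = b

/-- The fixed (otherwise arbitrary) orderings under which the primitive "access neighbor" lists
`π_{e - e'} (R i ⋉ t)`, for `t` the empty tuple, an `Aᵢ`-value and a `B`-value. -/
structure Ordering (R : StarInstance k) where
  tuples : Fin k → List (ℕ × ℕ)
  tuples_nodup : ∀ i, (tuples i).Nodup
  mem_tuples : ∀ i p, p ∈ tuples i ↔ p ∈ R i
  nbrA : Fin k → ℕ → List ℕ
  nbrA_nodup : ∀ i a, (nbrA i a).Nodup
  mem_nbrA : ∀ i a b, b ∈ nbrA i a ↔ (a, b) ∈ R i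
  nbrB : Fin k → ℕ → List ℕ
  nbrB_nodup : ∀ i b, (nbrB i b).Nodup
  mem_nbrB : ∀ i b a, a ∈ nbrB i b ↔ (a, b) ∈ R i

end StarInstance

/-- `v` is an `ε`-approximation of `V`. -/
def IsApproximation (ε V v : ℝ) : Prop := (1 - ε) * V ≤ v ∧ v ≤ (1 + ε) * V

/-! ## A randomized word RAM with the primitives of the property testing model -/

namespace WordRAM

/-- Arithmetic and comparison operations on words. -/
inductive Op
  | add | sub | mul | div | mod | lt | eq

/-- The value of an operation on `w`-bit words, before it is reduced modulo `2 ^ w`. Subtraction is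
modular, a comparison returns `1` or `0`, and a quotient by `0` is `0`. -/
def Op.eval (w : ℕ) : Op → ℕ → ℕ → ℕ
  | .add, x, y => x + y
  | .sub, x, y => x + 2 ^ w - y
  | .mul, x, y => x * y
  | .div, x, y => x / y
  | .mod, x, y => x % y
  | .lt, x, y => if x < y then 1 else 0
  | .eq, x, y => if x = y then 1 else 0

/-- The instructions that take one unit of time. Natural numbers name registers (`x`, `y`, `z`)
and arrays (`m`), except for the literal `n` of `const`; `i` names a relation. -/
inductive Instr (k : ℕ)
  /-- `x ← n` -/
  | const (x n : ℕ)
  /-- `x ← y o z` -/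
  | op (o : Op) (x y z : ℕ)
  /-- `x ← m[y]` -/
  | load (x m y : ℕ)
  /-- `m[x] ← y` -/
  | store (m x y : ℕ)
  /-- `x ← RandInt(y, z)` -/
  | randInt (x y z : ℕ)
  /-- sample tuple: `(x, y) ←` a uniform sample from `R i` -/
  | sample (i : Fin k) (x y : ℕ)
  /-- compute degree, empty tuple: `x ← |R i|` -/
  | card (i : Fin k) (x : ℕ)
  /-- compute degree: `x ← |R i ⋉ y|` for the `Aᵢ`-value `y` -/
  | degA (i : Fin k) (x y : ℕ)
  /-- compute degree: `x ← |R i ⋉ y|` for the `B`-value `y` -/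
  | degB (i : Fin k) (x y : ℕ)
  /-- access neighbor, empty tuple: `(x, y) ←` the tuple at position `z` of `R i` -/
  | tupleAt (i : Fin k) (x y z : ℕ)
  /-- access neighbor: `x ←` the value at position `z` of `π_B (R i ⋉ y)`, `y` an `Aᵢ`-value -/
  | nbrA (i : Fin k) (x y z : ℕ)
  /-- access neighbor: `x ←` the value at position `z` of `π_{Aᵢ} (R i ⋉ y)`, `y` a `B`-value -/
  | nbrB (i : Fin k) (x y z : ℕ)
  /-- test tuple: `x ← 1` if `(y, z) ∈ R i`, and `x ← 0` otherwise -/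
  | test (i : Fin k) (x y z : ℕ)

/-- Programs. A branch and a loop test whether the register `x` is nonzero. -/
inductive Program (k : ℕ)
  | skip
  | basic (I : Instr k)
  | seq (p q : Program k)
  | branch (x : ℕ) (p q : Program k)
  | loop (x : ℕ) (p : Program k)

/-- The contents of the registers and of the arrays, whose cells are addressed by words. -/
@[ext]
structure State where
  reg : ℕ → ℕ
  arr : ℕ → ℕ → ℕ

/-- All registers and all cells contain `0` at the start. -/
def State.start : State := ⟨fun _ => 0, fun _ _ => 0⟩

/-- Write a `w`-bit word into register `x`. -/
def State.setReg (w : ℕ) (s : State) (x v : ℕ) : State :=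
  { s with reg := Function.update s.reg x (v % 2 ^ w) }

/-- Write a `w`-bit word into cell `j` of array `m`. -/
def State.setArr (w : ℕ) (s : State) (m j v : ℕ) : State :=
  { s with arr := Function.update s.arr m (Function.update (s.arr m) j (v % 2 ^ w)) }

variable {k : ℕ}

/-- The effect of an instruction on a machine with `w`-bit words that has access to the instance
`R` under the orderings `L`. Positions in lists are counted from `0`. A call whose answer does not
exist (a sample of an empty relation, a position out of range, an empty range of integers) returns
`0`. -/
noncomputable def Instr.exec (w : ℕ) (R : StarInstance k) (L : R.Ordering) (s : State) :
    Instr k → PMF State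
  | .const x n => PMF.pure (s.setReg w x n)
  | .op o x y z => PMF.pure (s.setReg w x (o.eval w (s.reg y) (s.reg z)))
  | .load x m y => PMF.pure (s.setReg w x (s.arr m (s.reg y)))
  | .store m x y => PMF.pure (s.setArr w m (s.reg x) (s.reg y))
  | .randInt x y z =>
      if h : (Finset.Icc (s.reg y) (s.reg z)).Nonempty then
        (PMF.uniformOfFinset (Finset.Icc (s.reg y) (s.reg z)) h).map fun v => s.setReg w x v
      else PMF.pure (s.setReg w x 0)
  | .sample i x y =>
      if h : (R i).Nonempty then
        (PMF.uniformOfFinset (R i) h).map fun p => (s.setReg w x p.1).setReg w y p.2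
      else PMF.pure ((s.setReg w x 0).setReg w y 0)
  | .card i x => PMF.pure (s.setReg w x (R i).card)
  | .degA i x y => PMF.pure (s.setReg w x (R.semijoinA i (s.reg y)).card)
  | .degB i x y => PMF.pure (s.setReg w x (R.semijoinB i (s.reg y)).card)
  | .tupleAt i x y z =>
      let p := (L.tuples i).getD (s.reg z) (0, 0)
      PMF.pure ((s.setReg w x p.1).setReg w y p.2)
  | .nbrA i x y z => PMF.pure (s.setReg w x ((L.nbrA i (s.reg y)).getD (s.reg z) 0))
  | .nbrB i x y z => PMF.pure (s.setReg w x ((L.nbrB i (s.reg y)).getD (s.reg z) 0))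
  | .test i x y z => PMF.pure (s.setReg w x (if (s.reg y, s.reg z) ∈ R i then 1 else 0))

/-- A configuration: the programs that remain to be executed, in this order, and the state. The
machine has halted when nothing remains. -/
abbrev Config (k : ℕ) : Type := List (Program k) × State

/-- One step of the machine, which is one unit of time. -/
noncomputable def step (w : ℕ) (R : StarInstance k) (L : R.Ordering) : Config k → PMF (Config k)
  | ([], s) => PMF.pure ([], s)
  | (.skip :: K, s) => PMF.pure (K, s)
  | (.basic I :: K, s) => (I.exec w R L s).map fun s' => (K, s')
  | (.seq p q :: K, s) => PMF.pure (p :: q :: K, s)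
  | (.branch x p q :: K, s) => PMF.pure (if s.reg x ≠ 0 then (p :: K, s) else (q :: K, s))
  | (.loop x p :: K, s) =>
      PMF.pure (if s.reg x ≠ 0 then (p :: .loop x p :: K, s) else (K, s))

/-- The distribution of the configuration after `t` steps from a given configuration. -/
noncomputable def run (w : ℕ) (R : StarInstance k) (L : R.Ordering) :
    ℕ → Config k → PMF (Config k)
  | 0, c => PMF.pure c
  | t + 1, c => (step w R L c).bind (run w R L t)

open scoped ENNReal in
/-- The probability that `P`, started on the instance `R`, halts within `t` steps and then has in
register `0` a number `v` with the property `good`. -/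
noncomputable def haltProb (w : ℕ) (R : StarInstance k) (L : R.Ordering) (P : Program k) (t : ℕ)
    (good : ℕ → Prop) : ℝ≥0∞ :=
  (run w R L t ([P], State.start)).toOuterMeasure {c | c.1 = [] ∧ good (c.2.reg 0)}

end WordRAM

/-! Write N for the input size, `deg_i` for degrees in relation `i`, and W(a) for the set of
B-values witnessing an output tuple a. One draw at sampling rate q works as follows. A uniform tuple
of the disjoint union of all relations yields b with probability deg(b)/N, where deg(b) is the sum
of the `deg_i(b)`. It is accepted with probability q^(k-1) ∏ deg_i(b) / (deg(b) N^(k-1)), and then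
neighbors a_1, …, a_k of b are chosen uniformly. Each pair of a B-value and a tuple a that it
witnesses thus appears with the same probability q^(k-1)/N^k. To remove the multiplicity |W(a)|,
random neighbors of the entries a_i are tried in round robin until one lies in W(a). The first such
neighbor is uniform in W(a), and the draw succeeds if it equals b. Hence a draw succeeds with
probability exactly q^(k-1) OUT / N^k (`sum_inv_card_witnesses`, `wp_draw_le`).

Both requirements on a draw hold as soon as q^k OUT ≤ N^k. The acceptance probability is at most 1,
because ∏ deg_i(b) is bounded both by OUT and by deg(b)^k (`pow_mul_prod_le_degree_mul_pow`). The
expected cost is constant: a search takes about min_i deg(a_i)/|W(a)| rounds, and by the power mean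
inequality the sum of the minima over the output is at most OUT^(1-1/k) N (`pow_mul_sum_le`,
`wp_trials_le`).

The algorithm makes C q draws for q = 1, 2, 4, … and stops once there are θ successes, or with
answer 0 once q exceeds N. The mean number of successes is C q^k OUT/N^k. Let 2^j₀ be the largest
power of two with q^k max(1, OUT) ≤ N^k. At this rate and C = θ 2^(k+1), the mean is at least 2θ if
OUT > 0, so stopping is likely by then. Far below it, Markov's inequality makes stopping unlikely;
at the D rates nearest to it, Chebyshev's inequality makes the estimate accurate
(`wp_stage_le_errorBound`). The error bounds sum to a small constant (`sum_errorBound_le`), and the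
costs form a geometric sum of order 2^j₀ ≤ N/max(1, OUT)^(1/k). If OUT = 0 there are no successes
and the answer 0 is correct.

Time and error are handled by one expectation transformer `wp`, which charges τ per step and 1 for a
wrong result. With τ = 1/t, its value bounds the probability of not halting correctly within t steps
(`le_haltProb_of_wp_le`). Truncation at 1 lets a loop invariant give up with value 1 after an
unlikely event, such as passing the largest admissible rate, where nothing is known about the
running time. -/

namespace WordRAM

open scoped ENNReal

variable {k : ℕ}

/-! ## Expectations of nonnegative functions -/

/-- The expectation of `f` under `p`. -/
noncomputable def expect {α : Type*} (p : PMF α) (f : α → ℝ≥0∞) : ℝ≥0∞ := ∑' a, p a * f a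

theorem expect_pure {α : Type*} (a : α) (f : α → ℝ≥0∞) : expect (PMF.pure a) f = f a := by
  unfold expect
  rw [tsum_eq_single a]
  · simp
  · intro b hb
    simp [PMF.pure_apply, hb]

theorem expect_bind {α β : Type*} (p : PMF α) (q : α → PMF β) (f : β → ℝ≥0∞) :
    expect (p.bind q) f = expect p fun a => expect (q a) f := by
  unfold expect
  simp_rw [PMF.bind_apply, ← ENNReal.tsum_mul_right, ← ENNReal.tsum_mul_left]
  rw [ENNReal.tsum_comm]
  simp_rw [mul_assoc]

theorem expect_map {α β : Type*} (p : PMF α) (g : α → β) (f : β → ℝ≥0∞) :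
    expect (p.map g) f = expect p fun a => f (g a) := by
  rw [PMF.map, expect_bind]
  simp only [Function.comp, expect_pure]

theorem expect_mono {α : Type*} (p : PMF α) {f g : α → ℝ≥0∞} (h : ∀ a, f a ≤ g a) :
    expect p f ≤ expect p g :=
  ENNReal.tsum_le_tsum fun a => mul_le_mul_right (h a) _

theorem expect_const_add {α : Type*} (p : PMF α) (c : ℝ≥0∞) (f : α → ℝ≥0∞) :
    expect p (fun a => c + f a) = c + expect p f := by
  unfold expect
  simp_rw [mul_add]
  rw [ENNReal.tsum_add, ENNReal.tsum_mul_right, p.tsum_coe, one_mul]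

theorem expect_uniformOfFinset {α : Type*} (A : Finset α) (h : A.Nonempty) (f : α → ℝ≥0∞) :
    expect (PMF.uniformOfFinset A h) f = (∑ a ∈ A, f a) / A.card := by
  classical
  unfold expect
  rw [tsum_eq_sum (s := A)]
  · rw [ENNReal.div_eq_inv_mul, Finset.mul_sum]
    refine Finset.sum_congr rfl fun a ha => ?_
    rw [PMF.uniformOfFinset_apply_of_mem h ha]
  · intro a ha
    rw [PMF.uniformOfFinset_apply_of_notMem h ha, zero_mul]

/-! ## Expected cost of programs -/

/-- An upper bound for the expectation of `f` in the final state of a program plus `τ` times its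
running time, where expectations at the head of a loop are truncated at `1`. -/
noncomputable def wp (w : ℕ) (R : StarInstance k) (L : R.Ordering) (τ : ℝ≥0∞) :
    Program k → (State → ℝ≥0∞) → State → ℝ≥0∞
  | .skip, f, s => τ + f s
  | .basic I, f, s => τ + expect (I.exec w R L s) f
  | .seq p q, f, s => τ + wp w R L τ p (wp w R L τ q f) s
  | .branch x p q, f, s =>
      τ + if s.reg x ≠ 0 then wp w R L τ p f s else wp w R L τ q f s
  | .loop x p, f, s =>
      ⨅ (I : State → ℝ≥0∞)
        (_ : ∀ s, min 1 (τ + if s.reg x ≠ 0 then wp w R L τ p I s else f s) ≤ I s), I s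

variable {w : ℕ} {R : StarInstance k} {L : R.Ordering} {τ : ℝ≥0∞}

theorem wp_mono (p : Program k) {f g : State → ℝ≥0∞} (h : ∀ s, f s ≤ g s) (s : State) :
    wp w R L τ p f s ≤ wp w R L τ p g s := by
  induction p generalizing f g s with
  | skip => exact add_le_add le_rfl (h s)
  | basic I => exact add_le_add le_rfl (expect_mono _ h)
  | seq p q hp hq => exact add_le_add le_rfl (hp (fun s => hq h s) s)
  | branch x p q hp hq =>
    refine add_le_add le_rfl ?_
    split_ifs
    · exact hp h s
    · exact hq h s
  | loop x p hp =>
    refine le_iInf₂ fun I hI => iInf₂_le I fun s => le_trans ?_ (hI s)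
    refine min_le_min le_rfl (add_le_add le_rfl ?_)
    split_ifs
    · exact le_rfl
    · exact h s

/-- The induction principle for loops. -/
theorem wp_loop_le {x : ℕ} {p : Program k} {f : State → ℝ≥0∞} (I : State → ℝ≥0∞)
    (h₁ : ∀ s, s.reg x ≠ 0 → min 1 (τ + wp w R L τ p I s) ≤ I s)
    (h₀ : ∀ s, s.reg x = 0 → min 1 (τ + f s) ≤ I s) (s : State) :
    wp w R L τ (.loop x p) f s ≤ I s := by
  refine iInf₂_le I fun s => ?_
  by_cases hs : s.reg x = 0
  · simpa [hs] using h₀ s hs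
  · simpa [hs] using h₁ s hs

/-- Knaster–Tarski: the infimum of all loop invariants is itself an invariant, by monotonicity of
the body. This unfolds a loop once when a machine step is matched against `wp`. -/
theorem min_wp_loop_le (x : ℕ) (p : Program k) (f : State → ℝ≥0∞) (s : State) :
    min 1 (τ + if s.reg x ≠ 0 then wp w R L τ p (wp w R L τ (.loop x p) f) s else f s) ≤
      wp w R L τ (.loop x p) f s := by
  refine le_iInf₂ fun I hI => le_trans ?_ (hI s)
  refine min_le_min le_rfl (add_le_add le_rfl ?_)
  split_ifs
  · exact wp_mono p (fun s => iInf₂_le I hI) s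
  · exact le_rfl

/-- The bound `wp` for a list of programs that are executed one after the other. -/
noncomputable def wpStack (w : ℕ) (R : StarInstance k) (L : R.Ordering) (τ : ℝ≥0∞)
    (K : List (Program k)) (f : State → ℝ≥0∞) : State → ℝ≥0∞ :=
  K.foldr (fun p g => wp w R L τ p g) f

theorem min_expect_step_le (p : Program k) (K : List (Program k)) (f : State → ℝ≥0∞) (s : State) :
    min 1 (τ + expect (step w R L (p :: K, s)) fun c => wpStack w R L τ c.1 f c.2) ≤
      wpStack w R L τ (p :: K) f s := by
  cases p with
  | skip => simp only [step, expect_pure]; exact min_le_right _ _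
  | basic I => simp only [step, expect_map]; exact min_le_right _ _
  | seq p q => simp only [step, expect_pure]; exact min_le_right _ _
  | branch x p q =>
    simp only [step, expect_pure]
    refine (min_le_right _ _).trans (le_of_eq ?_)
    change _ = τ + if s.reg x ≠ 0 then _ else _
    split_ifs <;> rfl
  | loop x p =>
    simp only [step, expect_pure]
    refine le_trans (le_of_eq ?_) (min_wp_loop_le x p (wpStack w R L τ K f) s)
    split_ifs <;> rfl

theorem expect_le_one {α : Type*} (p : PMF α) {f : α → ℝ≥0∞} (h : ∀ a, f a ≤ 1) :
    expect p f ≤ 1 := by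
  refine (expect_mono p h).trans ?_
  simp [expect, p.tsum_coe]

open Classical in
/-- The indicator of the configurations that have not halted in a good state. -/
noncomputable def failure (good : ℕ → Prop) (c : Config k) : ℝ≥0∞ :=
  if c.1 = [] ∧ good (c.2.reg 0) then 0 else 1

theorem failure_le_one (good : ℕ → Prop) (c : Config k) : failure good c ≤ 1 := by
  unfold failure
  split_ifs <;> simp

theorem run_nil (t : ℕ) (s : State) : run w R L t ([], s) = PMF.pure ([], s) := by
  induction t with
  | zero => rfl
  | succ t ih => rw [run, step, PMF.pure_bind, ih]

/-- A potential argument: each step pays τ out of the potential, while time that remains after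
halting is covered by the summand 1. For tτ = 1 the two sides cancel to a bound on the failure
probability. -/
theorem expect_run_failure_le (good : ℕ → Prop) (f : State → ℝ≥0∞)
    (hf : ∀ s, failure (k := k) good ([], s) ≤ f s) (t : ℕ) (ht : t * τ ≤ 1) (c : Config k) :
    expect (run w R L t c) (failure good) + t * τ ≤ 1 + wpStack w R L τ c.1 f c.2 := by
  induction t generalizing c with
  | zero =>
    simp only [Nat.cast_zero, zero_mul, add_zero]
    exact (expect_le_one _ (failure_le_one good)).trans le_self_add
  | succ t ih =>
    have ht' : t * τ ≤ 1 := le_trans (mul_le_mul_left (by exact_mod_cast t.le_succ) τ) ht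
    obtain ⟨K, s⟩ := c
    cases K with
    | nil =>
      rw [run_nil, expect_pure, add_comm]
      exact add_le_add ht (hf s)
    | cons p K =>
      rw [run, expect_bind]
      -- If the potential is already at least 1, the trivial bound on a probability suffices;
      -- otherwise the truncation is inactive and the step inequality applies.
      rcases le_or_gt 1 (wpStack w R L τ (p :: K) f s) with h | h
      · rw [add_comm]
        exact add_le_add ht ((expect_le_one _ fun c => expect_le_one _ (failure_le_one good)).trans h)
      · have h1 := min_expect_step_le (w := w) (L := L) (τ := τ) p K f s
        rcases min_le_iff.1 h1 with h2 | h2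
        · exact absurd h (not_lt.2 h2)
        · calc _ = τ + (t * τ + expect (step w R L (p :: K, s))
                  fun c => expect (run w R L t c) (failure good)) := by
                push_cast; ring
            _ = τ + expect (step w R L (p :: K, s))
                  fun c => t * τ + expect (run w R L t c) (failure good) := by
                rw [expect_const_add]
            _ ≤ τ + expect (step w R L (p :: K, s))
                  fun c => 1 + wpStack w R L τ c.1 f c.2 := by
                refine add_le_add le_rfl (expect_mono _ fun c => ?_)
                rw [add_comm]
                exact ih ht' c
            _ = 1 + (τ + expect (step w R L (p :: K, s))
                  fun c => wpStack w R L τ c.1 f c.2) := by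
                rw [expect_const_add]; ring
            _ ≤ _ := add_le_add le_rfl h2

/-- If the expected cost of a program is at most `δ`, where a unit of time costs `1 / t` and a bad
result costs `1`, then it halts with a good result within `t` steps with probability at least
`1 - δ`. -/
theorem le_haltProb_of_wp_le (P : Program k) (good : ℕ → Prop) (f : State → ℝ≥0∞)
    (hf : ∀ s, good (s.reg 0) ∨ 1 ≤ f s) (t : ℕ) (ht : 1 ≤ t) {δ : ℝ≥0∞}
    (h : wp w R L (t : ℝ≥0∞)⁻¹ P f State.start ≤ δ) :
    1 - δ ≤ haltProb w R L P t good := by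
  have htt : (t : ℝ≥0∞) * (t : ℝ≥0∞)⁻¹ = 1 :=
    ENNReal.mul_inv_cancel (by exact_mod_cast (by omega : t ≠ 0)) (ENNReal.natCast_ne_top t)
  have hf' : ∀ s, failure (k := k) good ([], s) ≤ f s := by
    intro s
    unfold failure
    split_ifs with hs
    · exact zero_le
    · rcases hf s with h1 | h1
      · exact absurd ⟨rfl, h1⟩ hs
      · exact h1
  have h1 := expect_run_failure_le (w := w) (L := L) good f hf' t htt.le ([P], State.start)
  rw [htt, add_comm] at h1
  have h2 : expect (run w R L t ([P], State.start)) (failure good) ≤ δ :=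
    ((ENNReal.add_le_add_iff_left ENNReal.one_ne_top).1 h1).trans h
  rw [tsub_le_iff_right]
  refine le_trans (le_of_eq ?_) (add_le_add le_rfl h2)
  unfold haltProb expect
  rw [PMF.toOuterMeasure_apply, ← ENNReal.tsum_add, ← (run w R L t ([P], State.start)).tsum_coe]
  refine tsum_congr fun c => ?_
  unfold failure
  by_cases hc : c.1 = [] ∧ good (c.2.reg 0)
  · rw [Set.indicator_of_mem (by exact hc)]; simp [hc]
  · rw [Set.indicator_of_notMem (by exact hc)]; simp [hc]

/-! ## Programs without loops -/

/-- A bound for the running time of a program without loops. -/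
def Program.len : Program k → ℕ
  | .skip => 1
  | .basic _ => 1
  | .seq p q => 1 + p.len + q.len
  | .branch _ p q => 1 + p.len + q.len
  | .loop _ _ => 0

/-- The program contains no loop. -/
def Program.LoopFree : Program k → Prop
  | .skip => True
  | .basic _ => True
  | .seq p q => p.LoopFree ∧ q.LoopFree
  | .branch _ p q => p.LoopFree ∧ q.LoopFree
  | .loop _ _ => False

theorem wp_const_add_le {p : Program k} (hp : p.LoopFree) (c : ℝ≥0∞) (f : State → ℝ≥0∞)
    (s : State) :
    wp w R L τ p (fun s => c + f s) s ≤ p.len * τ + c + wp w R L 0 p f s := by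
  induction p generalizing c f s with
  | skip => simp [wp, Program.len, add_assoc]
  | basic I => simp [wp, Program.len, expect_const_add, add_assoc]
  | seq p q ihp ihq =>
    simp only [wp, Program.len, zero_add]
    calc _ ≤ τ + wp w R L τ p (fun s => (q.len * τ + c) + wp w R L 0 q f s) s :=
          add_le_add le_rfl (wp_mono p (fun s => ihq hp.2 c f s) s)
      _ ≤ τ + (p.len * τ + (q.len * τ + c) + wp w R L 0 p (wp w R L 0 q f) s) :=
          add_le_add le_rfl (ihp hp.1 _ _ s)
      _ = _ := by push_cast; ring
  | branch x p q ihp ihq =>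
    simp only [wp, Program.len, zero_add]
    split_ifs
    · calc _ ≤ τ + (p.len * τ + c + wp w R L 0 p f s) + q.len * τ :=
            le_add_right (add_le_add le_rfl (ihp hp.1 c f s))
        _ = _ := by push_cast; ring
    · calc _ ≤ τ + (q.len * τ + c + wp w R L 0 q f s) + p.len * τ :=
            le_add_right (add_le_add le_rfl (ihq hp.2 c f s))
        _ = _ := by push_cast; ring
  | loop x p => exact hp.elim

/-- Separates worst-case time from the expectation: loop-free code can be analyzed with τ = 0 and
its length charged afterwards. The continuation `f` may still contain loops and their cost. -/
theorem wp_le_len_mul_add {p : Program k} (hp : p.LoopFree) (f : State → ℝ≥0∞) (s : State) :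
    wp w R L τ p f s ≤ p.len * τ + wp w R L 0 p f s := by
  simpa using wp_const_add_le (w := w) (L := L) (τ := τ) hp 0 f s

end WordRAM

namespace WordRAM

open scoped ENNReal

variable {k : ℕ} {w : ℕ} {R : StarInstance k} {L : R.Ordering} {τ : ℝ≥0∞}

/-! ## Deterministic programs -/

/-- The effect of a deterministic instruction. -/
noncomputable def Instr.next (w : ℕ) (R : StarInstance k) (L : R.Ordering) (s : State) :
    Instr k → State
  | .const x n => s.setReg w x n
  | .op o x y z => s.setReg w x (o.eval w (s.reg y) (s.reg z))
  | .load x m y => s.setReg w x (s.arr m (s.reg y))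
  | .store m x y => s.setArr w m (s.reg x) (s.reg y)
  | .randInt _ _ _ => s
  | .sample _ _ _ => s
  | .card i x => s.setReg w x (R i).card
  | .degA i x y => s.setReg w x (R.semijoinA i (s.reg y)).card
  | .degB i x y => s.setReg w x (R.semijoinB i (s.reg y)).card
  | .tupleAt i x y z =>
      (s.setReg w x ((L.tuples i).getD (s.reg z) (0, 0)).1).setReg w y
        ((L.tuples i).getD (s.reg z) (0, 0)).2
  | .nbrA i x y z => s.setReg w x ((L.nbrA i (s.reg y)).getD (s.reg z) 0)
  | .nbrB i x y z => s.setReg w x ((L.nbrB i (s.reg y)).getD (s.reg z) 0)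
  | .test i x y z => s.setReg w x (if (s.reg y, s.reg z) ∈ R i then 1 else 0)

/-- The instruction does not draw random numbers. -/
def Instr.Det : Instr k → Prop
  | .randInt _ _ _ => False
  | .sample _ _ _ => False
  | _ => True

@[simp]
theorem Instr.det_const (x n : ℕ) :
    (Instr.const x n : Instr k).Det := trivial

@[simp]
theorem Instr.det_op (o : Op) (x y z : ℕ) :
    (Instr.op o x y z : Instr k).Det := trivial

@[simp]
theorem Instr.det_degA (i : Fin k) (x y : ℕ) :
    (Instr.degA i x y : Instr k).Det := trivial

@[simp]
theorem Instr.det_degB (i : Fin k) (x y : ℕ) :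
    (Instr.degB i x y : Instr k).Det := trivial

@[simp]
theorem Instr.det_nbrA (i : Fin k) (x y z : ℕ) :
    (Instr.nbrA i x y z : Instr k).Det := trivial

@[simp]
theorem Instr.det_nbrB (i : Fin k) (x y z : ℕ) :
    (Instr.nbrB i x y z : Instr k).Det := trivial

theorem Instr.exec_eq_pure {I : Instr k} (h : I.Det) (s : State) :
    I.exec w R L s = PMF.pure (I.next w R L s) := by
  cases I <;> first | rfl | exact h.elim

/-- The program contains no loops and does not draw random numbers. -/
def Program.Det : Program k → Prop
  | .skip => True
  | .basic I => I.Det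
  | .seq p q => p.Det ∧ q.Det
  | .branch _ p q => p.Det ∧ q.Det
  | .loop _ _ => False

/-- The effect of a deterministic program. -/
noncomputable def eval (w : ℕ) (R : StarInstance k) (L : R.Ordering) : Program k → State → State
  | .skip, s => s
  | .basic I, s => I.next w R L s
  | .seq p q, s => eval w R L q (eval w R L p s)
  | .branch x p q, s => if s.reg x ≠ 0 then eval w R L p s else eval w R L q s
  | .loop _ _, s => s

theorem Program.Det.loopFree {p : Program k} (h : p.Det) : p.LoopFree := by
  induction p with
  | skip => trivial
  | basic I => trivial
  | seq p q hp hq => exact ⟨hp h.1, hq h.2⟩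
  | branch x p q hp hq => exact ⟨hp h.1, hq h.2⟩
  | loop x p => exact h.elim

theorem wp_zero_of_det {p : Program k} (h : p.Det) (f : State → ℝ≥0∞) (s : State) :
    wp w R L 0 p f s = f (eval w R L p s) := by
  induction p generalizing f s with
  | skip => simp [wp, eval]
  | basic I => simp [wp, eval, Instr.exec_eq_pure h, expect_pure]
  | seq p q hp hq => simp [wp, eval, hp h.1, hq h.2]
  | branch x p q hp hq =>
    simp only [wp, eval, hp h.1, hq h.2, zero_add]
    split_ifs <;> rfl
  | loop x p => exact h.elim

theorem State.reg_setReg (s : State) (x v y : ℕ) :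
    (s.setReg w x v).reg y = if y = x then v % 2 ^ w else s.reg y := by
  simp [State.setReg, Function.update_apply]

/-! ## Sequences -/

/-- Execute the programs of a list one after the other. -/
def Program.ofList : List (Program k) → Program k
  | [] => .skip
  | p :: l => .seq p (ofList l)

/-- Execute `p i` for all `i` in a list. -/
def Program.forAll (p : Fin k → Program k) (l : List (Fin k)) : Program k :=
  .ofList (l.map p)

theorem Program.det_ofList {l : List (Program k)} (h : ∀ p ∈ l, p.Det) : (ofList l).Det := by
  induction l with
  | nil => trivial
  | cons p l ih => exact ⟨h p (by simp), ih fun q hq => h q (by simp [hq])⟩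

theorem Program.loopFree_ofList {l : List (Program k)} (h : ∀ p ∈ l, p.LoopFree) :
    (ofList l).LoopFree := by
  induction l with
  | nil => trivial
  | cons p l ih => exact ⟨h p (by simp), ih fun q hq => h q (by simp [hq])⟩

theorem Program.det_forAll {p : Fin k → Program k} (h : ∀ i, (p i).Det) (l : List (Fin k)) :
    (forAll p l).Det :=
  det_ofList fun q hq => by
    obtain ⟨i, -, rfl⟩ := List.mem_map.1 hq
    exact h i

theorem Program.loopFree_forAll {p : Fin k → Program k} (h : ∀ i, (p i).LoopFree)
    (l : List (Fin k)) : (forAll p l).LoopFree :=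
  loopFree_ofList fun q hq => by
    obtain ⟨i, -, rfl⟩ := List.mem_map.1 hq
    exact h i

theorem eval_forAll_cons (p : Fin k → Program k) (i : Fin k) (l : List (Fin k)) (s : State) :
    eval w R L (.forAll p (i :: l)) s = eval w R L (.forAll p l) (eval w R L (p i) s) := rfl

theorem wp_zero_forAll_cons (p : Fin k → Program k) (i : Fin k) (l : List (Fin k))
    (f : State → ℝ≥0∞) (s : State) :
    wp w R L 0 (.forAll p (i :: l)) f s = wp w R L 0 (p i) (wp w R L 0 (.forAll p l) f) s :=
  zero_add _

/-- The registers below `10` have the same contents. -/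
def Agree (s s' : State) : Prop := ∀ y < 10, s'.reg y = s.reg y

theorem Agree.refl (s : State) : Agree s s := fun _ _ => rfl

theorem Agree.trans {s s' s'' : State} (h : Agree s s') (h' : Agree s' s'') : Agree s s'' :=
  fun y hy => (h' y hy).trans (h y hy)

theorem Agree.setReg {s s' : State} (h : Agree s s') {x : ℕ} (hx : 10 ≤ x) (v : ℕ) :
    Agree s (s'.setReg w x v) := fun y hy => by
  rw [State.reg_setReg, if_neg (by omega), h y hy]

/-! ## The algorithm

Register `0` holds the result, `1` the input size `N`, `2` the power `N ^ (k - 1)`, `3` the current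
sampling rate `q`, `4` the power `q ^ (k - 1)`, `5` the number of remaining draws, `6` the number
of successful draws, `7` whether the computation goes on, `8` the constant `1`, `9` the constant
`0`, `10` a value of `B`, and `20 + i` a value of `Aᵢ`. -/

namespace Program

/-- `x ← y o z` -/
abbrev arith (o : Op) (x y z : ℕ) : Program k := .basic (.op o x y z)

/-- `x ← n` -/
abbrev const (x n : ℕ) : Program k := .basic (.const x n)

/-- `x ← x * y ^ n` -/
def mulPow (x y n : ℕ) : Program k := .ofList (List.replicate n (arith .mul x x y))

/-- Search the tuple at the position in register `11` of the concatenation of all relations. -/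
def locate (i : Fin k) : Program k :=
  .branch 15
    (.ofList [.basic (.card i 12), arith .lt 16 11 12,
      .branch 16 (.ofList [.basic (.tupleAt i 12 10 11), const 15 0]) (arith .sub 11 11 12)])
    .skip

/-- Add the degree of the value of `B` to register `11`, and multiply register `13` by it. -/
def degrees (i : Fin k) : Program k :=
  .ofList [.basic (.degB i 12 10), arith .add 11 11 12, arith .mul 13 13 12]

/-- Choose a value of `Aᵢ` among the neighbors of the value of `B`. -/
def choose (i : Fin k) : Program k :=
  .ofList [.basic (.degB i 12 10), arith .sub 12 12 8, .basic (.randInt 12 9 12),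
    .basic (.nbrB i (20 + i) 10 12)]

/-- Test a tuple of relation `i`, and multiply register `16` by the result. -/
def check (i : Fin k) : Program k :=
  .ofList [.basic (.test i 12 (20 + i) 11), arith .mul 16 16 12]

/-- Choose a neighbor of the value of `Aᵢ`, and test whether it is a witness of the chosen values of
`A₁, …, A_k`. -/
def trial (i : Fin k) : Program k :=
  .ofList [.basic (.degA i 12 (20 + i)), arith .sub 12 12 8, .basic (.randInt 12 9 12),
    .basic (.nbrA i 11 (20 + i) 12), const 16 1, forAll check (List.finRange k),
    arith .eq 15 16 9, arith .eq 16 11 10]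

/-- A trial, unless a witness has been found. -/
def guardedTrial (i : Fin k) : Program k := .branch 15 (trial i) .skip

/-- Try until a witness is found. -/
def trials : Program k := .loop 15 (forAll guardedTrial (List.finRange k))

/-- The first part of a draw: choose a tuple. -/
def drawTuple : Program k :=
  .ofList [arith .sub 11 1 8, .basic (.randInt 11 9 11), const 15 1,
    forAll locate (List.finRange k)]

/-- The second part of a draw: decide whether the value of `B` is accepted. -/
def drawAccept : Program k :=
  .ofList [const 11 0, arith .add 13 4 9, forAll degrees (List.finRange k),
    arith .mul 11 11 2, arith .sub 11 11 8, .basic (.randInt 11 9 11), arith .lt 11 11 13]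

/-- The third part of a draw: choose values of the attributes `Aᵢ`. -/
def drawValues : Program k := .seq (forAll choose (List.finRange k)) (const 15 1)

/-- One draw. -/
def draw : Program k :=
  .seq (.seq drawTuple drawAccept)
    (.branch 11 (.seq drawValues (.seq trials (arith .add 6 6 16))) .skip)

/-- Prepare `C * q` draws. -/
def prepare (C : ℕ) : Program k :=
  .ofList [const 4 1, mulPow 4 3 (k - 1), const 5 C, arith .mul 5 5 3, const 6 0]

/-- The loop that performs the draws. -/
def draws : Program k := .loop 5 (.seq draw (arith .sub 5 5 8))

/-- Compute the estimate. -/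
def finish (C : ℕ) : Program k :=
  .ofList [arith .mul 11 2 1, arith .add 12 6 6, arith .mul 11 11 12, const 12 C,
    arith .mul 12 12 4, arith .mul 12 12 3, arith .add 11 11 12, arith .add 12 12 12,
    arith .div 0 11 12, const 7 0]

/-- Continue with twice the sampling rate if there are less than `θ` successful draws. -/
def decide (C θ : ℕ) : Program k :=
  .ofList [const 11 θ, arith .lt 11 6 11,
    .branch 11 (.ofList [arith .add 3 3 3, arith .lt 11 1 3, .branch 11 (const 7 0) .skip])
      (finish C)]

/-- The draws for one sampling rate. -/
def stage (C θ : ℕ) : Program k := .seq (prepare C) (.seq draws (decide C θ))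

/-- Add the size of a relation to register `1`. -/
def addCard (i : Fin k) : Program k := .ofList [.basic (.card i 11), arith .add 1 1 11]

/-- Initialize the registers. -/
def init : Program k :=
  .ofList [const 8 1, forAll addCard (List.finRange k), const 2 1, mulPow 2 1 (k - 1), const 3 1,
    const 7 1]

/-- The estimator for the output size. -/
def estimate (C θ : ℕ) : Program k := .seq init (.loop 7 (stage C θ))

end Program

open Program

/-! ## Effects of the deterministic parts -/

/-- Since the factor is at least 1, intermediate products never exceed the final one, so bounding
the latter excludes overflow. -/
theorem reg_eval_mulPow {x y : ℕ} (hxy : y ≠ x) (n : ℕ) (s : State)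
    (h : s.reg x * s.reg y ^ n < 2 ^ w) (hy : 1 ≤ s.reg y) :
    (eval w R L (mulPow x y n) s).reg x = s.reg x * s.reg y ^ n ∧
      ∀ z ≠ x, (eval w R L (mulPow x y n) s).reg z = s.reg z := by
  induction n generalizing s with
  | zero => simp [mulPow, ofList, eval]
  | succ n ih =>
    have h1 : s.reg x * s.reg y < 2 ^ w := by
      refine lt_of_le_of_lt ?_ h
      rw [pow_succ, ← mul_assoc, mul_right_comm]
      exact Nat.le_mul_of_pos_right _ (pow_pos hy n)
    set s1 : State := s.setReg w x (s.reg x * s.reg y) with hs1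
    have hx1 : s1.reg x = s.reg x * s.reg y := by
      simp [hs1, State.reg_setReg, Nat.mod_eq_of_lt h1]
    have hz1 : ∀ z ≠ x, s1.reg z = s.reg z := fun z hz => by
      simp [hs1, State.reg_setReg, hz]
    have e : eval w R L (mulPow x y (n + 1)) s = eval w R L (mulPow x y n) s1 := rfl
    have := ih s1 (by rw [hx1, hz1 y hxy, mul_assoc, ← pow_succ']; exact h)
      (by rw [hz1 y hxy]; exact hy)
    rw [e]
    refine ⟨?_, fun z hz => (this.2 z hz).trans (hz1 z hz)⟩
    rw [this.1, hx1, hz1 y hxy, pow_succ']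
    ring

theorem det_mulPow (x y n : ℕ) : (mulPow x y n : Program k).Det :=
  det_ofList fun p hp => by rw [List.eq_of_mem_replicate hp]; trivial

theorem eval_forAll_locate_of_zero (l : List (Fin k)) (s : State) (h : s.reg 15 = 0) :
    eval w R L (forAll locate l) s = s := by
  induction l with
  | nil => rfl
  | cons i l ih =>
    rw [eval_forAll_cons, show eval w R L (locate i) s = s by simp [locate, eval, h], ih]

/-- Register `15` means that the search is still on; register `11` is the position relative to the
relations not yet skipped. -/
theorem eval_forAll_locate (hfit : R.FitsIn w) (hR : ∀ i, (R i).card < 2 ^ w) (l : List (Fin k))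
    (s : State) (h : s.reg 15 = 1) (hr : s.reg 11 < (l.flatMap L.tuples).length)
    (hrw : s.reg 11 < 2 ^ w) (hw : 1 < 2 ^ w) :
    (eval w R L (forAll locate l) s).reg 10 =
      ((l.flatMap L.tuples).getD (s.reg 11) (0, 0)).2 ∧
      Agree s (eval w R L (forAll locate l) s) := by
  induction l generalizing s with
  | nil => simp at hr
  | cons i l ih =>
    have hlen : (L.tuples i).length = (R i).card := by
      rw [← List.toFinset_card_of_nodup (L.tuples_nodup i)]
      congr 1
      ext p
      rw [List.mem_toFinset, L.mem_tuples]
    rw [List.flatMap_cons] at hr ⊢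
    rw [eval_forAll_cons]
    by_cases hlt : s.reg 11 < (R i).card
    · have hmem : ((L.tuples i).getD (s.reg 11) (0, 0)) ∈ R i := by
        rw [← L.mem_tuples, List.getD_eq_getElem _ _ (by omega)]
        exact List.getElem_mem _
      have h2 := (hfit i _ hmem).2
      rw [List.getD_append _ _ _ _ (by omega)]
      set s1 := eval w R L (locate i) s with hs1
      have e : s1 = ((((s.setReg w 12 (R i).card).setReg w 16 1).setReg w 12
          ((L.tuples i).getD (s.reg 11) (0, 0)).1).setReg w 10
            ((L.tuples i).getD (s.reg 11) (0, 0)).2).setReg w 15 0 := by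
        simp [hs1, locate, eval, ofList, Instr.next, State.reg_setReg, Op.eval, h,
          Nat.mod_eq_of_lt (hR i), hlt, Nat.mod_eq_of_lt hw]
      rw [eval_forAll_locate_of_zero _ _ (by simp [e, State.reg_setReg]), e]
      refine ⟨?_, ?_⟩
      · simp [State.reg_setReg, -List.getD_eq_getElem?_getD, Nat.mod_eq_of_lt h2]
      · iterate 5 refine Agree.setReg ?_ (by norm_num) _
        exact Agree.refl s
    · rw [List.length_append] at hr
      set s1 := eval w R L (locate i) s with hs1
      have e : s1 = ((s.setReg w 12 (R i).card).setReg w 16 0).setReg w 11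
          (s.reg 11 + 2 ^ w - (R i).card) := by
        simp [hs1, locate, eval, ofList, Instr.next, State.reg_setReg, Op.eval, h,
          Nat.mod_eq_of_lt (hR i), hlt]
      have e11 : s1.reg 11 = s.reg 11 - (R i).card := by
        have : s.reg 11 + 2 ^ w - (R i).card = (s.reg 11 - (R i).card) + 2 ^ w := by omega
        rw [e, State.reg_setReg, if_pos rfl, this, Nat.add_mod_right]
        exact Nat.mod_eq_of_lt (by omega)
      have e15 : s1.reg 15 = 1 := by simp [e, State.reg_setReg, h]
      have ea : Agree s s1 := by
        rw [e]
        iterate 3 refine Agree.setReg ?_ (by norm_num) _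
        exact Agree.refl s
      have := ih s1 e15 (by omega) (by omega)
      refine ⟨?_, ea.trans this.2⟩
      rw [this.1, List.getD_append_right _ _ _ _ (by omega), e11, hlen]

/-- The overflow hypothesis uses N to the number of remaining relations instead of the actual
product, since a zero degree would hide large intermediate values. -/
theorem eval_forAll_degrees (b : ℕ) (N : ℕ) (l : List (Fin k)) (s : State) (hb : s.reg 10 = b)
    (hN : ∀ i, (R.semijoinB i b).card ≤ N) (hN1 : 1 ≤ N) (hNw : N < 2 ^ w)
    (hD : s.reg 11 + (l.map fun i => (R.semijoinB i b).card).sum < 2 ^ w)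
    (hT : s.reg 13 * N ^ l.length < 2 ^ w) :
    (eval w R L (forAll degrees l) s).reg 11 =
        s.reg 11 + (l.map fun i => (R.semijoinB i b).card).sum ∧
      (eval w R L (forAll degrees l) s).reg 13 =
        s.reg 13 * (l.map fun i => (R.semijoinB i b).card).prod ∧
      (eval w R L (forAll degrees l) s).reg 10 = b ∧
      Agree s (eval w R L (forAll degrees l) s) := by
  induction l generalizing s with
  | nil => simp [forAll, ofList, eval, hb, Agree.refl]
  | cons i l ih =>
    rw [List.map_cons, List.sum_cons] at hD
    rw [eval_forAll_cons]
    have hd := hN i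
    have hT' : s.reg 13 * (R.semijoinB i b).card * N ^ l.length < 2 ^ w := by
      refine lt_of_le_of_lt ?_ hT
      rw [List.length_cons, pow_succ', ← mul_assoc]
      gcongr
    have hT1 : s.reg 13 * (R.semijoinB i b).card < 2 ^ w :=
      lt_of_le_of_lt (Nat.le_mul_of_pos_right _ (pow_pos hN1 _)) hT'
    set s1 := eval w R L (degrees i) s with hs1
    have e : s1 = ((s.setReg w 12 (R.semijoinB i b).card).setReg w 11
        (s.reg 11 + (R.semijoinB i b).card)).setReg w 13
          (s.reg 13 * (R.semijoinB i b).card) := by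
      simp [hs1, degrees, eval, ofList, Instr.next, State.reg_setReg, Op.eval, hb,
        Nat.mod_eq_of_lt (hd.trans_lt hNw)]
    have e11 : s1.reg 11 = s.reg 11 + (R.semijoinB i b).card := by
      simp [e, State.reg_setReg]
      exact Nat.mod_eq_of_lt (by omega)
    have e13 : s1.reg 13 = s.reg 13 * (R.semijoinB i b).card := by
      simp [e, State.reg_setReg]
      exact Nat.mod_eq_of_lt hT1
    have e10 : s1.reg 10 = b := by simp [e, State.reg_setReg, hb]
    have ea : Agree s s1 := by
      rw [e]
      iterate 3 refine Agree.setReg ?_ (by norm_num) _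
      exact Agree.refl s
    have := ih s1 e10 (by omega) (by rw [e13]; exact hT')
    refine ⟨?_, ?_, this.2.2.1, ea.trans this.2.2.2⟩
    · rw [this.1, e11, List.map_cons, List.sum_cons, add_assoc]
    · rw [this.2.1, e13, List.map_cons, List.prod_cons, mul_assoc]

theorem eval_forAll_check (l : List (Fin k)) (s : State) (hw : 1 < 2 ^ w) (h : s.reg 16 ≤ 1) :
    (eval w R L (forAll check l) s).reg 16 =
        (if ∀ i ∈ l, (s.reg (20 + i), s.reg 11) ∈ R i then s.reg 16 else 0) ∧
      ∀ y, y ≠ 12 → y ≠ 16 → (eval w R L (forAll check l) s).reg y = s.reg y := by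
  induction l generalizing s with
  | nil => simp [forAll, ofList, eval]
  | cons i l ih =>
    rw [eval_forAll_cons]
    set s1 := eval w R L (check i) s with hs1
    have e : s1 = (s.setReg w 12 (if (s.reg (20 + i), s.reg 11) ∈ R i then 1 else 0)).setReg w 16
        (s.reg 16 * if (s.reg (20 + i), s.reg 11) ∈ R i then 1 else 0) := by
      simp only [hs1, check, eval, ofList, Instr.next, State.reg_setReg, Op.eval]
      split_ifs <;> simp [Nat.mod_eq_of_lt hw]; omega
    have e16 : s1.reg 16 = if (s.reg (20 + i), s.reg 11) ∈ R i then s.reg 16 else 0 := by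
      rw [e, State.reg_setReg, if_pos rfl]
      split_ifs
      · rw [mul_one]; exact Nat.mod_eq_of_lt (by omega)
      · simp
    have ey : ∀ y, y ≠ 12 → y ≠ 16 → s1.reg y = s.reg y := fun y h1 h2 => by
      simp [e, State.reg_setReg, h1, h2]
    have := ih s1 (by rw [e16]; split_ifs <;> omega)
    refine ⟨?_, fun y h1 h2 => (this.2 y h1 h2).trans (ey y h1 h2)⟩
    rw [this.1, e16, ey 11 (by omega) (by omega)]
    have : ∀ j : Fin k, s1.reg (20 + j) = s.reg (20 + j) := fun j => ey _ (by omega) (by omega)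
    simp only [this, List.forall_mem_cons]
    by_cases h1 : (s.reg (20 + i), s.reg 11) ∈ R i <;> simp [h1]

end WordRAM

/-! ### Combinatorics of the star query: double counting of witnesses and the two inequalities
behind the sampling rate. -/

namespace StarInstance

variable {k : ℕ} (R : StarInstance k)

/-- The neighbors of a `B`-value `b` in `R i`. -/
def nbrsB (i : Fin k) (b : ℕ) : Finset ℕ := (R.semijoinB i b).image Prod.fst

/-- The neighbors of an `Aᵢ`-value `a` in `R i`. -/
def nbrsA (i : Fin k) (a : ℕ) : Finset ℕ := (R.semijoinA i a).image Prod.snd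

variable {R}

theorem mem_nbrsB {i : Fin k} {a b : ℕ} : a ∈ R.nbrsB i b ↔ (a, b) ∈ R i := by
  simp [nbrsB, semijoinB]

theorem mem_nbrsA {i : Fin k} {a b : ℕ} : b ∈ R.nbrsA i a ↔ (a, b) ∈ R i := by
  simp [nbrsA, semijoinA]

theorem card_nbrsB (i : Fin k) (b : ℕ) : (R.nbrsB i b).card = (R.semijoinB i b).card := by
  refine Finset.card_image_of_injOn fun p hp q hq h => ?_
  simp only [semijoinB, Finset.coe_filter, Set.mem_ofPred_eq] at hp hq
  exact Prod.ext h (hp.2.trans hq.2.symm)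

theorem card_nbrsA (i : Fin k) (a : ℕ) : (R.nbrsA i a).card = (R.semijoinA i a).card := by
  refine Finset.card_image_of_injOn fun p hp q hq h => ?_
  simp only [semijoinA, Finset.coe_filter, Set.mem_ofPred_eq] at hp hq
  exact Prod.ext (hp.2.trans hq.2.symm) h

theorem card_le_size (i : Fin k) : (R i).card ≤ R.size :=
  Finset.single_le_sum (f := fun i => (R i).card) (fun _ _ => Nat.zero_le _) (Finset.mem_univ i)

theorem card_semijoinB_le_card (i : Fin k) (b : ℕ) : (R.semijoinB i b).card ≤ (R i).card :=
  Finset.card_le_card (Finset.filter_subset _ _)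

theorem card_semijoinA_le_card (i : Fin k) (a : ℕ) : (R.semijoinA i a).card ≤ (R i).card :=
  Finset.card_le_card (Finset.filter_subset _ _)

variable (R)

/-- The total degree of a value of `B`. -/
def degree (b : ℕ) : ℕ := ∑ i, (R.semijoinB i b).card

/-- The values of `B` that occur in the instance. -/
def valuesB : Finset ℕ := Finset.univ.biUnion fun i => (R i).image Prod.snd

/-- The witnesses of a tuple. -/
def witnesses (a : Fin k → ℕ) : Finset ℕ := R.valuesB.filter fun b => ∀ i, (a i, b) ∈ R i

open Classical in
/-- The query result as a finite set. -/
noncomputable def resultFinset : Finset (Fin k → ℕ) :=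
  (Fintype.piFinset fun i => (R i).image Prod.fst).filter fun a => ∃ b, ∀ i, (a i, b) ∈ R i

variable {R}

theorem degree_le_size (b : ℕ) : R.degree b ≤ R.size :=
  Finset.sum_le_sum fun i _ => card_semijoinB_le_card i b

theorem mem_valuesB {i : Fin k} {a b : ℕ} (h : (a, b) ∈ R i) : b ∈ R.valuesB := by
  simp only [valuesB, Finset.mem_biUnion, Finset.mem_univ, true_and, Finset.mem_image]
  exact ⟨i, (a, b), h, rfl⟩

theorem mem_witnesses (hk : 1 ≤ k) {a : Fin k → ℕ} {b : ℕ} :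
    b ∈ R.witnesses a ↔ ∀ i, (a i, b) ∈ R i := by
  simp only [witnesses, Finset.mem_filter, and_iff_right_iff_imp]
  exact fun h => mem_valuesB (h ⟨0, hk⟩)

theorem mem_resultFinset {a : Fin k → ℕ} :
    a ∈ R.resultFinset ↔ ∃ b, ∀ i, (a i, b) ∈ R i := by
  simp only [resultFinset, Finset.mem_filter, and_iff_right_iff_imp, Fintype.mem_piFinset,
    Finset.mem_image]
  rintro ⟨b, hb⟩ i
  exact ⟨(a i, b), hb i, rfl⟩

theorem resultFinset_subset :
    R.resultFinset ⊆ Fintype.piFinset fun i => (R i).image Prod.fst := by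
  classical exact Finset.filter_subset _ _

theorem out_eq_card : R.out = R.resultFinset.card := by
  rw [← Set.ncard_coe_finset, out]
  congr 1
  ext a
  simp [result, mem_resultFinset]

theorem card_witnesses_le_card_semijoinA (hk : 1 ≤ k) (a : Fin k → ℕ) (i : Fin k) :
    (R.witnesses a).card ≤ (R.semijoinA i (a i)).card := by
  rw [← card_nbrsA]
  exact Finset.card_le_card fun b hb => mem_nbrsA.2 ((mem_witnesses hk).1 hb i)

/-- Every output tuple is counted once for each of its witnesses. -/
theorem sum_valuesB_sum_piFinset (hk : 1 ≤ k) {M : Type*} [AddCommMonoid M]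
    (h : (Fin k → ℕ) → ℕ → M) :
    ∑ b ∈ R.valuesB, ∑ a ∈ Fintype.piFinset fun i => R.nbrsB i b, h a b =
      ∑ a ∈ R.resultFinset, ∑ b ∈ R.witnesses a, h a b := by
  refine Finset.sum_comm' fun b a => ?_
  rw [mem_witnesses hk, Fintype.mem_piFinset, mem_resultFinset]
  simp only [mem_nbrsB]
  exact ⟨fun h => ⟨h.2, b, h.2⟩, fun h => ⟨mem_valuesB (h.1 ⟨0, hk⟩), h.1⟩⟩

/-- The weight 1/|W(a)| cancels the number of times that a is counted. This turns sampling of pairs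
(b, a) into uniform sampling of output tuples. -/
theorem sum_inv_card_witnesses (hk : 1 ≤ k) (m : (Fin k → ℕ) → ℝ) :
    ∑ b ∈ R.valuesB, ∑ a ∈ Fintype.piFinset fun i => R.nbrsB i b,
      m a / (R.witnesses a).card = ∑ a ∈ R.resultFinset, m a := by
  rw [sum_valuesB_sum_piFinset hk]
  refine Finset.sum_congr rfl fun a ha => ?_
  obtain ⟨b, hb⟩ := mem_resultFinset.1 ha
  have : 0 < (R.witnesses a).card := Finset.card_pos.2 ⟨b, (mem_witnesses hk).2 hb⟩
  rw [Finset.sum_const, nsmul_eq_mul]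
  field_simp

theorem sum_snd_eq_sum_degree (g : ℕ → ℝ) :
    ∑ i, ∑ p ∈ R i, g p.2 = ∑ b ∈ R.valuesB, R.degree b * g b := by
  simp only [degree, Nat.cast_sum, Finset.sum_mul]
  rw [Finset.sum_comm]
  refine Finset.sum_congr rfl fun i _ => ?_
  rw [← Finset.sum_fiberwise_of_maps_to (t := R.valuesB) (g := Prod.snd)
    (fun p hp => mem_valuesB (a := p.1) hp)]
  refine Finset.sum_congr rfl fun b _ => ?_
  rw [Finset.sum_congr rfl (g := fun _ => g b), Finset.sum_const, nsmul_eq_mul, semijoinB]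
  intro p hp
  rw [(Finset.mem_filter.1 hp).2]

/-- Any combination of neighbors of b is an output tuple witnessed by b. -/
theorem prod_card_le_out (b : ℕ) : ∏ i, (R.semijoinB i b).card ≤ R.out := by
  simp_rw [← card_nbrsB]
  rw [out_eq_card, ← Fintype.card_piFinset]
  refine Finset.card_le_card fun a ha => mem_resultFinset.2 ⟨b, fun i => ?_⟩
  exact mem_nbrsB.1 (Fintype.mem_piFinset.1 ha i)

/-- The acceptance probability of a value of `B` is at most `1`. -/
theorem pow_mul_prod_le_degree_mul_pow (hk : 1 ≤ k) {q : ℕ}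
    (hq : q ^ k * R.out ≤ R.size ^ k) (b : ℕ) :
    q ^ (k - 1) * ∏ i, (R.semijoinB i b).card ≤ R.degree b * R.size ^ (k - 1) := by
  obtain ⟨n, rfl⟩ : ∃ n, k = n + 1 := ⟨k - 1, by omega⟩
  simp only [Nat.add_sub_cancel]
  set P := ∏ i, (R.semijoinB i b).card with hP
  have h1 : P ≤ R.degree b ^ (n + 1) := by
    rw [hP, ← Fin.prod_const]
    exact Finset.prod_le_prod' fun i _ =>
      Finset.single_le_sum (f := fun i => (R.semijoinB i b).card) (fun _ _ => Nat.zero_le _)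
        (Finset.mem_univ i)
  have h2 : q ^ (n + 1) * P ≤ R.size ^ (n + 1) :=
    (Nat.mul_le_mul_left _ (prod_card_le_out b)).trans hq
  -- Comparing k-th powers avoids roots: n of the n + 1 factors P are bounded through OUT, the last
  -- one through the degree.
  refine le_of_pow_le_pow_left₀ (n := n + 1) (by omega) (Nat.zero_le _) ?_
  calc (q ^ n * P) ^ (n + 1) = (q ^ (n + 1) * P) ^ n * P := by ring
    _ ≤ (R.size ^ (n + 1)) ^ n * R.degree b ^ (n + 1) := by gcongr
    _ = _ := by ring

/-- The number of trials is on average at most `1` per draw. -/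
theorem pow_mul_sum_le (hk : 1 ≤ k) {q : ℕ} (hq : q ^ k * R.out ≤ R.size ^ k)
    (m : (Fin k → ℕ) → ℕ) (hm : ∀ a i, m a ≤ (R.semijoinA i (a i)).card) :
    q ^ (k - 1) * ∑ a ∈ R.resultFinset, m a ≤ R.size ^ k := by
  obtain ⟨n, rfl⟩ : ∃ n, k = n + 1 := ⟨k - 1, by omega⟩
  simp only [Nat.add_sub_cancel]
  -- Power mean inequality over the OUT output tuples.
  have h1 : (∑ a ∈ R.resultFinset, m a) ^ (n + 1) ≤
      R.out ^ n * ∑ a ∈ R.resultFinset, m a ^ (n + 1) := by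
    rcases R.resultFinset.eq_empty_or_nonempty with h | h
    · simp [h]
    · have := pow_sum_div_card_le_sum_pow (s := R.resultFinset) (f := fun a => (m a : ℝ))
        (fun _ _ => Nat.cast_nonneg _) n
      rw [div_le_iff₀ (by have := Finset.card_pos.2 h; positivity)] at this
      rw [out_eq_card, mul_comm]
      exact_mod_cast this
  -- The power `m a ^ k` is at most the product of the degrees of the entries. Summed over the full
  -- grid of A-values, this product factorizes into the relation sizes.
  have h2 : ∑ a ∈ R.resultFinset, m a ^ (n + 1) ≤ R.size ^ (n + 1) := by
    calc _ ≤ ∑ a ∈ Fintype.piFinset fun i => (R i).image Prod.fst,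
          ∏ i, (R.semijoinA i (a i)).card := by
          refine (Finset.sum_le_sum fun a _ => ?_).trans
            (Finset.sum_le_sum_of_subset resultFinset_subset)
          rw [← Fin.prod_const]
          exact Finset.prod_le_prod' fun i _ => hm a i
      _ = ∏ i, (R i).card := by
          rw [← Finset.prod_univ_sum (fun i => (R i).image Prod.fst)
            (fun i x => (R.semijoinA i x).card)]
          refine Finset.prod_congr rfl fun i _ => ?_
          exact (Finset.card_eq_sum_card_image Prod.fst (R i)).symm
      _ ≤ ∏ _i : Fin (n + 1), R.size := Finset.prod_le_prod' fun i _ => card_le_size i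
      _ = _ := Fin.prod_const _ _
  refine le_of_pow_le_pow_left₀ (n := n + 1) (by omega) (Nat.zero_le _) ?_
  calc (q ^ n * ∑ a ∈ R.resultFinset, m a) ^ (n + 1)
      = (q ^ (n + 1)) ^ n * (∑ a ∈ R.resultFinset, m a) ^ (n + 1) := by ring
    _ ≤ (q ^ (n + 1)) ^ n * (R.out ^ n * R.size ^ (n + 1)) := by
        gcongr
        exact h1.trans (Nat.mul_le_mul_left _ h2)
    _ = (q ^ (n + 1) * R.out) ^ n * R.size ^ (n + 1) := by ring
    _ ≤ (R.size ^ (n + 1)) ^ n * R.size ^ (n + 1) := by gcongr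
    _ = _ := by ring

theorem out_le_size_pow : R.out ≤ R.size ^ k := by
  rw [out_eq_card]
  calc _ ≤ (Fintype.piFinset fun i => (R i).image Prod.fst).card :=
        Finset.card_le_card resultFinset_subset
    _ = ∏ i, ((R i).image Prod.fst).card := Fintype.card_piFinset _
    _ ≤ ∏ _i : Fin k, R.size :=
        Finset.prod_le_prod' fun i _ => Finset.card_image_le.trans (card_le_size i)
    _ = _ := Fin.prod_const _ _

/-! ### The orderings -/

theorem sum_range_getD {α M : Type*} [AddCommMonoid M] (l : List α) (d : α) (g : α → M) :
    ∑ r ∈ Finset.range l.length, g (l.getD r d) = (l.map g).sum := by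
  rw [Finset.sum_range, ← List.sum_ofFn]
  congr 1
  refine List.ext_getElem (by simp) fun n h1 h2 => ?_
  simp at h1 h2 ⊢

theorem length_eq_card {α : Type*} [DecidableEq α] {l : List α} (hl : l.Nodup) {A : Finset α}
    (hA : ∀ x, x ∈ l ↔ x ∈ A) : l.length = A.card := by
  rw [← List.toFinset_card_of_nodup hl]
  congr 1
  ext x
  rw [List.mem_toFinset, hA]

theorem sum_range_card_getD {α M : Type*} [DecidableEq α] [AddCommMonoid M] {l : List α}
    (hl : l.Nodup) {A : Finset α} (hA : ∀ x, x ∈ l ↔ x ∈ A) (d : α) (g : α → M) :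
    ∑ r ∈ Finset.range A.card, g (l.getD r d) = ∑ x ∈ A, g x := by
  rw [← length_eq_card hl hA, sum_range_getD, ← List.sum_toFinset g hl]
  congr 1
  ext x
  rw [List.mem_toFinset, hA]

theorem getD_mem {α : Type*} [DecidableEq α] {l : List α} (hl : l.Nodup) {A : Finset α}
    (hA : ∀ x, x ∈ l ↔ x ∈ A) (d : α) {r : ℕ} (hr : r < A.card) : l.getD r d ∈ A := by
  rw [← length_eq_card hl hA] at hr
  rw [← hA, List.getD_eq_getElem _ _ hr]
  exact List.getElem_mem _

theorem length_flatMap_tuples (L : R.Ordering) :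
    ((List.finRange k).flatMap L.tuples).length = R.size := by
  rw [List.length_flatMap, size, ← List.ofFn_id, List.map_ofFn, List.sum_ofFn]
  exact Finset.sum_congr rfl fun i _ => length_eq_card (L.tuples_nodup i) (L.mem_tuples i)

/-- A uniform position in the concatenated relations hits a B-value with probability proportional to
its total degree. -/
theorem sum_range_size_getD (L : R.Ordering) (g : ℕ → ℝ) :
    ∑ r ∈ Finset.range R.size, g (((List.finRange k).flatMap L.tuples).getD r (0, 0)).2 =
      ∑ b ∈ R.valuesB, R.degree b * g b := by
  rw [← length_flatMap_tuples L, sum_range_getD _ _ (fun p : ℕ × ℕ => g p.2),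
    ← sum_snd_eq_sum_degree, List.map_flatMap, List.flatMap, List.sum_flatten, List.map_map,
    ← List.ofFn_id, List.map_ofFn, List.sum_ofFn]
  refine Finset.sum_congr rfl fun i _ => ?_
  simp only [Function.comp, id]
  rw [← List.sum_toFinset _ (L.tuples_nodup i)]
  congr 1
  ext p
  rw [List.mem_toFinset, L.mem_tuples]

theorem snd_getD_mem_valuesB (L : R.Ordering) {r : ℕ} (hr : r < R.size) :
    (((List.finRange k).flatMap L.tuples).getD r (0, 0)).2 ∈ R.valuesB := by
  rw [← length_flatMap_tuples L] at hr
  rw [List.getD_eq_getElem _ _ hr]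
  obtain ⟨i, -, hi⟩ := List.mem_flatMap.1 (List.getElem_mem hr)
  rw [L.mem_tuples] at hi
  exact mem_valuesB (a := (((List.finRange k).flatMap L.tuples)[r]).1) hi

theorem degree_pos {b : ℕ} (hb : b ∈ R.valuesB) : 1 ≤ R.degree b := by
  simp only [valuesB, Finset.mem_biUnion, Finset.mem_univ, true_and, Finset.mem_image] at hb
  obtain ⟨i, p, hp, rfl⟩ := hb
  have : 1 ≤ (R.semijoinB i p.2).card :=
    Finset.card_pos.2 ⟨p, by simp [semijoinB, hp]⟩
  exact this.trans (Finset.single_le_sum (f := fun i => (R.semijoinB i p.2).card)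
    (fun _ _ => Nat.zero_le _) (Finset.mem_univ i))

end StarInstance

namespace WordRAM

open scoped ENNReal
open Program StarInstance

variable {k : ℕ} {w : ℕ} {R : StarInstance k} {L : R.Ordering}

/-! ## Bounds for the randomized parts -/

theorem wp_zero_ofList_cons (p : Program k) (l : List (Program k)) (f : State → ℝ≥0∞) (s : State) :
    wp w R L 0 (ofList (p :: l)) f s = wp w R L 0 p (wp w R L 0 (ofList l) f) s := zero_add _

theorem wp_zero_ofList_nil (f : State → ℝ≥0∞) (s : State) :
    wp w R L 0 (ofList ([] : List (Program k))) f s = f s := zero_add _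

theorem wp_zero_basic {I : Instr k} (h : I.Det) (f : State → ℝ≥0∞) (s : State) :
    wp w R L 0 (.basic I) f s = f (I.next w R L s) := wp_zero_of_det (p := .basic I) h f s

theorem ofReal_sum_div {ι : Type*} {A : Finset ι} {n : ℕ} (hn : 1 ≤ n) {g : ι → ℝ}
    {f : ι → ℝ≥0∞} (hg : ∀ i ∈ A, 0 ≤ g i) (h : ∀ i ∈ A, f i ≤ ENNReal.ofReal (g i)) :
    (∑ i ∈ A, f i) / n ≤ ENNReal.ofReal ((∑ i ∈ A, g i) / n) := by
  rw [ENNReal.ofReal_div_of_pos (by positivity), ENNReal.ofReal_sum_of_nonneg hg,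
    ENNReal.ofReal_natCast]
  exact ENNReal.div_le_div_right (Finset.sum_le_sum h) _

/-- Bounds are real-valued from here on, so that differences such as F₁ - F₀ can be used; hence the
recurring nonnegativity side conditions. -/
theorem wp_zero_randInt_le {x z n : ℕ} (hn : 1 ≤ n) {s : State} (h9 : s.reg 9 = 0)
    (hz : s.reg z = n - 1) {f : State → ℝ≥0∞} {g : ℕ → ℝ} (hg : ∀ r < n, 0 ≤ g r)
    (h : ∀ r < n, f (s.setReg w x r) ≤ ENNReal.ofReal (g r)) :
    wp w R L 0 (.basic (.randInt x 9 z)) f s ≤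
      ENNReal.ofReal ((∑ r ∈ Finset.range n, g r) / n) := by
  have hI : Finset.Icc (s.reg 9) (s.reg z) = Finset.range n := by
    ext r
    rw [Finset.mem_Icc, Finset.mem_range]
    omega
  have hne : (Finset.Icc (s.reg 9) (s.reg z)).Nonempty := by
    rw [hI, Finset.nonempty_range_iff]; omega
  simp only [wp, Instr.exec, zero_add]
  rw [dif_pos hne, expect_map, expect_uniformOfFinset, hI, Finset.card_range]
  exact ofReal_sum_div hn (fun r hr => hg r (Finset.mem_range.1 hr))
    fun r hr => h r (Finset.mem_range.1 hr)

/-- The instance can be handled with words of `w` bits. -/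
structure Admissible (w : ℕ) (R : StarInstance k) : Prop where
  one_le : 1 ≤ k
  size_pos : 1 ≤ R.size
  fitsIn : R.FitsIn w
  size_pow_lt : R.size ^ (2 * k) < 2 ^ w

namespace Admissible

variable (h : Admissible w R)
include h

theorem size_pow_lt' {n : ℕ} (hn : n ≤ 2 * k) : R.size ^ n < 2 ^ w :=
  lt_of_le_of_lt (Nat.pow_le_pow_right h.size_pos hn) h.size_pow_lt

theorem size_lt : R.size < 2 ^ w := by
  simpa using h.size_pow_lt' (n := 1) (by have := h.one_le; omega)

theorem one_lt : 1 < 2 ^ w := lt_of_le_of_lt h.size_pos h.size_lt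

theorem card_lt (i : Fin k) : (R i).card < 2 ^ w := (card_le_size i).trans_lt h.size_lt

theorem card_semijoinB_lt (i : Fin k) (b : ℕ) : (R.semijoinB i b).card < 2 ^ w :=
  (card_semijoinB_le_card i b).trans_lt (h.card_lt i)

theorem card_semijoinA_lt (i : Fin k) (b : ℕ) : (R.semijoinA i b).card < 2 ^ w :=
  (card_semijoinA_le_card i b).trans_lt (h.card_lt i)

end Admissible

/-- The registers with the size, the sampling rate, their powers and the constants are prepared. -/
structure Ready (R : StarInstance k) (q : ℕ) (s : State) : Prop where
  reg1 : s.reg 1 = R.size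
  reg2 : s.reg 2 = R.size ^ (k - 1)
  reg3 : s.reg 3 = q
  reg4 : s.reg 4 = q ^ (k - 1)
  reg8 : s.reg 8 = 1
  reg9 : s.reg 9 = 0

theorem Ready.agree {q : ℕ} {s s' : State} (h : Ready R q s) (ha : Agree s s') : Ready R q s' where
  reg1 := (ha 1 (by norm_num)).trans h.reg1
  reg2 := (ha 2 (by norm_num)).trans h.reg2
  reg3 := (ha 3 (by norm_num)).trans h.reg3
  reg4 := (ha 4 (by norm_num)).trans h.reg4
  reg8 := (ha 8 (by norm_num)).trans h.reg8
  reg9 := (ha 9 (by norm_num)).trans h.reg9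

theorem sub_one_mod {d : ℕ} (hd : 1 ≤ d) (hdw : d < 2 ^ w) : (d + 2 ^ w - 1) % 2 ^ w = d - 1 := by
  rw [show d + 2 ^ w - 1 = (d - 1) + 2 ^ w by omega, Nat.add_mod_right]
  exact Nat.mod_eq_of_lt (by omega)

theorem wp_zero_choose_le (hA : Admissible w R) {b : ℕ} {i : Fin k} {s : State}
    (h10 : s.reg 10 = b) (h8 : s.reg 8 = 1) (h9 : s.reg 9 = 0)
    (hd : 1 ≤ (R.semijoinB i b).card) {f : State → ℝ≥0∞} {H : ℕ → ℝ}
    (hH : ∀ x ∈ R.nbrsB i b, 0 ≤ H x)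
    (hf : ∀ x ∈ R.nbrsB i b, ∀ s', Agree s s' → s'.reg 10 = b → s'.reg (20 + i) = x →
      (∀ j ≠ i, s'.reg (20 + j) = s.reg (20 + j)) → f s' ≤ ENNReal.ofReal (H x)) :
    wp w R L 0 (choose i) f s ≤
      ENNReal.ofReal ((∑ x ∈ R.nbrsB i b, H x) / (R.semijoinB i b).card) := by
  have hm : ∀ x, x ∈ L.nbrB i b ↔ x ∈ R.nbrsB i b := fun x => by rw [L.mem_nbrB, mem_nbrsB]
  have hn := L.nbrB_nodup i b
  rw [← sum_range_card_getD hn hm 0 H, card_nbrsB]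
  simp only [choose, wp_zero_ofList_cons, wp_zero_basic, Instr.det_degB, Instr.det_op]
  have hdw := hA.card_semijoinB_lt i b
  refine wp_zero_randInt_le hd ?_ ?_ ?_ ?_
  · simp [Instr.next, State.reg_setReg, h9]
  · simp [Instr.next, State.reg_setReg, h10, Op.eval, h8, Nat.mod_eq_of_lt hdw,
      sub_one_mod hd hdw]
  · intro r hr
    exact hH _ (getD_mem hn hm 0 (by rwa [card_nbrsB]))
  · intro r hr
    have hx := getD_mem hn hm 0 (r := r) (by rwa [card_nbrsB])
    simp only [wp_zero_ofList_cons, wp_zero_basic, wp_zero_ofList_nil, Instr.det_nbrB]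
    have hi : (10 : ℕ) ≤ 20 + i := by omega
    refine hf _ hx _ ?_ ?_ ?_ ?_
    · simp only [Instr.next]
      iterate 4 refine Agree.setReg ?_ (by omega) _
      exact Agree.refl s
    · simp only [Instr.next, State.reg_setReg]
      simp [show ∀ n : ℕ, 10 ≠ 20 + n by omega, h10]
    · simp [Instr.next, State.reg_setReg, -List.getD_eq_getElem?_getD, h10,
        Nat.mod_eq_of_lt (hr.trans hdw)]
      exact Nat.mod_eq_of_lt (hA.fitsIn i _ (mem_nbrsB.1 hx)).1
    · intro j hj
      have : (j : ℕ) ≠ i := fun h => hj (Fin.ext h)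
      simp [Instr.next, State.reg_setReg, this, show ∀ n : ℕ, 20 + n ≠ 12 by omega]

/-- The tuple `a` records the current contents, so that coordinates outside `l` stay frozen. This
makes the induction on the coordinates still to be chosen possible. -/
theorem wp_zero_forAll_choose_le (hA : Admissible w R) {b : ℕ}
    (hd : ∀ i, 1 ≤ (R.semijoinB i b).card) {l : List (Fin k)} (hl : l.Nodup) {s : State}
    (h10 : s.reg 10 = b) (h8 : s.reg 8 = 1) (h9 : s.reg 9 = 0)
    {f : State → ℝ≥0∞} {H : (Fin k → ℕ) → ℝ} (hH : ∀ a, 0 ≤ H a)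
    (a : Fin k → ℕ) (ha : ∀ i : Fin k, s.reg (20 + i) = a i)
    (hf : ∀ a' ∈ Fintype.piFinset fun i => if i ∈ l then R.nbrsB i b else {a i},
      ∀ s', Agree s s' → s'.reg 10 = b → (∀ i : Fin k, s'.reg (20 + i) = a' i) →
        f s' ≤ ENNReal.ofReal (H a')) :
    wp w R L 0 (forAll choose l) f s ≤
      ENNReal.ofReal ((∑ a' ∈ Fintype.piFinset fun i => if i ∈ l then R.nbrsB i b else {a i},
        H a') / (l.map fun i => (R.semijoinB i b).card).prod) := by
  induction l generalizing s a with
  | nil =>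
    have e : (Fintype.piFinset fun i => if i ∈ ([] : List (Fin k)) then R.nbrsB i b else {a i})
        = {a} := by
      ext a'
      simp [funext_iff]
    rw [e] at hf ⊢
    simp only [Finset.sum_singleton, List.map_nil, List.prod_nil, Nat.cast_one, div_one]
    refine (wp_zero_ofList_nil f s).trans_le ?_
    exact hf a (by simp) s (Agree.refl s) h10 ha
  | cons i l ih =>
    obtain ⟨hil, hl⟩ := List.nodup_cons.1 hl
    -- Fixing the choice x at coordinate i moves that coordinate from the free to the frozen ones.
    have e : ∀ x ∈ R.nbrsB i b,
        (Fintype.piFinset fun j => if j ∈ i :: l then R.nbrsB j b else {a j}).filter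
          (fun a' => a' i = x) =
        Fintype.piFinset fun j => if j ∈ l then R.nbrsB j b else {Function.update a i x j} := by
      intro x hx
      ext a'
      simp only [Finset.mem_filter, Fintype.mem_piFinset, List.mem_cons]
      constructor
      · rintro ⟨h1, rfl⟩ j
        have := h1 j
        by_cases hji : j = i
        · subst hji
          simp [hil]
        · simpa [hji] using this
      · intro h1
        have hi := h1 i
        simp only [hil, if_false, Function.update_self, Finset.mem_singleton] at hi
        refine ⟨fun j => ?_, hi⟩
        have := h1 j
        by_cases hji : j = i
        · subst hji
          simpa [hi] using hx
        · simpa [hji] using this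
    have hsum : ∑ a' ∈ Fintype.piFinset fun j => if j ∈ i :: l then R.nbrsB j b else {a j}, H a' =
        ∑ x ∈ R.nbrsB i b, ∑ a' ∈ Fintype.piFinset fun j =>
          if j ∈ l then R.nbrsB j b else {Function.update a i x j}, H a' := by
      rw [← Finset.sum_fiberwise_of_maps_to (t := R.nbrsB i b) (g := fun a' => a' i)]
      · exact Finset.sum_congr rfl fun x hx => by rw [e x hx]
      · intro a' ha'
        simpa using Fintype.mem_piFinset.1 ha' i
    rw [wp_zero_forAll_cons, hsum, List.map_cons, List.prod_cons, Nat.cast_mul, div_mul_eq_div_div_swap,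
      Finset.sum_div]
    refine wp_zero_choose_le hA h10 h8 h9 (hd i) (fun x _ => ?_) fun x hx s' hs' h10' hi hj => ?_
    · exact div_nonneg (Finset.sum_nonneg fun a _ => hH a) (Nat.cast_nonneg _)
    · refine ih hl h10' ((hs' 8 (by norm_num)).trans h8) ((hs' 9 (by norm_num)).trans h9)
        (Function.update a i x) (fun j => ?_) fun a' ha' s'' h1 h2 h3 => ?_
      · by_cases hji : j = i
        · subst hji; simp [hi]
        · simp [hji, hj j hji, ha]
      · refine hf a' ?_ s'' (hs'.trans h1) h2 h3
        rw [← e x hx] at ha'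
        exact (Finset.mem_filter.1 ha').1

theorem det_forAll_check (l : List (Fin k)) : (forAll check l).Det :=
  det_forAll (fun i => det_ofList fun p hp => by
    simp only [List.mem_cons, List.not_mem_nil, or_false] at hp
    rcases hp with rfl | rfl <;> trivial) l

theorem wp_zero_trial_le (hA : Admissible w R) {a : Fin k → ℕ} {b : ℕ} (i : Fin k) {s : State}
    (ha : ∀ j : Fin k, s.reg (20 + j) = a j)
    (h10 : s.reg 10 = b) (h8 : s.reg 8 = 1) (h9 : s.reg 9 = 0)
    (hd : 1 ≤ (R.semijoinA i (a i)).card) {f : State → ℝ≥0∞} {H : ℕ → ℝ}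
    (hH : ∀ b' ∈ R.nbrsA i (a i), 0 ≤ H b')
    (hf : ∀ b' ∈ R.nbrsA i (a i), ∀ s', Agree s s' → s'.reg 10 = b →
      (∀ j : Fin k, s'.reg (20 + j) = a j) →
      s'.reg 15 = (if b' ∈ R.witnesses a then 0 else 1) →
      s'.reg 16 = (if b' = b then 1 else 0) → f s' ≤ ENNReal.ofReal (H b')) :
    wp w R L 0 (trial i) f s ≤
      ENNReal.ofReal ((∑ x ∈ R.nbrsA i (a i), H x) / (R.semijoinA i (a i)).card) := by
  have hm : ∀ x, x ∈ L.nbrA i (a i) ↔ x ∈ R.nbrsA i (a i) := fun x => by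
    rw [L.mem_nbrA, mem_nbrsA]
  have hn := L.nbrA_nodup i (a i)
  have hne' : ∀ c n : ℕ, c < 20 → 20 + n ≠ c := by omega
  rw [← sum_range_card_getD hn hm 0 H, card_nbrsA]
  simp only [trial, wp_zero_ofList_cons, wp_zero_basic, Instr.det_degA, Instr.det_op]
  have hdw := hA.card_semijoinA_lt i (a i)
  refine wp_zero_randInt_le hd ?_ ?_ ?_ ?_
  · simp [Instr.next, State.reg_setReg, h9]
  · simp [Instr.next, State.reg_setReg, ha, Op.eval, h8, Nat.mod_eq_of_lt hdw,
      sub_one_mod hd hdw]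
  · intro r hr
    exact hH _ (getD_mem hn hm 0 (by rwa [card_nbrsA]))
  · intro r hr
    set b' := (L.nbrA i (a i)).getD r 0 with hb'
    have hx := getD_mem hn hm 0 (r := r) (by rwa [card_nbrsA])
    rw [← hb'] at hx
    have hbw : b' < 2 ^ w := (hA.fitsIn i _ (mem_nbrsA.1 hx)).2
    simp only [wp_zero_ofList_cons, wp_zero_basic, wp_zero_ofList_nil, Instr.det_nbrA,
      Instr.det_const, Instr.det_op,
      wp_zero_of_det (det_forAll_check _)]
    refine (fun (h : _ ∧ _ ∧ _ ∧ _ ∧ _) => hf b' hx _ h.1 h.2.1 h.2.2.1 h.2.2.2.1 h.2.2.2.2) ?_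
    set s1 := Instr.next w R L (Instr.next w R L ((Instr.next w R L (Instr.next w R L s
      (.degA i 12 (20 + i))) (.op .sub 12 12 8)).setReg w 12 r) (.nbrA i 11 (20 + i) 12))
        (.const 16 1) with hs1
    have s1a : Agree s s1 := by
      simp only [hs1, Instr.next]
      iterate 5 refine Agree.setReg ?_ (by omega) _
      exact Agree.refl s
    have s1j : ∀ j : Fin k, s1.reg (20 + j) = a j := fun j => by
      simp [hs1, Instr.next, State.reg_setReg, hne', ha]
    have s10 : s1.reg 10 = b := by
      simp [hs1, Instr.next, State.reg_setReg, h10]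
    have s11 : s1.reg 11 = b' := by
      simp [hs1, Instr.next, State.reg_setReg, -List.getD_eq_getElem?_getD, hne', ha,
        Nat.mod_eq_of_lt (hr.trans hdw), ← hb', Nat.mod_eq_of_lt hbw]
    have s16 : s1.reg 16 = 1 := by
      simp [hs1, Instr.next, State.reg_setReg, Nat.mod_eq_of_lt hA.one_lt]
    obtain ⟨e1, e2⟩ := eval_forAll_check (w := w) (R := R) (L := L) (List.finRange k) s1 hA.one_lt
      s16.le
    set s2 := eval w R L (forAll check (List.finRange k)) s1 with hs2
    have hw16 : s2.reg 16 = if b' ∈ R.witnesses a then 1 else 0 := by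
      simp only [e1, s1j, s11, s16, List.mem_finRange, forall_true_left, mem_witnesses hA.one_le]
    clear_value s2
    have s2a : Agree s s2 := fun y hy => (e2 y (by omega) (by omega)).trans (s1a y hy)
    have e2j : ∀ j : Fin k, s2.reg (20 + j) = a j := fun j =>
      (e2 _ (by omega) (by omega)).trans (s1j j)
    have e210 : s2.reg 10 = b := (e2 _ (by omega) (by omega)).trans s10
    have e211 : s2.reg 11 = b' := (e2 _ (by omega) (by omega)).trans s11
    have e209 : s2.reg 9 = 0 := (s2a 9 (by norm_num)).trans h9
    clear_value s1 b'
    clear hf hH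
    simp only [Instr.next, State.reg_setReg, Op.eval, hw16, e209, e210, e211]
    refine ⟨?_, ?_, ?_, ?_, ?_⟩
    · iterate 2 refine Agree.setReg ?_ (by omega) _
      exact s2a
    · simp
    · intro j
      rw [if_neg (by omega), if_neg (by omega), e2j]
    · rw [if_neg (by norm_num), if_pos trivial]
      by_cases hbb : b' ∈ R.witnesses a
      · simp only [if_pos hbb, one_ne_zero, if_false, Nat.zero_mod]
      · simp only [if_neg hbb, if_true, Nat.mod_eq_of_lt hA.one_lt]
    · rw [if_pos trivial]
      by_cases hbb : b' = b
      · simp [hbb, Nat.mod_eq_of_lt hA.one_lt]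
      · simp [hbb]

theorem natCast_mul_ofReal (n : ℕ) (x : ℝ) :
    (n : ℝ≥0∞) * ENNReal.ofReal x = ENNReal.ofReal (n * x) := by
  rw [ENNReal.ofReal_mul n.cast_nonneg, ENNReal.ofReal_natCast]

/-- The values of `A₁, …, A_k` and `B` are stored, and the registers below `10` are unchanged. -/
structure Chosen (s₀ : State) (a : Fin k → ℕ) (b : ℕ) (s : State) : Prop where
  agree : Agree s₀ s
  reg10 : s.reg 10 = b
  regA : ∀ j : Fin k, s.reg (20 + j) = a j

theorem wp_zero_forAll_guardedTrial_of_zero (l : List (Fin k)) (f : State → ℝ≥0∞) (s : State)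
    (h : s.reg 15 = 0) : wp w R L 0 (forAll guardedTrial l) f s = f s := by
  induction l with
  | nil => exact wp_zero_ofList_nil f s
  | cons i l ih =>
    rw [wp_zero_forAll_cons]
    simp [guardedTrial, wp, h, ih]

theorem sum_nbrsA_ite (hA : Admissible w R) {a : Fin k → ℕ} {b : ℕ} (hb : b ∈ R.witnesses a)
    (i : Fin k) (F₀ F₁ V : ℝ) :
    ∑ b' ∈ R.nbrsA i (a i), (if b' ∈ R.witnesses a then (if b' = b then F₁ else F₀) else V) =
      F₁ + ((R.witnesses a).card - 1) * F₀ +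
        ((R.semijoinA i (a i)).card - (R.witnesses a).card) * V := by
  have hsub : R.witnesses a ⊆ R.nbrsA i (a i) := fun b' hb' =>
    mem_nbrsA.2 ((mem_witnesses hA.one_le).1 hb' i)
  rw [← Finset.sum_sdiff hsub, add_comm]
  congr 1
  · rw [Finset.sum_congr rfl (g := fun b' => if b' = b then F₁ else F₀)
      (fun b' hb' => if_pos hb'), ← Finset.add_sum_erase _ _ hb, if_pos rfl,
      Finset.sum_congr rfl (g := fun _ => F₀)
      (fun b' hb' => if_neg (Finset.ne_of_mem_erase hb')), Finset.sum_const, nsmul_eq_mul,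
      Finset.card_erase_of_mem hb, Nat.cast_sub (Finset.card_pos.2 ⟨b, hb⟩), Nat.cast_one]
  · rw [Finset.sum_congr rfl (g := fun _ => V)
      (fun b' hb' => if_neg (Finset.mem_sdiff.1 hb').2), Finset.sum_const, nsmul_eq_mul,
      Finset.card_sdiff_of_subset hsub, Nat.cast_sub (Finset.card_le_card hsub), card_nbrsA]

/-- A trial at i ends the search with probability |W(a)|/deg(a_i). Given that, the neighbor found is
uniform in W(a), so the mean value is G whichever i was used. The surcharge E for going on survives
a round only with the product of the failure probabilities. -/
theorem wp_zero_forAll_guardedTrial_le (hA : Admissible w R) {a : Fin k → ℕ} {b : ℕ}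
    (hb : b ∈ R.witnesses a) {s₀ : State} (h8 : s₀.reg 8 = 1) (h9 : s₀.reg 9 = 0)
    {I : State → ℝ≥0∞} {F₀ F₁ G E : ℝ} (hF₀ : 0 ≤ F₀) (hF₁ : 0 ≤ F₁) (hE : 0 ≤ E)
    (hG : (R.witnesses a).card * G = F₁ + ((R.witnesses a).card - 1) * F₀)
    (hV : ∀ s, Chosen s₀ a b s → s.reg 15 = 1 → I s ≤ ENNReal.ofReal (G + E))
    (h₁ : ∀ s, Chosen s₀ a b s → s.reg 15 = 0 → s.reg 16 = 1 → I s ≤ ENNReal.ofReal F₁)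
    (h₀ : ∀ s, Chosen s₀ a b s → s.reg 15 = 0 → s.reg 16 = 0 → I s ≤ ENNReal.ofReal F₀)
    (l : List (Fin k)) (s : State) (hs : Chosen s₀ a b s) (h15 : s.reg 15 = 1) :
    wp w R L 0 (forAll guardedTrial l) I s ≤ ENNReal.ofReal
      (G + E * (l.map fun i =>
        (1 - (R.witnesses a).card / (R.semijoinA i (a i)).card : ℝ)).prod) := by
  have hW : (1 : ℝ) ≤ (R.witnesses a).card := by exact_mod_cast Finset.card_pos.2 ⟨b, hb⟩
  have hG0 : 0 ≤ G := by
    have : 0 ≤ (R.witnesses a).card * G := by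
      rw [hG]; exact add_nonneg hF₁ (mul_nonneg (by linarith) hF₀)
    exact nonneg_of_mul_nonneg_right this (by linarith)
  have hle : ∀ i, ((R.witnesses a).card : ℝ) ≤ (R.semijoinA i (a i)).card := fun i => by
    exact_mod_cast card_witnesses_le_card_semijoinA hA.one_le a i
  have hfac : ∀ i, (0 : ℝ) ≤ 1 - (R.witnesses a).card / (R.semijoinA i (a i)).card := fun i => by
    have := hle i
    rw [sub_nonneg, div_le_one (by linarith)]
    exact this
  induction l generalizing s with
  | nil =>
    rw [List.map_nil, List.prod_nil, mul_one]
    exact (wp_zero_ofList_nil I s).trans_le (hV s hs h15)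
  | cons i l ih =>
    rw [wp_zero_forAll_cons]
    have hprod : 0 ≤ (l.map fun i =>
        (1 - (R.witnesses a).card / (R.semijoinA i (a i)).card : ℝ)).prod :=
      List.prod_nonneg fun x hx => by
        obtain ⟨i, -, rfl⟩ := List.mem_map.1 hx
        exact hfac i
    rw [List.map_cons, List.prod_cons]
    set π := (l.map fun i => (1 - (R.witnesses a).card / (R.semijoinA i (a i)).card : ℝ)).prod
    have hd : 1 ≤ (R.semijoinA i (a i)).card := by exact_mod_cast hW.trans (hle i)
    have hV0 : 0 ≤ G + E * π := add_nonneg hG0 (mul_nonneg hE hprod)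
    simp only [guardedTrial, wp, h15, zero_add, ne_eq, one_ne_zero, not_false_eq_true, if_true]
    refine (wp_zero_trial_le hA i hs.regA hs.reg10 ((hs.agree 8 (by norm_num)).trans h8)
      ((hs.agree 9 (by norm_num)).trans h9) hd
      (H := fun b' => if b' ∈ R.witnesses a then (if b' = b then F₁ else F₀) else G + E * π)
      (fun b' _ => by split_ifs <;> assumption) ?_).trans ?_
    · intro b' hb' s' ha' h10' hA' h15' h16'
      have hs' : Chosen s₀ a b s' := ⟨hs.agree.trans ha', h10', hA'⟩
      by_cases hbw : b' ∈ R.witnesses a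
      · rw [if_pos hbw] at h15'
        rw [wp_zero_forAll_guardedTrial_of_zero _ _ _ h15']
        simp only [if_pos hbw]
        by_cases hbb : b' = b
        · rw [if_pos hbb] at h16' ⊢
          exact h₁ s' hs' h15' h16'
        · rw [if_neg hbb] at h16' ⊢
          exact h₀ s' hs' h15' h16'
      · rw [if_neg hbw] at h15'
        simp only [if_neg hbw]
        exact ih s' hs' h15'
    · rw [sum_nbrsA_ite hA hb, ← hG]
      refine le_of_eq ?_
      congr 1
      have hd0 : ((R.semijoinA i (a i)).card : ℝ) ≠ 0 := by
        have : (1 : ℝ) ≤ (R.semijoinA i (a i)).card := by exact_mod_cast hd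
        linarith
      field_simp
      ring

theorem loopFree_of_mem {l : List (Program k)} (h : l.Forall LoopFree) : (ofList l).LoopFree :=
  loopFree_ofList fun p hp => List.forall_iff_forall_mem.1 h p hp

theorem loopFree_guardedTrial (i : Fin k) : (guardedTrial i).LoopFree :=
  ⟨loopFree_of_mem ⟨trivial, trivial, trivial, trivial, trivial,
    (det_forAll_check _).loopFree, trivial, trivial⟩, trivial⟩

/-- A bound for the running time of one round of trials. -/
def roundCost (k : ℕ) : ℕ := (forAll guardedTrial (List.finRange k)).len + 1

/-- The bound holds for every `i`, although the program does not know the best one: each round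
contains a trial at `i`, so the number of rounds is dominated by a geometric variable with mean
deg(a_i)/|W(a)|. -/
theorem wp_trials_le (hA : Admissible w R) {τ : ℝ} (hτ : 0 ≤ τ) {a : Fin k → ℕ} {b : ℕ}
    (hb : b ∈ R.witnesses a) {s₀ : State} (h8 : s₀.reg 8 = 1) (h9 : s₀.reg 9 = 0)
    {f : State → ℝ≥0∞} {F₀ F₁ : ℝ} (hF₀ : 0 ≤ F₀) (hF₁ : 0 ≤ F₁)
    (h₁ : ∀ s, Chosen s₀ a b s → s.reg 16 = 1 → f s ≤ ENNReal.ofReal F₁)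
    (h₀ : ∀ s, Chosen s₀ a b s → s.reg 16 = 0 → f s ≤ ENNReal.ofReal F₀)
    (i : Fin k) {s : State} (hs : Chosen s₀ a b s) (h15 : s.reg 15 = 1) :
    wp w R L (ENNReal.ofReal τ) trials f s ≤ ENNReal.ofReal
      (F₀ + τ + (F₁ - F₀ + roundCost k * τ * (R.semijoinA i (a i)).card) /
        (R.witnesses a).card) := by
  classical
  have hW : (1 : ℝ) ≤ (R.witnesses a).card := by exact_mod_cast Finset.card_pos.2 ⟨b, hb⟩
  have hle : ∀ i, ((R.witnesses a).card : ℝ) ≤ (R.semijoinA i (a i)).card := fun i => by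
    exact_mod_cast card_witnesses_le_card_semijoinA hA.one_le a i
  set W : ℝ := ((R.witnesses a).card : ℝ) with hWdef
  set G : ℝ := F₀ + τ + (F₁ - F₀) / W with hG
  set E : ℝ := roundCost k * τ * (R.semijoinA i (a i)).card / W with hE
  have hE0 : 0 ≤ E := by positivity
  have hWG : W * G = (F₁ + τ) + (W - 1) * (F₀ + τ) := by rw [hG]; field_simp; ring
  have hG0 : 0 ≤ G := by
    have : 0 ≤ W * G := by
      rw [hWG]; exact add_nonneg (by linarith) (mul_nonneg (by linarith) (by linarith))
    exact nonneg_of_mul_nonneg_right this (by linarith)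
  -- The value ⊤ makes the invariant trivial at states that the loop cannot reach.
  let I : State → ℝ≥0∞ := fun s => if Chosen s₀ a b s ∧ s.reg 15 ≤ 1 then
    (if s.reg 15 = 1 then ENNReal.ofReal (G + E) else ENNReal.ofReal τ + f s) else ⊤
  have hI : wp w R L (ENNReal.ofReal τ) trials f s ≤ I s := by
    refine wp_loop_le I (fun s hs => ?_) (fun s hs => ?_) s
    · refine (min_le_right _ _).trans ?_
      by_cases hc : Chosen s₀ a b s ∧ s.reg 15 ≤ 1
      · have h1 : s.reg 15 = 1 := by omega
        simp only [I, if_pos hc, if_pos h1]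
        have hbody := wp_zero_forAll_guardedTrial_le (L := L) hA hb h8 h9 (I := I)
          (F₀ := F₀ + τ) (F₁ := F₁ + τ) (G := G) (E := E) (by linarith) (by linarith) hE0 hWG
          (fun s hs h => by simp only [I, if_pos (⟨hs, h.le⟩ : _ ∧ _), if_pos h]; exact le_rfl)
          (fun s hs h h' => by
            simp only [I, if_pos (⟨hs, by omega⟩ : Chosen s₀ a b s ∧ s.reg 15 ≤ 1), h,
              zero_ne_one, if_false]
            rw [add_comm, ENNReal.ofReal_add hF₁ hτ]
            exact add_le_add (h₁ s hs h') le_rfl)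
          (fun s hs h h' => by
            simp only [I, if_pos (⟨hs, by omega⟩ : Chosen s₀ a b s ∧ s.reg 15 ≤ 1), h,
              zero_ne_one, if_false]
            rw [add_comm, ENNReal.ofReal_add hF₀ hτ]
            exact add_le_add (h₀ s hs h') le_rfl)
          (List.finRange k) s hc.1 h1
        -- All failure probabilities but the one at i are bounded by 1.
        have hprod : ((List.finRange k).map fun i =>
            (1 - W / (R.semijoinA i (a i)).card : ℝ)).prod ≤
              1 - W / (R.semijoinA i (a i)).card := by
          have h01 : ∀ i, 0 ≤ 1 - W / (R.semijoinA i (a i)).card ∧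
              1 - W / (R.semijoinA i (a i)).card ≤ 1 := fun i => by
            have := hle i
            constructor
            · rw [sub_nonneg, div_le_one (by linarith)]
              exact this
            · have : 0 ≤ W / (R.semijoinA i (a i)).card := by positivity
              linarith
          rw [← List.ofFn_id, List.map_ofFn, List.prod_ofFn,
            ← Finset.mul_prod_erase _ _ (Finset.mem_univ i)]
          exact mul_le_of_le_one_right (h01 i).1
            (Finset.prod_le_one (fun j _ => (h01 j).1) fun j _ => (h01 j).2)
        have hlen := wp_le_len_mul_add (w := w) (L := L) (τ := ENNReal.ofReal τ)
          (loopFree_forAll loopFree_guardedTrial (List.finRange k)) I s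
        calc _ ≤ ENNReal.ofReal τ + (((forAll guardedTrial (List.finRange k)).len *
              ENNReal.ofReal τ) + ENNReal.ofReal (G + E * (1 - W / (R.semijoinA i (a i)).card))) := by
              refine add_le_add le_rfl (hlen.trans (add_le_add le_rfl (hbody.trans ?_)))
              exact ENNReal.ofReal_le_ofReal
                (add_le_add le_rfl (mul_le_mul_of_nonneg_left hprod hE0))
          _ = ENNReal.ofReal (roundCost k * τ + (G + E * (1 - W / (R.semijoinA i (a i)).card))) := by
              have := hle i
              have h3 : 0 ≤ G + E * (1 - W / (R.semijoinA i (a i)).card) := by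
                refine add_nonneg hG0 (mul_nonneg hE0 ?_)
                rw [sub_nonneg, div_le_one (by linarith)]
                exact this
              rw [natCast_mul_ofReal, ← ENNReal.ofReal_add (by positivity) h3,
                ← ENNReal.ofReal_add hτ (by positivity), roundCost]
              congr 1
              push_cast
              ring
          -- E was chosen as the solution of E = `roundCost k` · τ + E (1 - |W(a)|/deg(a_i)).
          _ = ENNReal.ofReal (G + E) := by
              congr 1
              have h2 : (0:ℝ) < (R.semijoinA i (a i)).card := by linarith [hle i]
              rw [hE]
              field_simp
              ring
      · simp only [I, if_neg hc]; exact le_top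
    · refine (min_le_right _ _).trans ?_
      by_cases hc : Chosen s₀ a b s ∧ s.reg 15 ≤ 1
      · simp only [I, if_pos hc, hs, zero_ne_one, if_false]
        exact le_rfl
      · simp only [I, if_neg hc]; exact le_top
  refine hI.trans (le_of_eq ?_)
  simp only [I, if_pos (⟨hs, h15.le⟩ : _ ∧ _), if_pos h15]
  congr 1
  rw [hG, hE]
  ring

end WordRAM

/-! ### The smallest degree of an entry, which governs the length of the search. -/

namespace StarInstance

variable {k : ℕ} {R : StarInstance k}

/-- The smallest degree of an entry of a tuple. -/
noncomputable def minDegree (R : StarInstance k) (a : Fin k → ℕ) : ℕ :=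
  ⨅ i, (R.semijoinA i (a i)).card

theorem minDegree_le (a : Fin k → ℕ) (i : Fin k) :
    R.minDegree a ≤ (R.semijoinA i (a i)).card :=
  ciInf_le (OrderBot.bddBelow _) i

theorem exists_card_eq_minDegree (hk : 1 ≤ k) (a : Fin k → ℕ) :
    ∃ i, (R.semijoinA i (a i)).card = R.minDegree a :=
  haveI : Nonempty (Fin k) := ⟨⟨0, hk⟩⟩
  exists_eq_ciInf_of_finite

theorem sum_degree : ∑ b ∈ R.valuesB, (R.degree b : ℝ) = R.size := by
  have := sum_snd_eq_sum_degree (R := R) (fun _ => 1)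
  simp only [Finset.sum_const, nsmul_eq_mul, mul_one] at this
  rw [← this, size, Nat.cast_sum]

end StarInstance

/-! ### Analysis of one draw. -/

namespace WordRAM

open scoped ENNReal
open Program StarInstance

variable {k : ℕ} {w : ℕ} {R : StarInstance k} {L : R.Ordering}

theorem det_degrees (i : Fin k) : (degrees i).Det :=
  ⟨trivial, trivial, trivial, trivial⟩

theorem det_locate (i : Fin k) : (locate i).Det :=
  ⟨⟨trivial, trivial, ⟨⟨trivial, trivial, trivial⟩, trivial⟩, trivial⟩, trivial⟩

theorem loopFree_drawTuple : (drawTuple : Program k).LoopFree :=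
  ⟨trivial, trivial, trivial, (det_forAll det_locate _).loopFree, trivial⟩

theorem loopFree_drawAccept : (drawAccept : Program k).LoopFree :=
  ⟨trivial, trivial, (det_forAll det_degrees _).loopFree, trivial, trivial, trivial, trivial,
    trivial⟩

theorem loopFree_drawValues : (drawValues : Program k).LoopFree :=
  ⟨loopFree_forAll (p := choose) (fun _ => ⟨trivial, trivial, trivial, trivial, trivial⟩) _, trivial⟩

theorem wp_zero_drawTuple_le (hA : Admissible w R) {q : ℕ} {s : State} (hs : Ready R q s)
    {f : State → ℝ≥0∞} {H : ℕ → ℝ} (hH : ∀ b ∈ R.valuesB, 0 ≤ H b)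
    (hf : ∀ b ∈ R.valuesB, ∀ s', Agree s s' → s'.reg 10 = b → f s' ≤ ENNReal.ofReal (H b)) :
    wp w R L 0 drawTuple f s ≤
      ENNReal.ofReal ((∑ b ∈ R.valuesB, R.degree b * H b) / R.size) := by
  rw [← sum_range_size_getD L]
  simp only [drawTuple, wp_zero_ofList_cons, wp_zero_basic, Instr.det_op]
  refine wp_zero_randInt_le hA.size_pos ?_ ?_ ?_ ?_
  · simp [Instr.next, State.reg_setReg, hs.reg9]
  · simp [Instr.next, State.reg_setReg, hs.reg1, hs.reg8, Op.eval,
      sub_one_mod hA.size_pos hA.size_lt]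
  · exact fun r hr => hH _ (snd_getD_mem_valuesB L hr)
  · intro r hr
    simp only [wp_zero_ofList_cons, wp_zero_basic, wp_zero_ofList_nil, Instr.det_const,
      wp_zero_of_det (det_forAll det_locate _)]
    set s1 := Instr.next w R L ((Instr.next w R L s (.op .sub 11 1 8)).setReg w 11 r)
      (.const 15 1) with hs1
    have s1a : Agree s s1 := by
      simp only [hs1, Instr.next]
      iterate 3 refine Agree.setReg ?_ (by omega) _
      exact Agree.refl s
    have s15 : s1.reg 15 = 1 := by
      simp [hs1, Instr.next, State.reg_setReg, Nat.mod_eq_of_lt hA.one_lt]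
    have s11 : s1.reg 11 = r := by
      simp [hs1, Instr.next, State.reg_setReg, Nat.mod_eq_of_lt (hr.trans hA.size_lt)]
    have := eval_forAll_locate (L := L) hA.fitsIn hA.card_lt (List.finRange k) s1 s15
      (by rw [s11, length_flatMap_tuples]; exact hr) (by rw [s11]; exact hr.trans hA.size_lt)
      hA.one_lt
    rw [s11] at this
    exact hf _ (snd_getD_mem_valuesB L hr) _ (s1a.trans this.2) this.1

/-- Acceptance compares a uniform integer below Z with T; the hypothesis T ≤ Z makes T/Z the exact
probability. An accepted b has a neighbor in every relation. -/
theorem wp_zero_drawAccept_le (hA : Admissible w R) {q : ℕ} (hqN : q ≤ R.size) {s : State}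
    (hs : Ready R q s) {b : ℕ} (hb : b ∈ R.valuesB) (h10 : s.reg 10 = b)
    (hq : q ^ (k - 1) * ∏ i, (R.semijoinB i b).card ≤ R.degree b * R.size ^ (k - 1))
    {f : State → ℝ≥0∞} {A B : ℝ} (hA0 : 0 ≤ A) (hB0 : 0 ≤ B)
    (h₁ : 0 < ∏ i, (R.semijoinB i b).card → ∀ s', Agree s s' → s'.reg 10 = b → s'.reg 11 = 1 →
      f s' ≤ ENNReal.ofReal A)
    (h₀ : ∀ s', Agree s s' → s'.reg 10 = b → s'.reg 11 = 0 → f s' ≤ ENNReal.ofReal B) :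
    wp w R L 0 drawAccept f s ≤ ENNReal.ofReal (B + (A - B) *
      ((q ^ (k - 1) * ∏ i, (R.semijoinB i b).card : ℕ) /
        (R.degree b * R.size ^ (k - 1) : ℕ))) := by
  have hk := hA.one_le
  set T := q ^ (k - 1) * ∏ i, (R.semijoinB i b).card with hT
  set Z := R.degree b * R.size ^ (k - 1) with hZ
  have hZ1 : 1 ≤ Z := Nat.mul_pos (degree_pos hb) (pow_pos hA.size_pos _)
  have hZw : Z < 2 ^ w := by
    refine lt_of_le_of_lt (Nat.mul_le_mul_right _ (degree_le_size b)) ?_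
    rw [← pow_succ']
    exact hA.size_pow_lt' (by omega)
  have hsum : ((List.finRange k).map fun i => (R.semijoinB i b).card).sum = R.degree b := by
    rw [← List.ofFn_id, List.map_ofFn, List.sum_ofFn]; rfl
  have hprod : ((List.finRange k).map fun i => (R.semijoinB i b).card).prod =
      ∏ i, (R.semijoinB i b).card := by
    rw [← List.ofFn_id, List.map_ofFn, List.prod_ofFn]; rfl
  -- This product bounds the intermediate values of T and is the reason for the exponent 2k in
  -- `Admissible`.
  have hpw : q ^ (k - 1) * R.size ^ k < 2 ^ w := by
    refine lt_of_le_of_lt (Nat.mul_le_mul_right _ (Nat.pow_le_pow_left hqN _)) ?_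
    rw [← pow_add]
    exact hA.size_pow_lt' (by omega)
  have hqw : q ^ (k - 1) < 2 ^ w :=
    lt_of_le_of_lt (Nat.le_mul_of_pos_right _ (pow_pos hA.size_pos _)) hpw
  simp only [drawAccept, wp_zero_ofList_cons, wp_zero_basic, Instr.det_op, Instr.det_const,
    wp_zero_of_det (det_forAll det_degrees _)]
  set s1 := Instr.next w R L (Instr.next w R L s (.const 11 0)) (.op .add 13 4 9) with hs1
  have s1a : Agree s s1 := by
    simp only [hs1, Instr.next]
    iterate 2 refine Agree.setReg ?_ (by omega) _
    exact Agree.refl s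
  have s10 : s1.reg 10 = b := by simp [hs1, Instr.next, State.reg_setReg, h10]
  have s11 : s1.reg 11 = 0 := by simp [hs1, Instr.next, State.reg_setReg]
  have s13 : s1.reg 13 = q ^ (k - 1) := by
    simp [hs1, Instr.next, State.reg_setReg, Op.eval, hs.reg4, hs.reg9, Nat.mod_eq_of_lt hqw]
  have hdeg := eval_forAll_degrees (w := w) (R := R) (L := L) b R.size (List.finRange k) s1 s10
    (fun i => (card_semijoinB_le_card i b).trans (card_le_size i)) hA.size_pos hA.size_lt
    (by rw [s11, hsum, zero_add]; exact (degree_le_size b).trans_lt hA.size_lt)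
    (by rw [s13, List.length_finRange]; exact hpw)
  rw [s11, hsum, zero_add, s13, hprod, ← hT] at hdeg
  set s2 := eval w R L (forAll degrees (List.finRange k)) s1 with hs2
  clear_value s2 s1
  obtain ⟨d11, d13, d10, da⟩ := hdeg
  have s2a := s1a.trans da
  have hr2 := hs.agree s2a
  have hval : B + (A - B) * ((T : ℝ) / (Z : ℝ)) =
      (∑ r ∈ Finset.range Z, if r < T then A else B) / Z := by
    have hZ0 : (Z : ℝ) ≠ 0 := by positivity
    have hcard : (Finset.filter (fun r => r < T) (Finset.range Z)).card = T := by
      rw [show Finset.filter (fun r => r < T) (Finset.range Z) = Finset.range T by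
        ext r; simp only [Finset.mem_filter, Finset.mem_range]; omega, Finset.card_range]
    have hcard' : (Finset.filter (fun r => ¬ r < T) (Finset.range Z)).card = Z - T := by
      have := Finset.card_filter_add_card_filter_not (s := Finset.range Z) (fun r => r < T)
      rw [hcard, Finset.card_range] at this
      omega
    rw [Finset.sum_ite, Finset.sum_const, Finset.sum_const, hcard, hcard', nsmul_eq_mul,
      nsmul_eq_mul, Nat.cast_sub hq]
    field_simp
    ring
  rw [hval]
  refine wp_zero_randInt_le hZ1 ?_ ?_ ?_ ?_
  · simp [Instr.next, State.reg_setReg, hr2.reg9]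
  · simp [Instr.next, State.reg_setReg, Op.eval, d11, hr2.reg2, hr2.reg8, ← hZ,
      Nat.mod_eq_of_lt hZw, sub_one_mod hZ1 hZw]
  · intro r _
    split_ifs <;> assumption
  · intro r hr
    simp only [wp_zero_ofList_cons, wp_zero_basic, wp_zero_ofList_nil, Instr.det_op]
    simp only [Instr.next, State.reg_setReg, Op.eval]
    simp only [if_true, Nat.reduceEqDiff, if_false, d13,
      Nat.mod_eq_of_lt (hr.trans hZw)]
    have haf : ∀ v₁ v₂ v₃ v₄, Agree s ((((s2.setReg w 11 v₁).setReg w 11 v₂).setReg w 11 v₃).setReg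
        w 11 v₄) := fun v₁ v₂ v₃ v₄ => by
      iterate 4 refine Agree.setReg ?_ (by omega) _
      exact s2a
    by_cases hrT : r < T
    · simp only [if_pos hrT]
      refine h₁ ?_ _ (haf _ _ _ _) ?_ ?_
      · exact Nat.pos_of_mul_pos_left (by rw [← hT]; omega)
      · simp [State.reg_setReg, d10]
      · simp [State.reg_setReg, Nat.mod_eq_of_lt hA.one_lt]
    · simp only [if_neg hrT]
      refine h₀ _ (haf _ _ _ _) ?_ ?_
      · simp [State.reg_setReg, d10]
      · simp [State.reg_setReg]

/-- The registers below `10` except for the number of successful draws are the same, and the number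
of successful draws is `S`. -/
structure Drawn (s : State) (S : ℕ) (s' : State) : Prop where
  agree : ∀ y < 10, y ≠ 6 → s'.reg y = s.reg y
  reg6 : s'.reg 6 = S

/-- The program that is executed for an accepted value of `B`. -/
def drawRest : Program k := .seq drawValues (.seq trials (arith .add 6 6 16))

/-- A bound for the running time of `drawRest` without the trials. -/
def restCost (k : ℕ) : ℕ := (drawValues : Program k).len + 4

theorem wp_drawRest_le (hA : Admissible w R) {τ : ℝ} (hτ : 0 ≤ τ) {q : ℕ} {s : State}
    (hs : Ready R q s) {S : ℕ} (hS : s.reg 6 = S) (hSw : S + 1 < 2 ^ w)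
    {b : ℕ} (hb : 0 < ∏ i, (R.semijoinB i b).card)
    (h10 : s.reg 10 = b) {f : State → ℝ≥0∞} {F₀ F₁ : ℝ} (hF₀ : 0 ≤ F₀) (hF₁ : 0 ≤ F₁)
    (h₁ : ∀ s', Drawn s (S + 1) s' → f s' ≤ ENNReal.ofReal F₁)
    (h₀ : ∀ s', Drawn s S s' → f s' ≤ ENNReal.ofReal F₀) :
    wp w R L (ENNReal.ofReal τ) drawRest f s ≤ ENNReal.ofReal
      (F₀ + restCost k * τ + (∑ a ∈ Fintype.piFinset fun i => R.nbrsB i b,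
        (F₁ - F₀ + roundCost k * τ * R.minDegree a) / (R.witnesses a).card) /
          (∏ i, (R.semijoinB i b).card : ℕ)) := by
  have hd : ∀ i, 1 ≤ (R.semijoinB i b).card := fun i =>
    Nat.pos_of_ne_zero fun h => hb.ne' (Finset.prod_eq_zero (Finset.mem_univ i) h)
  have hprod : ((List.finRange k).map fun i => (R.semijoinB i b).card).prod =
      ∏ i, (R.semijoinB i b).card := by
    rw [← List.ofFn_id, List.map_ofFn, List.prod_ofFn]; rfl
  -- The three units are the sequencing step, the final loop test and the addition to the success
  -- counter.
  let V : (Fin k → ℕ) → ℝ := fun a => F₀ + 3 * τ +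
    (F₁ - F₀ + roundCost k * τ * R.minDegree a) / (R.witnesses a).card
  have hV3 : ∀ a, 3 * τ ≤ V a := fun a => by
    have h2 : 0 ≤ roundCost k * τ * R.minDegree a := by positivity
    rcases Nat.eq_zero_or_pos (R.witnesses a).card with h | h
    -- A tuple without witnesses is never chosen; the convention x / 0 = 0 keeps V nonnegative
    -- there.
    · simp only [V, h, Nat.cast_zero, div_zero]; linarith
    · have h1 : (1 : ℝ) ≤ (R.witnesses a).card := by exact_mod_cast h
      have h3 : F₀ / (R.witnesses a).card ≤ F₀ := div_le_self hF₀ h1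
      have h4 : 0 ≤ (F₁ + roundCost k * τ * R.minDegree a) / (R.witnesses a).card := by positivity
      have h5 : V a = 3 * τ + (F₀ - F₀ / (R.witnesses a).card) +
          (F₁ + roundCost k * τ * R.minDegree a) / (R.witnesses a).card := by
        simp only [V]; ring
      rw [h5]
      linarith
  have hV : ∀ a, 0 ≤ V a := fun a => le_trans (by positivity) (hV3 a)
  have hvals : wp w R L 0 drawValues
      (wp w R L (ENNReal.ofReal τ) (.seq trials (arith .add 6 6 16)) f) s ≤ ENNReal.ofReal
        ((∑ a ∈ Fintype.piFinset fun i => R.nbrsB i b, V a) /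
          (∏ i, (R.semijoinB i b).card : ℕ)) := by
    have hch := wp_zero_forAll_choose_le (L := L) hA hd (List.nodup_finRange k) h10 hs.reg8 hs.reg9
      (f := wp w R L 0 (const 15 1)
        (wp w R L (ENNReal.ofReal τ) (.seq trials (arith .add 6 6 16)) f))
      (H := V) hV (fun i => s.reg (20 + i)) (fun _ => rfl) ?_
    · rw [hprod] at hch
      simp only [List.mem_finRange, if_true] at hch
      exact (zero_add _).trans_le hch
    · intro a ha s1 h1 h2 h3
      simp only [List.mem_finRange, if_true, Fintype.mem_piFinset, mem_nbrsB] at ha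
      have hbw : b ∈ R.witnesses a := (mem_witnesses hA.one_le).2 ha
      obtain ⟨i, hi⟩ := exists_card_eq_minDegree (R := R) hA.one_le a
      rw [wp_zero_basic (by simp)]
      set s2 := Instr.next w R L s1 (.const 15 1) with hs2
      have s2c : Chosen s a b s2 := by
        refine ⟨?_, ?_, fun j => ?_⟩
        · exact h1.setReg (by norm_num) _
        · simp [hs2, Instr.next, State.reg_setReg, h2]
        · simp [hs2, Instr.next, State.reg_setReg, h3, show 20 + (j : ℕ) ≠ 15 by omega]
      have s215 : s2.reg 15 = 1 := by
        simp [hs2, Instr.next, State.reg_setReg, Nat.mod_eq_of_lt hA.one_lt]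
      have key : ∀ s3, Chosen s a b s3 → ∀ e, s3.reg 16 = e → S + e < 2 ^ w →
          Drawn s (S + e) (Instr.next w R L s3 (.op .add 6 6 16)) := by
        intro s3 hs3 e he hew
        refine ⟨fun y hy hy6 => ?_, ?_⟩
        · simp only [Instr.next, State.reg_setReg, if_neg hy6]
          exact hs3.agree y hy
        · simp [Instr.next, State.reg_setReg, Op.eval, he, (hs3.agree 6 (by norm_num)).trans hS,
            Nat.mod_eq_of_lt hew]
      have htr := wp_trials_le (L := L) hA hτ hbw hs.reg8 hs.reg9
        (f := wp w R L (ENNReal.ofReal τ) (arith .add 6 6 16) f)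
        (F₀ := F₀ + τ) (F₁ := F₁ + τ) (by positivity) (by positivity)
        (fun s3 hs3 h16 => by
          simp only [wp, Instr.exec, expect_pure]
          rw [add_comm, ENNReal.ofReal_add hF₁ hτ]
          exact add_le_add (h₁ _ (key s3 hs3 1 h16 hSw)) le_rfl)
        (fun s3 hs3 h16 => by
          simp only [wp, Instr.exec, expect_pure]
          rw [add_comm, ENNReal.ofReal_add hF₀ hτ]
          exact add_le_add (h₀ _ (key s3 hs3 0 h16 (by omega))) le_rfl) i s2c s215
      have e : V a = τ + (F₀ + τ + τ + (F₁ + τ - (F₀ + τ) + roundCost k * τ *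
          (R.semijoinA i (a i)).card) / (R.witnesses a).card) := by
        simp only [V, hi]; ring
      change ENNReal.ofReal τ + _ ≤ _
      refine (add_le_add le_rfl htr).trans ?_
      rw [← ENNReal.ofReal_add hτ (by linarith [hV3 a]), e]
  change ENNReal.ofReal τ + _ ≤ _
  refine (add_le_add le_rfl ((wp_le_len_mul_add loopFree_drawValues _ s).trans
    (add_le_add le_rfl hvals))).trans (le_of_eq ?_)
  rw [natCast_mul_ofReal, ← ENNReal.ofReal_add (by positivity)
    (div_nonneg (Finset.sum_nonneg fun a _ => hV a) (Nat.cast_nonneg _)),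
    ← ENNReal.ofReal_add hτ (add_nonneg (by positivity)
      (div_nonneg (Finset.sum_nonneg fun a _ => hV a) (Nat.cast_nonneg _)))]
  congr 1
  have hpos : ((∏ i, (R.semijoinB i b).card : ℕ) : ℝ) ≠ 0 := by exact_mod_cast hb.ne'
  simp only [V]
  rw [Finset.sum_add_distrib, Finset.sum_const, Fintype.card_piFinset, nsmul_eq_mul]
  simp only [card_nbrsB, restCost]
  push_cast at hpos ⊢
  field_simp
  ring

/-- The success probability of a draw. -/
noncomputable def successProb (R : StarInstance k) (q : ℕ) : ℝ :=
  (q ^ (k - 1) * R.out : ℕ) / (R.size ^ k : ℕ)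

/-- A bound for the expected running time of a draw. -/
def drawCost (k : ℕ) : ℕ :=
  (drawTuple : Program k).len + (drawAccept : Program k).len + restCost k + roundCost k + 4

/-- F₁ and F₀ are the values of the continuation after success and failure. Keeping the term (F₁ -
F₀) · `successProb R q`, with either sign of F₁ - F₀, makes the bound usable for second moments. -/
theorem wp_draw_le (hA : Admissible w R) {τ : ℝ} (hτ : 0 ≤ τ) {q : ℕ} (hqN : q ≤ R.size)
    (hq : q ^ k * R.out ≤ R.size ^ k) {s : State}
    (hs : Ready R q s) {S : ℕ} (hS : s.reg 6 = S) (hSw : S + 1 < 2 ^ w)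
    {f : State → ℝ≥0∞} {F₀ F₁ : ℝ} (hF₀ : 0 ≤ F₀) (hF₁ : 0 ≤ F₁)
    (h₁ : ∀ s', Drawn s (S + 1) s' → f s' ≤ ENNReal.ofReal F₁)
    (h₀ : ∀ s', Drawn s S s' → f s' ≤ ENNReal.ofReal F₀) :
    wp w R L (ENNReal.ofReal τ) draw f s ≤ ENNReal.ofReal
      (F₀ + (F₁ - F₀) * successProb R q + drawCost k * τ) := by
  set X : ℕ → ℝ := fun b => ∑ a ∈ Fintype.piFinset fun i => R.nbrsB i b,
        (F₁ - F₀ + roundCost k * τ * R.minDegree a) / (R.witnesses a).card with hX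
  -- Covers the overhead of both branches: the test with the rest of the draw, or the test with
  -- `skip`.
  set c : ℝ := restCost k * τ + 2 * τ with hc
  have hc0 : 0 ≤ c := by positivity
  have hN : (R.size : ℝ) ≠ 0 := by have := hA.size_pos; positivity
  let g : State → ℝ≥0∞ := wp w R L (ENNReal.ofReal τ) (.branch 11 drawRest .skip) f
  -- X b may be negative, but the weights 1/|W(a)| are at most 1, so the average over the choices of
  -- a is at least -F₀.
  have hXP : ∀ b, 0 ≤ F₀ + X b / (∏ i, (R.semijoinB i b).card : ℕ) := fun b => by
    have h1 : ∑ a ∈ Fintype.piFinset fun i => R.nbrsB i b, (-F₀) ≤ X b := by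
      refine Finset.sum_le_sum fun a _ => ?_
      have h2 : 0 ≤ (F₁ + roundCost k * τ * R.minDegree a) / (R.witnesses a).card := by positivity
      have h3 : F₀ / (R.witnesses a).card ≤ F₀ := by
        rcases Nat.eq_zero_or_pos (R.witnesses a).card with h | h
        · simpa [h] using hF₀
        · exact div_le_self hF₀ (by exact_mod_cast h)
      have h4 : (F₁ - F₀ + roundCost k * τ * R.minDegree a) / (R.witnesses a).card =
          (F₁ + roundCost k * τ * R.minDegree a) / (R.witnesses a).card -
            F₀ / (R.witnesses a).card := by ring
      rw [h4]
      linarith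
    rw [Finset.sum_const, Fintype.card_piFinset, nsmul_eq_mul] at h1
    simp only [card_nbrsB] at h1
    rcases Nat.eq_zero_or_pos (∏ i, (R.semijoinB i b).card) with h | h
    · simpa [h] using hF₀
    · have h5 : (0 : ℝ) < (∏ i, (R.semijoinB i b).card : ℕ) := by exact_mod_cast h
      have h6 : -F₀ ≤ X b / (∏ i, (R.semijoinB i b).card : ℕ) := by
        rw [le_div_iff₀ h5]
        linarith
      linarith
  have hacc : ∀ b ∈ R.valuesB, ∀ s', Agree s s' → s'.reg 10 = b →
      wp w R L 0 drawAccept g s' ≤ ENNReal.ofReal (F₀ + c + X b * ((q ^ (k - 1) : ℕ) /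
        (R.degree b * R.size ^ (k - 1) : ℕ))) := by
    intro b hb s' hs' h10
    refine (wp_zero_drawAccept_le hA hqN (hs.agree hs') hb h10
      (pow_mul_prod_le_degree_mul_pow hA.one_le hq b)
      (A := F₀ + c + X b / (∏ i, (R.semijoinB i b).card : ℕ)) (B := F₀ + c)
      (by linarith [hXP b]) (by positivity) ?_ ?_).trans (le_of_eq ?_)
    · intro hpos s2 h1 h2 h3
      have hs2 := hs'.trans h1
      have hD : ∀ S s3, Drawn s2 S s3 → Drawn s S s3 := fun S s3 h =>
        ⟨fun y hy hy6 => (h.agree y hy hy6).trans (hs2 y hy), h.reg6⟩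
      have hrest := wp_drawRest_le (L := L) hA hτ (hs.agree hs2)
        ((hs2 6 (by norm_num)).trans hS) hSw hpos h2 hF₀ hF₁
        (fun s3 h => h₁ s3 (hD _ _ h)) (fun s3 h => h₀ s3 (hD _ _ h))
      simp only [g, wp, h3, ne_eq, one_ne_zero, not_false_eq_true, if_true]
      refine (add_le_add le_rfl hrest).trans ?_
      have := hXP b
      have h4 : 0 ≤ restCost k * τ := by positivity
      rw [← ENNReal.ofReal_add hτ (by linarith)]
      exact ENNReal.ofReal_le_ofReal (by linarith)
    · intro s2 h1 h2 h3
      have hs2 := hs'.trans h1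
      simp only [g, wp, h3, ne_eq, not_true_eq_false, if_false]
      refine (add_le_add le_rfl (add_le_add le_rfl (h₀ s2
        ⟨fun y hy _ => hs2 y hy, (hs2 6 (by norm_num)).trans hS⟩))).trans ?_
      rw [← ENNReal.ofReal_add hτ hF₀, ← ENNReal.ofReal_add hτ (by positivity)]
      refine ENNReal.ofReal_le_ofReal ?_
      have h4 : 0 ≤ restCost k * τ := by positivity
      linarith
    · congr 1
      rcases Nat.eq_zero_or_pos (∏ i, (R.semijoinB i b).card) with h | h
      · have : X b = 0 := by
          have hem : (Fintype.piFinset fun i => R.nbrsB i b) = ∅ := by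
            rw [← Finset.card_eq_zero, Fintype.card_piFinset]
            simpa only [card_nbrsB] using h
          simp only [hX, hem, Finset.sum_empty]
        simp [h, this]
      · have h5 : ((∏ i, (R.semijoinB i b).card : ℕ) : ℝ) ≠ 0 := by exact_mod_cast h.ne'
        rw [Nat.cast_mul (q ^ (k - 1))]
        field_simp
        ring
  have hacc0 : ∀ b ∈ R.valuesB, 0 ≤ F₀ + c + X b * ((q ^ (k - 1) : ℕ) /
        (R.degree b * R.size ^ (k - 1) : ℕ)) := by
    intro b hb
    have h1 : ((q ^ (k - 1) * ∏ i, (R.semijoinB i b).card : ℕ) : ℝ) ≤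
        (R.degree b * R.size ^ (k - 1) : ℕ) := by
      exact_mod_cast pow_mul_prod_le_degree_mul_pow hA.one_le hq b
    have hZ : (0 : ℝ) < (R.degree b * R.size ^ (k - 1) : ℕ) := by
      have := degree_pos hb
      have := hA.size_pos
      positivity
    rcases le_or_gt 0 (X b) with h | h
    · positivity
    · rcases Nat.eq_zero_or_pos (∏ i, (R.semijoinB i b).card) with hP | hP
      · have hem : (Fintype.piFinset fun i => R.nbrsB i b) = ∅ := by
          rw [← Finset.card_eq_zero, Fintype.card_piFinset]
          simpa only [card_nbrsB] using hP
        simp [hX, hem] at h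
      · have h5 : (0 : ℝ) < (∏ i, (R.semijoinB i b).card : ℕ) := by exact_mod_cast hP
        have h6 : ((q ^ (k - 1) : ℕ) : ℝ) / (R.degree b * R.size ^ (k - 1) : ℕ) ≤
            1 / (∏ i, (R.semijoinB i b).card : ℕ) := by
          rw [div_le_div_iff₀ hZ h5, one_mul, ← Nat.cast_mul]
          exact h1
        have h7 := mul_le_mul_of_nonpos_left h6 h.le
        have h8 := hXP b
        rw [mul_one_div] at h7
        linarith
  have hXsum : ∑ b ∈ R.valuesB, X b =
      (F₁ - F₀) * R.out + roundCost k * τ * (∑ a ∈ R.resultFinset, R.minDegree a : ℕ) := by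
    simp only [hX]
    rw [sum_inv_card_witnesses hA.one_le, Finset.sum_add_distrib, Finset.sum_const, ← out_eq_card,
      nsmul_eq_mul, ← Finset.mul_sum, mul_comm (R.out : ℝ), Nat.cast_sum]
  have htuple := wp_zero_drawTuple_le (L := L) hA hs (f := wp w R L 0 drawAccept g)
    (H := fun b => F₀ + c + X b * ((q ^ (k - 1) : ℕ) / (R.degree b * R.size ^ (k - 1) : ℕ)))
    hacc0 hacc
  have hpk : R.size ^ k = R.size * R.size ^ (k - 1) := by
    rw [← pow_succ', Nat.sub_add_cancel hA.one_le]
  -- The degree in the sampling probability of b cancels against the one in the acceptance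
  -- probability.
  have hval : (∑ b ∈ R.valuesB, (R.degree b : ℝ) * (F₀ + c + X b * ((q ^ (k - 1) : ℕ) /
      (R.degree b * R.size ^ (k - 1) : ℕ)))) / R.size =
      F₀ + c + (∑ b ∈ R.valuesB, X b) * ((q ^ (k - 1) : ℕ) / (R.size ^ k : ℕ)) := by
    have h1 : ∀ b ∈ R.valuesB, (R.degree b : ℝ) * (F₀ + c + X b * ((q ^ (k - 1) : ℕ) /
        (R.degree b * R.size ^ (k - 1) : ℕ))) =
        R.degree b * (F₀ + c) + X b * ((q ^ (k - 1) : ℕ) / (R.size ^ (k - 1) : ℕ)) := by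
      intro b hb
      have h2 : (R.degree b : ℝ) ≠ 0 := by have := degree_pos hb; positivity
      rw [Nat.cast_mul (R.degree b)]
      push_cast
      field_simp
    rw [Finset.sum_congr rfl h1, Finset.sum_add_distrib, ← Finset.sum_mul, ← Finset.sum_mul,
      sum_degree, hpk, Nat.cast_mul R.size]
    push_cast
    field_simp
  have hfin : F₀ + c + (∑ b ∈ R.valuesB, X b) * ((q ^ (k - 1) : ℕ) / (R.size ^ k : ℕ)) ≤
      F₀ + (F₁ - F₀) * successProb R q + (restCost k + roundCost k + 2) * τ := by
    have hpos : (0 : ℝ) < (R.size ^ k : ℕ) := by have := hA.size_pos; positivity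
    -- The expected search effort per draw is constant; this uses q^k OUT ≤ N^k.
    have h1 : ((q ^ (k - 1) * ∑ a ∈ R.resultFinset, R.minDegree a : ℕ) : ℝ) /
        (R.size ^ k : ℕ) ≤ 1 := by
      rw [div_le_one hpos]
      exact_mod_cast pow_mul_sum_le hA.one_le hq R.minDegree minDegree_le
    have h2 := mul_le_mul_of_nonneg_left h1 (by positivity : 0 ≤ roundCost k * τ)
    rw [hXsum, hc, successProb]
    rw [Nat.cast_mul (q ^ (k - 1))] at h2 ⊢
    have e : ((F₁ - F₀) * R.out + roundCost k * τ *
        (∑ a ∈ R.resultFinset, R.minDegree a : ℕ)) * ((q ^ (k - 1) : ℕ) / (R.size ^ k : ℕ) : ℝ) =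
        (F₁ - F₀) * ((q ^ (k - 1) : ℕ) * R.out / (R.size ^ k : ℕ)) + roundCost k * τ *
          ((q ^ (k - 1) : ℕ) * (∑ a ∈ R.resultFinset, R.minDegree a : ℕ) /
            (R.size ^ k : ℕ)) := by ring
    rw [e]
    linarith
  have hnn : 0 ≤ F₀ + (F₁ - F₀) * successProb R q + (restCost k + roundCost k + 2) * τ := by
    refine le_trans ?_ hfin
    rw [← hval]
    exact div_nonneg (Finset.sum_nonneg fun b hb => mul_nonneg (Nat.cast_nonneg _) (hacc0 b hb))
      (Nat.cast_nonneg _)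
  have hloop : (Program.seq drawTuple drawAccept : Program k).LoopFree :=
    ⟨loopFree_drawTuple, loopFree_drawAccept⟩
  change ENNReal.ofReal τ + wp w R L (ENNReal.ofReal τ) (.seq drawTuple drawAccept) g s ≤ _
  have h1 := wp_le_len_mul_add (w := w) (L := L) (τ := ENNReal.ofReal τ) hloop g s
  have h2 : wp w R L 0 (.seq drawTuple drawAccept) g s ≤
      ENNReal.ofReal (F₀ + (F₁ - F₀) * successProb R q + (restCost k + roundCost k + 2) * τ) := by
    refine (zero_add _).trans_le (htuple.trans (ENNReal.ofReal_le_ofReal ?_))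
    exact hval.trans_le hfin
  refine (add_le_add le_rfl (h1.trans (add_le_add le_rfl h2))).trans (le_of_eq ?_)
  rw [natCast_mul_ofReal, ← ENNReal.ofReal_add (by positivity) hnn,
    ← ENNReal.ofReal_add hτ (add_nonneg (by positivity) hnn)]
  congr 1
  simp only [Program.len, drawCost]
  push_cast
  ring

/-! ### A sequence of draws: first and second moments of the number of successes. -/

theorem successProb_nonneg (R : StarInstance k) (q : ℕ) : 0 ≤ successProb R q := by
  unfold successProb; positivity

theorem successProb_le_one (hA : Admissible w R) {q : ℕ} (hq1 : 1 ≤ q)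
    (hq : q ^ k * R.out ≤ R.size ^ k) : successProb R q ≤ 1 := by
  have hpos : (0 : ℝ) < (R.size ^ k : ℕ) := by have := hA.size_pos; positivity
  rw [successProb, div_le_one hpos]
  exact_mod_cast (Nat.mul_le_mul_right _ (Nat.pow_le_pow_right hq1 (Nat.sub_le k 1))).trans hq

/-- The registers below `10` are the same, except for the number of remaining and of successful
draws. -/
def SameBase (s s' : State) : Prop := ∀ y < 10, y ≠ 5 → y ≠ 6 → s'.reg y = s.reg y

theorem SameBase.ready {q : ℕ} {s s' : State} (h : SameBase s s') (hs : Ready R q s) :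
    Ready R q s' where
  reg1 := (h 1 (by norm_num) (by norm_num) (by norm_num)).trans hs.reg1
  reg2 := (h 2 (by norm_num) (by norm_num) (by norm_num)).trans hs.reg2
  reg3 := (h 3 (by norm_num) (by norm_num) (by norm_num)).trans hs.reg3
  reg4 := (h 4 (by norm_num) (by norm_num) (by norm_num)).trans hs.reg4
  reg8 := (h 8 (by norm_num) (by norm_num) (by norm_num)).trans hs.reg8
  reg9 := (h 9 (by norm_num) (by norm_num) (by norm_num)).trans hs.reg9

/-- A bound for the expectation of `α + β S' + γ (S' - μ) ^ 2`, where `S'` is the sum of `S` and the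
number of successes among `m` independent trials with success probability `p`, plus the cost. -/
noncomputable def potential (α β γ μ p c τ : ℝ) (m S : ℕ) : ℝ :=
  α + β * (S + m * p) + γ * ((S + m * p - μ) ^ 2 + m * (p * (1 - p))) + (m * c + 1) * τ

theorem potential_nonneg {α β γ μ p c τ : ℝ} (hα : 0 ≤ α) (hβ : 0 ≤ β) (hγ : 0 ≤ γ) (hp : 0 ≤ p)
    (hp1 : p ≤ 1) (hc : 0 ≤ c) (hτ : 0 ≤ τ) (m S : ℕ) : 0 ≤ potential α β γ μ p c τ m S := by
  have := sub_nonneg.2 hp1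
  unfold potential
  positivity

/-- Conditioning on the next draw: a success, of probability p, raises S by one. The identity
replaces any use of independence. -/
theorem potential_succ (α β γ μ p c τ : ℝ) (m S : ℕ) :
    potential α β γ μ p c τ m S + (potential α β γ μ p c τ m (S + 1) -
      potential α β γ μ p c τ m S) * p + c * τ = potential α β γ μ p c τ (m + 1) S := by
  unfold potential
  push_cast
  ring

/-- The quadratic bound on the continuation serves both tail estimates: the coefficient `β` for
Markov, `γ` for Chebyshev. Beyond the draw itself, an iteration costs three units: loop test,
sequencing and decrement. -/
theorem wp_draws_le (hA : Admissible w R) {τ : ℝ} (hτ : 0 ≤ τ) {q : ℕ} (hq1 : 1 ≤ q)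
    (hqN : q ≤ R.size) (hq : q ^ k * R.out ≤ R.size ^ k) {s : State} (hs : Ready R q s) {m : ℕ}
    (h5 : s.reg 5 = m) (h6 : s.reg 6 = 0) (hmw : m < 2 ^ w)
    {α β γ μ : ℝ} (hα : 0 ≤ α) (hβ : 0 ≤ β) (hγ : 0 ≤ γ) {f : State → ℝ≥0∞}
    (hf : ∀ s', SameBase s s' → s'.reg 6 ≤ m →
      f s' ≤ ENNReal.ofReal (α + β * s'.reg 6 + γ * (s'.reg 6 - μ) ^ 2)) :
    wp w R L (ENNReal.ofReal τ) draws f s ≤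
      ENNReal.ofReal (potential α β γ μ (successProb R q) (drawCost k + 3) τ m 0) := by
  classical
  set p := successProb R q with hp
  have hp0 : 0 ≤ p := successProb_nonneg R q
  have hp1 : p ≤ 1 := successProb_le_one hA hq1 hq
  let G : ℕ → ℕ → ℝ := potential α β γ μ p (drawCost k + 3) τ
  have hG : ∀ m S, 0 ≤ G m S := potential_nonneg hα hβ hγ hp0 hp1 (by positivity) hτ
  -- Remaining plus successful draws never exceed m, which excludes overflow of the success counter.
  let I : State → ℝ≥0∞ := fun s' => if SameBase s s' ∧ s'.reg 5 + s'.reg 6 ≤ m then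
    ENNReal.ofReal (G (s'.reg 5) (s'.reg 6)) else ⊤
  have hI : wp w R L (ENNReal.ofReal τ) draws f s ≤ I s := by
    refine wp_loop_le I (fun s' hs' => ?_) (fun s' hs' => ?_) s
    · refine (min_le_right _ _).trans ?_
      by_cases hc : SameBase s s' ∧ s'.reg 5 + s'.reg 6 ≤ m
      · simp only [I, if_pos hc]
        obtain ⟨n, hn⟩ : ∃ n, s'.reg 5 = n + 1 := ⟨s'.reg 5 - 1, by omega⟩
        have hr := hc.1.ready hs
        have key : ∀ S, n + S ≤ m → ∀ s'', Drawn s' S s'' →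
            wp w R L (ENNReal.ofReal τ) (arith .sub 5 5 8) I s'' ≤
              ENNReal.ofReal (G n S + τ) := by
          intro S hS s'' hd
          have e8 : s''.reg 8 = 1 := (hd.agree 8 (by norm_num) (by norm_num)).trans hr.reg8
          have e5 : s''.reg 5 = n + 1 := (hd.agree 5 (by norm_num) (by norm_num)).trans hn
          have hsub : (n + 1 + 2 ^ w - 1) % 2 ^ w = n := by
            rw [sub_one_mod (by omega) (by omega), Nat.add_sub_cancel]
          have hcc : SameBase s (Instr.next w R L s'' (.op .sub 5 5 8)) ∧
              (Instr.next w R L s'' (.op .sub 5 5 8)).reg 5 = n ∧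
              (Instr.next w R L s'' (.op .sub 5 5 8)).reg 6 = S := by
            refine ⟨fun y hy hy5 hy6 => ?_, ?_, ?_⟩
            · simp only [Instr.next, State.reg_setReg, if_neg hy5]
              exact (hd.agree y hy hy6).trans (hc.1 y hy hy5 hy6)
            · simp only [Instr.next, State.reg_setReg, if_true, Op.eval, e5, e8, hsub]
            · simp [Instr.next, State.reg_setReg, hd.reg6]
          have hI2 : I (Instr.next w R L s'' (.op .sub 5 5 8)) = ENNReal.ofReal (G n S) := by
            simp only [I, hcc.2.1, hcc.2.2]
            rw [if_pos ⟨hcc.1, hS⟩]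
          simp only [wp, Instr.exec_eq_pure (Instr.det_op _ _ _ _), expect_pure, hI2]
          rw [← ENNReal.ofReal_add hτ (hG _ _), add_comm]
        have hdraw := wp_draw_le (L := L) hA hτ hqN hq hr (S := s'.reg 6) rfl (by omega)
          (f := wp w R L (ENNReal.ofReal τ) (arith .sub 5 5 8) I)
          (F₀ := G n (s'.reg 6) + τ) (F₁ := G n (s'.reg 6 + 1) + τ)
          (add_nonneg (hG _ _) hτ) (add_nonneg (hG _ _) hτ)
          (key _ (by omega)) (key _ (by omega))
        change _ + (_ + _) ≤ _
        refine (add_le_add le_rfl (add_le_add le_rfl hdraw)).trans ?_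
        have e := potential_succ α β γ μ p (drawCost k + 3) τ n (s'.reg 6)
        have hnn : 0 ≤ G n (s'.reg 6) + τ + (G n (s'.reg 6 + 1) + τ - (G n (s'.reg 6) + τ)) * p +
            drawCost k * τ := by
          have h1 : G n (s'.reg 6) + τ + (G n (s'.reg 6 + 1) + τ - (G n (s'.reg 6) + τ)) * p +
            drawCost k * τ = G n (s'.reg 6) * (1 - p) + G n (s'.reg 6 + 1) * p + τ +
              drawCost k * τ := by ring
          rw [h1]
          have h2 := mul_nonneg (hG n (s'.reg 6)) (sub_nonneg.2 hp1)
          have h3 := mul_nonneg (hG n (s'.reg 6 + 1)) hp0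
          positivity
        rw [← ENNReal.ofReal_add hτ hnn, ← ENNReal.ofReal_add hτ (add_nonneg hτ hnn), hn]
        refine ENNReal.ofReal_le_ofReal (le_of_eq ?_)
        simp only [G]
        rw [← e]
        ring
      · simp only [I, if_neg hc]; exact le_top
    · refine (min_le_right _ _).trans ?_
      by_cases hc : SameBase s s' ∧ s'.reg 5 + s'.reg 6 ≤ m
      · simp only [I, if_pos hc, hs']
        refine (add_le_add le_rfl (hf s' hc.1 (by omega))).trans ?_
        rw [← ENNReal.ofReal_add hτ (by positivity)]
        refine ENNReal.ofReal_le_ofReal (le_of_eq ?_)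
        simp only [G, potential]
        push_cast
        ring
      · simp only [I, if_neg hc]; exact le_top
  refine hI.trans (le_of_eq ?_)
  have hc : SameBase s s ∧ s.reg 5 + s.reg 6 ≤ m := ⟨fun _ _ _ _ => rfl, by omega⟩
  simp only [I, if_pos hc, h5, h6, G]

/-! ### One stage: preparation, draws and the decision to stop. -/

/-- The state at the start of the draws with sampling rate `q`. -/
structure Running (R : StarInstance k) (q : ℕ) (s : State) : Prop where
  reg0 : s.reg 0 = 0
  reg1 : s.reg 1 = R.size
  reg2 : s.reg 2 = R.size ^ (k - 1)
  reg3 : s.reg 3 = q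
  reg7 : s.reg 7 = 1
  reg8 : s.reg 8 = 1
  reg9 : s.reg 9 = 0

/-- The estimate that is computed from `S` successful draws. -/
def estimateValue (R : StarInstance k) (C q S : ℕ) : ℕ :=
  (2 * S * R.size ^ k + C * q ^ k) / (2 * (C * q ^ k))

theorem det_prepare (C : ℕ) : (prepare C : Program k).Det :=
  ⟨trivial, det_mulPow _ _ _, trivial, trivial, trivial, trivial⟩

theorem det_decide (C θ : ℕ) : (Program.decide C θ : Program k).Det :=
  ⟨trivial, trivial, ⟨⟨trivial, trivial, ⟨trivial, trivial⟩, trivial⟩,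
    ⟨trivial, trivial, trivial, trivial, trivial, trivial, trivial, trivial, trivial, trivial,
      trivial⟩⟩, trivial⟩

theorem eval_ofList_cons (p : Program k) (l : List (Program k)) (s : State) :
    eval w R L (ofList (p :: l)) s = eval w R L (ofList l) (eval w R L p s) := rfl

theorem eval_prepare (hA : Admissible w R) {C q : ℕ} (hq1 : 1 ≤ q) (hqN : q ≤ R.size)
    (hC : C * q < 2 ^ w) {s : State} (hs : Running R q s) :
    Ready R q (eval w R L (prepare C) s) ∧ (eval w R L (prepare C) s).reg 5 = C * q ∧
      (eval w R L (prepare C) s).reg 6 = 0 ∧ (eval w R L (prepare C) s).reg 0 = 0 ∧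
      (eval w R L (prepare C) s).reg 7 = 1 := by
  have hk := hA.one_le
  have hCw : C < 2 ^ w := lt_of_le_of_lt (Nat.le_mul_of_pos_right _ hq1) hC
  have hqw : q ^ (k - 1) < 2 ^ w :=
    lt_of_le_of_lt (Nat.pow_le_pow_left hqN _) (hA.size_pow_lt' (by omega))
  simp only [prepare, eval_ofList_cons]
  set s1 := eval w R L (const 4 1) s with hs1
  have s1r : ∀ y ≠ 4, s1.reg y = s.reg y := fun y hy => by
    simp [hs1, eval, Instr.next, State.reg_setReg, hy]
  have s14 : s1.reg 4 = 1 := by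
    simp [hs1, eval, Instr.next, State.reg_setReg, Nat.mod_eq_of_lt hA.one_lt]
  have s13 : s1.reg 3 = q := (s1r 3 (by norm_num)).trans hs.reg3
  obtain ⟨m1, m2⟩ := reg_eval_mulPow (w := w) (R := R) (L := L) (x := 4) (y := 3) (by norm_num)
    (k - 1) s1 (by rw [s13, s14, one_mul]; exact hqw) (by rw [s13]; exact hq1)
  set s2 := eval w R L (mulPow 4 3 (k - 1)) s1
  clear_value s2 s1
  have s2r : ∀ y ≠ 4, s2.reg y = s.reg y := fun y hy => (m2 y hy).trans (s1r y hy)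
  rw [s13, s14, one_mul] at m1
  simp only [ofList, eval, Instr.next, Op.eval]
  refine ⟨⟨?_, ?_, ?_, ?_, ?_, ?_⟩, ?_, ?_, ?_, ?_⟩ <;>
    simp [State.reg_setReg, s2r, m1, hs.reg0, hs.reg1, hs.reg2, hs.reg3, hs.reg7, hs.reg8, hs.reg9,
      Nat.mod_eq_of_lt hCw, Nat.mod_eq_of_lt hC]

theorem eval_decide_of_lt (hA : Admissible w R) {C θ q : ℕ} (hq : 2 * q < 2 ^ w) (hθ : θ < 2 ^ w)
    {s : State} (hs : Ready R q s) (h0 : s.reg 0 = 0) (h7 : s.reg 7 = 1) (h6 : s.reg 6 < θ) :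
    if R.size < 2 * q then
      (eval w R L (Program.decide C θ) s).reg 7 = 0 ∧
        (eval w R L (Program.decide C θ) s).reg 0 = 0
    else Running R (2 * q) (eval w R L (Program.decide C θ) s) := by
  have e1 : (s.setReg w 11 θ).setReg w 11 1 = s.setReg w 11 1 := by
    ext y
    · simp only [State.reg_setReg]; split_ifs <;> rfl
    · rfl
  have e : eval w R L (Program.decide C θ) s =
      eval w R L (.ofList [arith .add 3 3 3, arith .lt 11 1 3, .branch 11 (const 7 0) .skip])
        (s.setReg w 11 1) := by
    simp [Program.decide, eval, ofList, Instr.next, State.reg_setReg, Op.eval, Nat.mod_eq_of_lt hθ,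
      h6, Nat.mod_eq_of_lt hA.one_lt, e1]
  rw [e]
  have hq' : (q + q) % 2 ^ w = 2 * q := by rw [← two_mul]; exact Nat.mod_eq_of_lt hq
  split_ifs with h
  · constructor <;>
    simp [eval, ofList, Instr.next, State.reg_setReg, Op.eval, hs.reg1, hs.reg3, hq', h,
      Nat.mod_eq_of_lt hA.one_lt, h0]
  · constructor <;>
    simp [eval, ofList, Instr.next, State.reg_setReg, Op.eval, hs.reg1, hs.reg2, hs.reg3, hs.reg8,
      hs.reg9, hq', h, h0, h7]

/-- With at most C q successes, every intermediate number is at most 3 C N^(k+1), so the estimate is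
computed without overflow. -/
theorem eval_decide_of_le (hA : Admissible w R) {C θ q : ℕ} (hq1 : 1 ≤ q) (hqN : q ≤ R.size)
    (hC1 : 1 ≤ C) (hC : 4 * C * R.size ^ (k + 1) < 2 ^ w) (hθ : θ < 2 ^ w)
    {s : State} (hs : Ready R q s) (h6 : θ ≤ s.reg 6) (h6' : s.reg 6 ≤ C * q) :
    (eval w R L (Program.decide C θ) s).reg 7 = 0 ∧
      (eval w R L (Program.decide C θ) s).reg 0 = estimateValue R C q (s.reg 6) := by
  have hk := hA.one_le
  have hN := hA.size_pos
  set N := R.size with hNdef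
  have hNk : N ^ (k - 1) * N = N ^ k := by rw [← pow_succ, Nat.sub_add_cancel hk]
  have hqk : C * q ^ (k - 1) * q = C * q ^ k := by
    rw [mul_assoc, ← pow_succ, Nat.sub_add_cancel hk]
  have hSN : s.reg 6 * N ^ k ≤ C * N ^ (k + 1) := by
    calc _ ≤ C * N * N ^ k := by gcongr; exact h6'.trans (by gcongr)
      _ = _ := by ring
  have hqNk : C * q ^ k ≤ C * N ^ (k + 1) := by
    refine Nat.mul_le_mul_left C ?_
    exact (Nat.pow_le_pow_left hqN k).trans (Nat.pow_le_pow_right hN (Nat.le_succ k))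
  have hS1 : s.reg 6 ≤ s.reg 6 * N ^ k := Nat.le_mul_of_pos_right _ (pow_pos hN k)
  have hq2 : C * q ^ (k - 1) ≤ C * q ^ k := by
    rw [← hqk]; exact Nat.le_mul_of_pos_right _ hq1
  have hq3 : C ≤ C * q ^ (k - 1) := Nat.le_mul_of_pos_right _ (pow_pos hq1 _)
  have hNk2 : N ^ k ≤ C * N ^ (k + 1) := by
    calc N ^ k ≤ N ^ (k + 1) := Nat.pow_le_pow_right hN (Nat.le_succ k)
      _ ≤ _ := Nat.le_mul_of_pos_left _ hC1
  have hC' : 4 * (C * N ^ (k + 1)) < 2 ^ w := by rwa [← mul_assoc]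
  set M := C * N ^ (k + 1) with hM
  have v1 : N ^ (k - 1) * N % 2 ^ w = N ^ k := by rw [hNk]; exact Nat.mod_eq_of_lt (by omega)
  have v2 : (s.reg 6 + s.reg 6) % 2 ^ w = s.reg 6 + s.reg 6 := Nat.mod_eq_of_lt (by omega)
  have v3' : N ^ k * (s.reg 6 + s.reg 6) = 2 * s.reg 6 * N ^ k := by ring
  have v3'' : 2 * s.reg 6 * N ^ k = 2 * (s.reg 6 * N ^ k) := by ring
  have v3 : N ^ k * (s.reg 6 + s.reg 6) % 2 ^ w = 2 * s.reg 6 * N ^ k := by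
    rw [v3']; exact Nat.mod_eq_of_lt (by omega)
  have v4 : C % 2 ^ w = C := Nat.mod_eq_of_lt (by omega)
  have v5 : C * q ^ (k - 1) % 2 ^ w = C * q ^ (k - 1) := Nat.mod_eq_of_lt (by omega)
  have v6 : C * q ^ (k - 1) * q % 2 ^ w = C * q ^ k := by
    rw [hqk]; exact Nat.mod_eq_of_lt (by omega)
  have v7 : (2 * s.reg 6 * N ^ k + C * q ^ k) % 2 ^ w = 2 * s.reg 6 * N ^ k + C * q ^ k :=
    Nat.mod_eq_of_lt (by omega)
  have v8 : (C * q ^ k + C * q ^ k) % 2 ^ w = 2 * (C * q ^ k) := by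
    rw [← two_mul]; exact Nat.mod_eq_of_lt (by omega)
  have v9' : estimateValue R C q (s.reg 6) ≤ 2 * s.reg 6 * N ^ k + C * q ^ k :=
    Nat.div_le_self _ _
  have v9 : estimateValue R C q (s.reg 6) % 2 ^ w = estimateValue R C q (s.reg 6) :=
    Nat.mod_eq_of_lt (by omega)
  have h6n : ¬ s.reg 6 < θ := not_lt.2 h6
  have e1 : (s.setReg w 11 θ).setReg w 11 0 = s.setReg w 11 0 := by
    ext y
    · simp only [State.reg_setReg]; split_ifs <;> rfl
    · rfl
  have e : eval w R L (Program.decide C θ) s = eval w R L (finish C) (s.setReg w 11 0) := by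
    simp [Program.decide, eval, ofList, Instr.next, State.reg_setReg, Op.eval, Nat.mod_eq_of_lt hθ,
      h6n, e1]
  rw [e]
  constructor
  · simp [finish, eval, ofList, Instr.next, State.reg_setReg]
  · simp only [finish, eval, ofList, Instr.next, State.reg_setReg, Op.eval]
    simp [hs.reg1, hs.reg2, hs.reg3, hs.reg4, ← hNdef, v1, v2, v3, v4, v5, v6, v7, v8]
    exact v9

/-- A bound for the running time of the deterministic parts of a stage. -/
def stageCost (k C θ : ℕ) : ℕ :=
  (prepare C : Program k).len + (Program.decide C θ : Program k).len + 2

theorem wp_stage_le (hA : Admissible w R) {τ : ℝ} (hτ : 0 ≤ τ) {C θ q : ℕ} (hq1 : 1 ≤ q)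
    (hqN : q ≤ R.size) (hq : q ^ k * R.out ≤ R.size ^ k) (hC1 : 1 ≤ C)
    (hC : 4 * C * R.size ^ (k + 1) < 2 ^ w) (hθ : θ ≤ C) {s : State} (hs : Running R q s)
    {α β γ μ : ℝ} (hα : 0 ≤ α) (hβ : 0 ≤ β) (hγ : 0 ≤ γ) {f : State → ℝ≥0∞}
    (hcont : ∀ S < θ, 2 * q ≤ R.size → ∀ s', Running R (2 * q) s' →
      f s' ≤ ENNReal.ofReal (α + β * S + γ * (S - μ) ^ 2))
    (hhalt : ∀ S < θ, R.size < 2 * q → ∀ s', s'.reg 7 = 0 → s'.reg 0 = 0 →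
      f s' ≤ ENNReal.ofReal (α + β * S + γ * (S - μ) ^ 2))
    (hfin : ∀ S, θ ≤ S → ∀ s', s'.reg 7 = 0 → s'.reg 0 = estimateValue R C q S →
      f s' ≤ ENNReal.ofReal (α + β * S + γ * (S - μ) ^ 2)) :
    wp w R L (ENNReal.ofReal τ) (stage C θ) f s ≤ ENNReal.ofReal
      (potential α β γ μ (successProb R q) (drawCost k + 3) τ (C * q) 0 + stageCost k C θ * τ) := by
  have hN := hA.size_pos
  have hCN : C * R.size ≤ C * R.size ^ (k + 1) := by
    gcongr
    exact Nat.le_self_pow (by omega) _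
  have hC' : 4 * (C * R.size ^ (k + 1)) < 2 ^ w := by rwa [← mul_assoc]
  have hCq : C * q ≤ C * R.size := by gcongr
  have hqC : q ≤ C * q := Nat.le_mul_of_pos_left _ hC1
  have hCC : C ≤ C * q := Nat.le_mul_of_pos_right _ hq1
  have hθw : θ < 2 ^ w := by omega
  set d : ℝ := (Program.decide C θ : Program k).len * τ with hd
  have hd0 : 0 ≤ d := mul_nonneg (Nat.cast_nonneg _) hτ
  have hprep := eval_prepare (L := L) hA hq1 hqN (by omega : C * q < 2 ^ w) hs
  obtain ⟨s1, hs1⟩ : ∃ s1, s1 = eval w R L (prepare C) s := ⟨_, rfl⟩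
  rw [← hs1] at hprep
  obtain ⟨p1, p2, p3, p4, p5⟩ := hprep
  -- The time of the decision is absorbed into the constant term of the quadratic bound.
  have hdraws := wp_draws_le (L := L) hA hτ hq1 hqN hq p1 p2 p3 (by omega) (α := α + d)
    (by positivity) hβ hγ (μ := μ)
    (f := wp w R L (ENNReal.ofReal τ) (Program.decide C θ) f) (fun s' hb h6 => by
      refine (wp_le_len_mul_add (det_decide C θ).loopFree f s').trans ?_
      rw [wp_zero_of_det (det_decide C θ), natCast_mul_ofReal, add_assoc α, add_comm d,
        ← add_assoc α, add_right_comm, add_comm _ d, ENNReal.ofReal_add hd0 (by positivity)]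
      refine add_le_add le_rfl ?_
      have hr := hb.ready p1
      rcases lt_or_ge (s'.reg 6) θ with h | h
      · have := eval_decide_of_lt (L := L) (C := C) hA (by omega : 2 * q < 2 ^ w) hθw hr
          ((hb 0 (by norm_num) (by norm_num) (by norm_num)).trans p4)
          ((hb 7 (by norm_num) (by norm_num) (by norm_num)).trans p5) h
        split_ifs at this with h2
        · exact hhalt _ h h2 _ this.1 this.2
        · exact hcont _ h (not_lt.1 h2) _ this
      · obtain ⟨h1, h2⟩ := eval_decide_of_le (L := L) hA hq1 hqN hC1 hC hθw hr h h6
        exact hfin _ h _ h1 h2)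
  change ENNReal.ofReal τ + wp w R L (ENNReal.ofReal τ) (prepare C) _ s ≤ _
  have hlen := wp_le_len_mul_add (w := w) (L := L) (τ := ENNReal.ofReal τ) (det_prepare C).loopFree
    (wp w R L (ENNReal.ofReal τ) (.seq draws (Program.decide C θ)) f) s
  rw [wp_zero_of_det (det_prepare C), natCast_mul_ofReal, ← hs1] at hlen
  have hseq : wp w R L (ENNReal.ofReal τ) (.seq draws (Program.decide C θ)) f s1 ≤ _ :=
    add_le_add (le_refl (ENNReal.ofReal τ)) hdraws
  refine (add_le_add le_rfl (hlen.trans (add_le_add le_rfl hseq))).trans ?_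
  have hnn := potential_nonneg (α := α + d) (μ := μ) (c := drawCost k + 3) (by positivity) hβ hγ
    (successProb_nonneg R q) (successProb_le_one hA hq1 hq) (by positivity) hτ (C * q) 0
  have hlen0 : 0 ≤ ((prepare C : Program k).len : ℝ) * τ := mul_nonneg (Nat.cast_nonneg _) hτ
  rw [← ENNReal.ofReal_add hτ hnn, ← ENNReal.ofReal_add hlen0 (add_nonneg hτ hnn),
    ← ENNReal.ofReal_add hτ (add_nonneg hlen0 (add_nonneg hτ hnn))]
  refine ENNReal.ofReal_le_ofReal (le_of_eq ?_)
  simp only [potential, stageCost, hd]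
  push_cast
  ring

/-! ### Accuracy of the rounded estimate and error bounds for the sampling rates. -/

/-- A number divided with rounding to the nearest integer. -/
theorem abs_round_div_sub_le (n m : ℕ) (hm : 0 < m) :
    |(((2 * n + m) / (2 * m) : ℕ) : ℝ) - n / m| ≤ 1 / 2 := by
  have h1 := Nat.div_add_mod (2 * n + m) (2 * m)
  have h2 := Nat.mod_lt (2 * n + m) (by omega : 2 * m > 0)
  set v := (2 * n + m) / (2 * m)
  set r := (2 * n + m) % (2 * m)
  have h1' : 2 * (m : ℝ) * v + r = 2 * n + m := by exact_mod_cast h1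
  have h2' : (r : ℝ) < 2 * m := by exact_mod_cast h2
  have h3 : (0 : ℝ) ≤ r := Nat.cast_nonneg _
  have hm' : (0 : ℝ) < m := by exact_mod_cast hm
  have e : (v : ℝ) - n / m = (m - r) / (2 * m) := by
    field_simp
    linarith
  rw [e, abs_div, abs_of_pos (by positivity : (0 : ℝ) < 2 * m), div_le_iff₀ (by positivity), abs_le]
  constructor <;> linarith

/-- If εV ≥ 1, the rounding error 1/2 fits into the other half of the tolerance. If εV < 1, then v
and V are integers at distance less than 1, hence equal. -/
theorem isApproximation_of_round {ε : ℝ} (hε : 0 < ε) (V v : ℕ) (x : ℝ)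
    (hx : |x - V| ≤ ε / 2 * V) (hv : |(v : ℝ) - x| ≤ 1 / 2) : IsApproximation ε V v := by
  rw [abs_le] at hx hv
  rcases le_or_gt 1 (ε * V) with h | h
  · constructor <;> linarith
  · have hVv : V = v := by
      have h1 : (V : ℝ) < v + 1 := by linarith
      have h2 : (v : ℝ) < V + 1 := by linarith
      have h1' : V < v + 1 := by exact_mod_cast h1
      have h2' : v < V + 1 := by exact_mod_cast h2
      omega
    have : (0 : ℝ) ≤ ε * v := by positivity
    rw [IsApproximation, hVv]
    constructor <;> linarith

/-- The expected number of successes, divided by the number `C` of draws at sampling rate `1`. -/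
noncomputable def relMean (R : StarInstance k) (q : ℕ) : ℝ := (q ^ k * R.out : ℕ) / (R.size ^ k : ℕ)

theorem mul_successProb (hA : Admissible w R) (q : ℕ) : q * successProb R q = relMean R q := by
  rw [successProb, relMean, ← mul_div_assoc, ← Nat.cast_mul, ← mul_assoc, ← pow_succ',
    Nat.sub_add_cancel hA.one_le]

theorem isApproximation_estimateValue (hA : Admissible w R) {ε : ℝ} (hε : 0 < ε) {C q S : ℕ}
    (hC : 1 ≤ C) (hq : 1 ≤ q)
    (hS : |(S : ℝ) - C * relMean R q| ≤ ε / 2 * (C * relMean R q)) :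
    IsApproximation ε R.out (estimateValue R C q S : ℕ) := by
  have hN := hA.size_pos
  have hm : 0 < C * q ^ k := by positivity
  refine isApproximation_of_round hε _ _ (((S * R.size ^ k : ℕ) : ℝ) / (C * q ^ k : ℕ)) ?_ ?_
  · have e : ((S * R.size ^ k : ℕ) : ℝ) / (C * q ^ k : ℕ) - R.out =
        (S - C * relMean R q) * ((R.size ^ k : ℕ) / (C * q ^ k : ℕ)) := by
      have h1 : (R.size : ℝ) ≠ 0 := by positivity
      have h2 : (C : ℝ) ≠ 0 := by positivity
      have h3 : (q : ℝ) ≠ 0 := by positivity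
      rw [relMean]
      push_cast
      field_simp
    have e2 : ε / 2 * R.out =
        ε / 2 * (C * relMean R q) * ((R.size ^ k : ℕ) / (C * q ^ k : ℕ)) := by
      have h1 : (R.size : ℝ) ≠ 0 := by positivity
      have h2 : (C : ℝ) ≠ 0 := by positivity
      have h3 : (q : ℝ) ≠ 0 := by positivity
      rw [relMean]
      push_cast
      field_simp
    have h0 : (0 : ℝ) ≤ (R.size ^ k : ℕ) / (C * q ^ k : ℕ) := by positivity
    rw [e, e2, abs_mul, abs_of_nonneg h0]
    exact mul_le_mul_of_nonneg_right hS h0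
  · have e : estimateValue R C q S = (2 * (S * R.size ^ k) + C * q ^ k) / (2 * (C * q ^ k)) := by
      rw [estimateValue, mul_assoc 2 S]
    rw [e]
    exact abs_round_div_sub_le _ _ hm

/-- A bound for the probability that the sampling rate `2 ^ (j₀ - d)` leads to a wrong result. -/
noncomputable def errorBound (ε : ℝ) (k θ D d : ℕ) : ℝ :=
  if d < D then 4 * 2 ^ (k * D) / (ε ^ 2 * θ) else 2 ^ (k + 1) / 2 ^ d

theorem errorBound_nonneg (ε : ℝ) (k θ D d : ℕ) : 0 ≤ errorBound ε k θ D d := by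
  unfold errorBound
  split_ifs <;> positivity

theorem sum_errorBound_le (ε : ℝ) (k θ D n : ℕ) :
    ∑ d ∈ Finset.range n, errorBound ε k θ D d ≤
      D * (4 * 2 ^ (k * D) / (ε ^ 2 * θ)) + 2 * 2 ^ (k + 1) / 2 ^ D := by
  set a : ℝ := 4 * 2 ^ (k * D) / (ε ^ 2 * θ) with ha
  have ha0 : 0 ≤ a := by positivity
  -- Adding the remaining geometric tail makes the statement inductive.
  suffices h : ∑ d ∈ Finset.range n, errorBound ε k θ D d + 2 * 2 ^ (k + 1) / 2 ^ (max n D) ≤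
      (min n D : ℕ) * a + 2 * 2 ^ (k + 1) / 2 ^ D by
    have h1 : (0 : ℝ) ≤ 2 * 2 ^ (k + 1) / 2 ^ (max n D) := by positivity
    have h2 : ((min n D : ℕ) : ℝ) * a ≤ D * a := by
      gcongr
      exact min_le_right _ _
    linarith
  induction n with
  | zero => simp
  | succ n ih =>
    rw [Finset.sum_range_succ]
    rcases lt_or_ge n D with h | h
    · rw [max_eq_right (by omega), min_eq_left (by omega)] at ih ⊢
      rw [errorBound, if_pos h, ← ha]
      push_cast
      linarith
    · rw [max_eq_left (by omega), min_eq_right (by omega)] at ih ⊢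
      rw [errorBound, if_neg (by omega)]
      have : (2 : ℝ) * 2 ^ (k + 1) / 2 ^ n = 2 ^ (k + 1) / 2 ^ n + 2 * 2 ^ (k + 1) / 2 ^ (n + 1) := by
        rw [pow_succ 2 n]
        field_simp
        ring
      linarith

/-- `2 ^ j₀` is the largest admissible sampling rate. -/
structure IsMaxRate (R : StarInstance k) (j₀ : ℕ) : Prop where
  le : (2 ^ j₀) ^ k * max 1 R.out ≤ R.size ^ k
  lt : R.size ^ k < (2 ^ (j₀ + 1)) ^ k * max 1 R.out

theorem IsMaxRate.pow_le_size {j₀ : ℕ} (h : IsMaxRate R j₀) (hk : 1 ≤ k) : 2 ^ j₀ ≤ R.size := by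
  refine le_of_pow_le_pow_left₀ (n := k) (by omega) (Nat.zero_le _) ?_
  exact (Nat.le_mul_of_pos_right _ (by positivity)).trans h.le

theorem IsMaxRate.pow_mul_out_le {j₀ j : ℕ} (h : IsMaxRate R j₀) (hj : j ≤ j₀) :
    (2 ^ j) ^ k * R.out ≤ R.size ^ k := by
  refine le_trans ?_ h.le
  gcongr
  · norm_num
  · exact le_max_right _ _

theorem IsMaxRate.relMean_le {j₀ j : ℕ} (h : IsMaxRate R j₀) (hA : Admissible w R) (hj : j ≤ j₀) :
    relMean R (2 ^ j) ≤ 1 / 2 ^ (j₀ - j) := by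
  have hN := hA.size_pos
  have hk := hA.one_le
  have hpos : (0 : ℝ) < (R.size ^ k : ℕ) := by positivity
  rw [relMean, div_le_div_iff₀ hpos (by positivity), one_mul]
  have h1 : (2 ^ j) ^ k * R.out * 2 ^ (j₀ - j) ≤ R.size ^ k := by
    refine le_trans ?_ (h.pow_mul_out_le le_rfl)
    have e : (2 : ℕ) ^ j₀ = 2 ^ j * 2 ^ (j₀ - j) := by rw [← pow_add]; congr 1; omega
    rw [e, mul_pow, mul_right_comm _ _ R.out]
    exact Nat.mul_le_mul_left _ (Nat.le_self_pow (by omega) _)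
  exact_mod_cast h1

/-- Maximality of 2^j₀: the next rate overshoots, and each halving of the rate loses a factor 2^k in
the mean. -/
theorem IsMaxRate.le_relMean {j₀ j : ℕ} (h : IsMaxRate R j₀) (hA : Admissible w R) (hj : j ≤ j₀)
    (hout : 1 ≤ R.out) : 1 / 2 ^ (k * (j₀ - j + 1)) ≤ relMean R (2 ^ j) := by
  have hN := hA.size_pos
  have hpos : (0 : ℝ) < (R.size ^ k : ℕ) := by positivity
  rw [relMean, div_le_div_iff₀ (by positivity) hpos, one_mul]
  have h1 : R.size ^ k ≤ (2 ^ j) ^ k * R.out * 2 ^ (k * (j₀ - j + 1)) := by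
    refine h.lt.le.trans (le_of_eq ?_)
    have e : (2 : ℕ) ^ (j₀ + 1) = 2 ^ j * 2 ^ (j₀ - j + 1) := by rw [← pow_add]; congr 1; omega
    rw [e, max_eq_right hout, mul_pow, ← pow_mul 2 (j₀ - j + 1), mul_comm k]
    ring
  exact_mod_cast h1

/-- A bound for the running time of a stage per unit of the sampling rate. -/
def rateCost (k C θ : ℕ) : ℕ := C * (drawCost k + 3) + stageCost k C θ + 3

/-- `V` is the cost of going on with the doubled rate. Near j₀ with nonempty output, Chebyshev's
inequality bounds both a bad estimate and a missed stop at j₀. Otherwise only stopping is charged as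
an error, with Markov's inequality. The -1 leaves room for the loop test. -/
theorem wp_stage_le_errorBound (hA : Admissible w R) {τ : ℝ} (hτ : 0 ≤ τ) {θ D : ℕ} (hθ : 1 ≤ θ)
    (hD : 1 ≤ D) (hC : 4 * (θ * 2 ^ (k + 1)) * R.size ^ (k + 1) < 2 ^ w)
    {ε : ℝ} (hε : 0 < ε) (hε1 : ε < 1) {j₀ j : ℕ} (hj₀ : IsMaxRate R j₀) (hj : j ≤ j₀)
    {s : State} (hs : Running R (2 ^ j) s) {V : ℝ} (hV : 0 ≤ V) {I : State → ℝ≥0∞}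
    (hcont : j < j₀ → ∀ s', Running R (2 ^ (j + 1)) s' → I s' ≤ ENNReal.ofReal V)
    (hover : ∀ s', Running R (2 ^ (j₀ + 1)) s' → I s' ≤ 1)
    (hgood : ∀ s', s'.reg 7 = 0 → IsApproximation ε R.out (s'.reg 0) → I s' ≤ ENNReal.ofReal τ)
    (hbad : ∀ s', s'.reg 7 = 0 → I s' ≤ ENNReal.ofReal (1 + τ)) :
    wp w R L (ENNReal.ofReal τ) (stage (θ * 2 ^ (k + 1)) θ) I s ≤ ENNReal.ofReal
      (V + errorBound ε k θ D (j₀ - j) +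
        (rateCost k (θ * 2 ^ (k + 1)) θ * 2 ^ j - 1) * τ) := by
  have hk := hA.one_le
  have hq1 : 1 ≤ 2 ^ j := Nat.one_le_two_pow
  have hqN : 2 ^ j ≤ R.size :=
    (Nat.pow_le_pow_right (by norm_num) hj).trans (hj₀.pow_le_size hk)
  have hq := hj₀.pow_mul_out_le hj
  set C := θ * 2 ^ (k + 1) with hCdef
  have hC1 : 1 ≤ C := Nat.mul_pos hθ (by positivity)
  have hθC : θ ≤ C := Nat.le_mul_of_pos_right _ (by positivity)
  -- As 2^j₀ ≤ N, the program cannot run out of rates before j₀.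
  have hlast : R.size < 2 * 2 ^ j → j = j₀ := by
    intro h
    by_contra hne
    have h1 := hj₀.pow_le_size hk
    have h2 : 2 ^ (j + 1) ≤ 2 ^ j₀ := Nat.pow_le_pow_right (by norm_num) (by omega)
    rw [pow_succ] at h2
    omega
  have hp0 := successProb_nonneg R (2 ^ j)
  have hp1 := successProb_le_one hA hq1 hq
  have hmean := mul_successProb hA (2 ^ j)
  set x := relMean R (2 ^ j) with hx
  set p := successProb R (2 ^ j) with hp
  have hCq : ((C * 2 ^ j : ℕ) : ℝ) * p = C * x := by
    rw [← hmean]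
    push_cast
    ring
  have hcost : ((C * 2 ^ j : ℕ) * ((drawCost k + 3 : ℕ) : ℝ) + 1) * τ + stageCost k C θ * τ + τ ≤
      (rateCost k C θ * 2 ^ j - 1) * τ := by
    have h1 : (1 : ℝ) ≤ 2 ^ j := one_le_pow₀ (by norm_num)
    have h2 : (0 : ℝ) ≤ stageCost k C θ := Nat.cast_nonneg _
    have h3 : ((C * 2 ^ j : ℕ) * ((drawCost k + 3 : ℕ) : ℝ) + 1) + stageCost k C θ + 1 ≤
        rateCost k C θ * 2 ^ j - 1 := by
      rw [rateCost]
      push_cast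
      have := mul_le_mul_of_nonneg_left h1 h2
      linarith
    have := mul_le_mul_of_nonneg_right h3 hτ
    linarith
  by_cases hcase : 1 ≤ R.out ∧ j₀ - j < D
  · obtain ⟨hout, hd⟩ := hcase
    have hxl := hj₀.le_relMean hA hj hout
    rw [← hx] at hxl
    set μ : ℝ := C * x with hμ
    have hx0 : 0 < x := lt_of_lt_of_le (by positivity) hxl
    have hμ0 : 0 < μ := by positivity
    have hμl : 2 * θ / 2 ^ (k * (j₀ - j)) ≤ μ := by
      refine le_trans (le_of_eq ?_) (mul_le_mul_of_nonneg_left hxl (Nat.cast_nonneg C))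
      rw [hCdef, mul_add k, mul_one, pow_add]
      push_cast
      field_simp
      rw [← pow_add]
    -- At deviation εμ/2 the quadratic term equals 2, more than the price 1 of a wrong result; its
    -- expectation is at most 8/(ε²μ), as the variance is at most μ.
    set γ : ℝ := 8 / (ε * μ) ^ 2 with hγ
    have hγ0 : 0 ≤ γ := by positivity
    have hdev : ∀ S : ℕ, ε / 2 * μ < |(S : ℝ) - μ| → 2 ≤ γ * (S - μ) ^ 2 := by
      intro S hS
      have h1 : (ε / 2 * μ) ^ 2 ≤ (S - μ) ^ 2 := by
        rw [← sq_abs ((S : ℝ) - μ)]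
        gcongr
      have h2 := mul_le_mul_of_nonneg_left h1 hγ0
      have h3 : γ * (ε / 2 * μ) ^ 2 = 2 := by
        rw [hγ]
        field_simp
        norm_num
      linarith
    -- At the largest rate μ ≥ 2θ, so fewer than θ successes deviate by more than μ/2.
    have hsmall : j = j₀ → ∀ S : ℕ, S < θ → 2 ≤ γ * (S - μ) ^ 2 := by
      intro hjj S hS
      refine hdev S ?_
      subst hjj
      simp only [Nat.sub_self, mul_zero, pow_zero, div_one] at hμl
      have h1 : (S : ℝ) < θ := by exact_mod_cast hS
      rw [lt_abs]
      right
      have h2 : ε / 2 * μ ≤ 1 / 2 * μ := by gcongr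
      linarith
    have hst := wp_stage_le (L := L) hA hτ (C := C) (θ := θ) hq1 hqN hq hC1 hC hθC hs
      (α := V + τ) (β := 0) (γ := γ) (μ := μ) (by positivity) le_rfl hγ0 (f := I) ?_ ?_ ?_
    · refine hst.trans (ENNReal.ofReal_le_ofReal ?_)
      have e : errorBound ε k θ D (j₀ - j) = 4 * 2 ^ (k * D) / (ε ^ 2 * θ) := if_pos hd
      have h1 : γ * (C * x * (1 - p)) ≤ 4 * 2 ^ (k * D) / (ε ^ 2 * θ) := by
        calc γ * (C * x * (1 - p)) ≤ γ * (μ * 1) := by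
              gcongr
              linarith
          _ = 8 / ε ^ 2 / μ := by rw [hγ]; field_simp
          _ ≤ 8 / ε ^ 2 / (2 * θ / 2 ^ (k * (j₀ - j))) := by
              gcongr
          _ = 4 * 2 ^ (k * (j₀ - j)) / (ε ^ 2 * θ) := by field_simp; norm_num
          _ ≤ _ := by
              gcongr
              norm_num
      have e2 : potential (V + τ) 0 γ μ p (drawCost k + 3) τ (C * 2 ^ j) 0 =
          V + τ + γ * (C * x * (1 - p)) +
            ((C * 2 ^ j : ℕ) * ((drawCost k + 3 : ℕ) : ℝ) + 1) * τ := by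
        unfold potential
        rw [hCq, ← mul_assoc _ p, hCq, ← hμ]
        push_cast
        ring
      rw [e, e2]
      linarith
    · intro S hS _ s' hs'
      rcases hj.lt_or_eq with h | h
      · refine (hcont h s' (by rw [pow_succ']; exact hs')).trans (ENNReal.ofReal_le_ofReal ?_)
        have : 0 ≤ γ * (S - μ) ^ 2 := by positivity
        linarith
      · refine (hover s' (by rw [pow_succ', ← h]; exact hs')).trans ?_
        rw [← ENNReal.ofReal_one]
        refine ENNReal.ofReal_le_ofReal ?_
        linarith [hsmall h S hS]
    · intro S hS hN s' h7 _
      refine (hbad s' h7).trans (ENNReal.ofReal_le_ofReal ?_)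
      linarith [hsmall (hlast hN) S hS]
    · intro S hS s' h7 h0
      by_cases hg : |(S : ℝ) - μ| ≤ ε / 2 * μ
      · refine (hgood s' h7 ?_).trans (ENNReal.ofReal_le_ofReal ?_)
        · rw [h0]
          exact isApproximation_estimateValue hA hε hC1 hq1 hg
        · have : 0 ≤ γ * (S - μ) ^ 2 := by positivity
          linarith
      · refine (hbad s' h7).trans (ENNReal.ofReal_le_ofReal ?_)
        linarith [hdev S (not_le.1 hg)]
  · have hθ0 : (0 : ℝ) < θ := by exact_mod_cast hθ
    have hzero : j = j₀ → R.out = 0 := by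
      intro h
      by_contra h0
      exact hcase ⟨Nat.one_le_iff_ne_zero.2 h0, by omega⟩
    have hxb : 2 ^ (k + 1) * x ≤ errorBound ε k θ D (j₀ - j) := by
      rcases Nat.eq_zero_or_pos R.out with h0 | h0
      · have : x = 0 := by simp [hx, relMean, h0]
        rw [this, mul_zero]
        exact errorBound_nonneg _ _ _ _ _
      · have hd : ¬ j₀ - j < D := fun h => hcase ⟨h0, h⟩
        rw [errorBound, if_neg hd, div_eq_mul_one_div]
        gcongr
        exact hj₀.relMean_le hA hj
    -- Markov: S/θ dominates the indicator of stopping and has mean C x/θ = 2^(k+1) x.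
    have hst := wp_stage_le (L := L) hA hτ (C := C) (θ := θ) hq1 hqN hq hC1 hC hθC hs
      (α := V + τ) (β := 1 / θ) (γ := 0) (μ := 0) (by positivity) (by positivity) le_rfl
      (f := I) ?_ ?_ ?_
    · refine hst.trans (ENNReal.ofReal_le_ofReal ?_)
      have e2 : potential (V + τ) (1 / θ) 0 0 p (drawCost k + 3) τ (C * 2 ^ j) 0 =
          V + τ + 2 ^ (k + 1) * x +
            ((C * 2 ^ j : ℕ) * ((drawCost k + 3 : ℕ) : ℝ) + 1) * τ := by
        unfold potential
        rw [hCq, hCdef]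
        push_cast
        field_simp
        ring
      rw [e2]
      linarith
    · intro S hS hN s' hs'
      rcases hj.lt_or_eq with h | h
      · refine (hcont h s' (by rw [pow_succ']; exact hs')).trans (ENNReal.ofReal_le_ofReal ?_)
        have : 0 ≤ 1 / (θ : ℝ) * S := by positivity
        linarith
      -- Here OUT = 0, so the largest rate satisfies N < 2 · 2^j₀ and the program stops after it.
      · exfalso
        have h1 := hj₀.lt
        rw [hzero h, max_eq_left (by norm_num), mul_one, ← h, pow_succ'] at h1
        exact absurd (lt_of_pow_lt_pow_left₀ k (Nat.zero_le _) h1) (not_lt.2 hN)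
    · intro S hS hN s' h7 h0
      refine (hgood s' h7 ?_).trans (ENNReal.ofReal_le_ofReal ?_)
      · rw [h0, hzero (hlast hN)]
        simp [IsApproximation]
      · have : 0 ≤ 1 / (θ : ℝ) * S := by positivity
        linarith
    · intro S hS s' h7 _
      refine (hbad s' h7).trans (ENNReal.ofReal_le_ofReal ?_)
      have : 1 ≤ 1 / (θ : ℝ) * S := by
        rw [one_div_mul_eq_div, le_div_iff₀ hθ0, one_mul]
        exact_mod_cast hS
      linarith

/-! ### Initialization, the loop over the sampling rates, and the choice of constants. -/

theorem reg_eval_forAll_addCard (l : List (Fin k)) (s : State) (hR : ∀ i, (R i).card < 2 ^ w)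
    (h : s.reg 1 + (l.map fun i => (R i).card).sum < 2 ^ w) :
    (eval w R L (forAll addCard l) s).reg 1 = s.reg 1 + (l.map fun i => (R i).card).sum ∧
      ∀ y, y ≠ 1 → y ≠ 11 → (eval w R L (forAll addCard l) s).reg y = s.reg y := by
  induction l generalizing s with
  | nil => simp [forAll, ofList, eval]
  | cons i l ih =>
    rw [List.map_cons, List.sum_cons] at h ⊢
    rw [eval_forAll_cons]
    set s1 := eval w R L (addCard i) s with hs1
    have e : s1 = (s.setReg w 11 (R i).card).setReg w 1 (s.reg 1 + (R i).card) := by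
      simp [hs1, addCard, eval, ofList, Instr.next, State.reg_setReg, Op.eval,
        Nat.mod_eq_of_lt (hR i)]
    have e1 : s1.reg 1 = s.reg 1 + (R i).card := by
      rw [e, State.reg_setReg, if_pos rfl]
      exact Nat.mod_eq_of_lt (by omega)
    have ey : ∀ y, y ≠ 1 → y ≠ 11 → s1.reg y = s.reg y := fun y h1 h2 => by
      simp [e, State.reg_setReg, h1, h2]
    have := ih s1 (by omega)
    refine ⟨?_, fun y h1 h2 => (this.2 y h1 h2).trans (ey y h1 h2)⟩
    rw [this.1, e1, add_assoc]

theorem det_init : (Program.init : Program k).Det :=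
  ⟨trivial, det_forAll (p := addCard) (fun _ => ⟨trivial, trivial, trivial⟩) _, trivial,
    det_mulPow _ _ _, trivial, trivial, trivial⟩

theorem running_eval_init (hA : Admissible w R) :
    Running R 1 (eval w R L Program.init State.start) := by
  have hk := hA.one_le
  have hNw : R.size ^ (k - 1) < 2 ^ w := hA.size_pow_lt' (by omega)
  have hsum : ((List.finRange k).map fun i => (R i).card).sum = R.size := by
    rw [← List.ofFn_id, List.map_ofFn, List.sum_ofFn]; rfl
  simp only [Program.init, eval_ofList_cons]
  set s1 := eval w R L (Program.const 8 1) State.start with hs1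
  have s18 : s1.reg 8 = 1 := by
    simp [hs1, eval, Instr.next, State.reg_setReg, Nat.mod_eq_of_lt hA.one_lt]
  have s1r : ∀ y ≠ 8, s1.reg y = 0 := fun y hy => by
    simp [hs1, eval, Instr.next, State.reg_setReg, hy, State.start]
  have hadd := reg_eval_forAll_addCard (L := L) (List.finRange k) s1 hA.card_lt
    (by rw [s1r 1 (by norm_num), hsum, zero_add]; exact hA.size_lt)
  rw [s1r 1 (by norm_num), hsum, zero_add] at hadd
  set s2 := eval w R L (forAll addCard (List.finRange k)) s1
  clear_value s2
  set s3 := eval w R L (Program.const 2 1) s2 with hs3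
  have s3r : ∀ y ≠ 2, s3.reg y = s2.reg y := fun y hy => by
    simp [hs3, eval, Instr.next, State.reg_setReg, hy]
  have s32 : s3.reg 2 = 1 := by
    simp [hs3, eval, Instr.next, State.reg_setReg, Nat.mod_eq_of_lt hA.one_lt]
  have s31 : s3.reg 1 = R.size := (s3r 1 (by norm_num)).trans hadd.1
  obtain ⟨m1, m2⟩ := reg_eval_mulPow (w := w) (R := R) (L := L) (x := 2) (y := 1) (by norm_num)
    (k - 1) s3 (by rw [s31, s32, one_mul]; exact hNw) (by rw [s31]; exact hA.size_pos)
  rw [s31, s32, one_mul] at m1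
  set s4 := eval w R L (mulPow 2 1 (k - 1)) s3
  clear_value s4 s3
  have s41 : s4.reg 1 = R.size := (m2 1 (by norm_num)).trans s31
  have s4r : ∀ y, y ≠ 1 → y ≠ 2 → y ≠ 11 → s4.reg y = s1.reg y := fun y h1 h2 h3 =>
    (m2 y h2).trans ((s3r y h2).trans (hadd.2 y h1 h3))
  simp only [ofList, eval, Instr.next]
  constructor <;> simp [State.reg_setReg, s41, s4r, m1, s18, s1r, Nat.mod_eq_of_lt hA.one_lt]

theorem exists_isMaxRate (hA : Admissible w R) : ∃ j₀, IsMaxRate R j₀ := by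
  have hN := hA.size_pos
  have hex : ∃ j, R.size ^ k < (2 ^ (j + 1)) ^ k * max 1 R.out := by
    refine ⟨R.size, lt_of_lt_of_le (Nat.pow_lt_pow_left (n := k) ?_ ?_)
      (Nat.le_mul_of_pos_right _ (by positivity))⟩
    · exact Nat.lt_two_pow_self.trans (Nat.pow_lt_pow_right (by norm_num) (Nat.lt_succ_self _))
    · have := hA.one_le; omega
  classical
  refine ⟨Nat.find hex, ?_, Nat.find_spec hex⟩
  rcases Nat.eq_zero_or_pos (Nat.find hex) with h | h
  · rw [h, pow_zero, one_pow, one_mul]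
    -- Rate 1 is always admissible, as OUT ≤ N^k.
    exact max_le (Nat.one_le_pow _ _ hN) out_le_size_pow
  · have := Nat.find_min hex (Nat.sub_lt h one_pos)
    rwa [show Nat.find hex - 1 + 1 = Nat.find hex by omega, not_lt] at this

open Classical in
/-- The indicator of a wrong result. -/
noncomputable def wrong (ε : ℝ) (V : ℕ) (s : State) : ℝ≥0∞ :=
  if IsApproximation ε V (s.reg 0) then 0 else 1

theorem wp_loop_stage_le (hA : Admissible w R) {τ : ℝ} (hτ : 0 ≤ τ) {θ D : ℕ} (hθ : 1 ≤ θ)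
    (hD : 1 ≤ D) (hC : 4 * (θ * 2 ^ (k + 1)) * R.size ^ (k + 1) < 2 ^ w)
    {ε : ℝ} (hε : 0 < ε) (hε1 : ε < 1) {j₀ : ℕ} (hj₀ : IsMaxRate R j₀)
    {s : State} (hs : Running R 1 s) :
    wp w R L (ENNReal.ofReal τ) (.loop 7 (stage (θ * 2 ^ (k + 1)) θ)) (wrong ε R.out) s ≤
      ENNReal.ofReal (D * (4 * 2 ^ (k * D) / (ε ^ 2 * θ)) + 2 * 2 ^ (k + 1) / 2 ^ D +
        2 * rateCost k (θ * 2 ^ (k + 1)) θ * 2 ^ j₀ * τ) := by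
  classical
  set A : ℝ := ((rateCost k (θ * 2 ^ (k + 1)) θ : ℕ) : ℝ) with hAdef
  have hA0 : 0 ≤ A := Nat.cast_nonneg _
  -- The errors and the geometric running time of the stages j, …, j₀.
  let U : ℕ → ℝ := fun j => ∑ d ∈ Finset.range (j₀ + 1 - j), errorBound ε k θ D d +
    A * (2 ^ (j₀ + 1) - 2 ^ j) * τ
  have hU : ∀ j ≤ j₀ + 1, 0 ≤ U j := fun j hj => by
    refine add_nonneg (Finset.sum_nonneg fun d _ => errorBound_nonneg _ _ _ _ _) ?_
    have : (2 : ℝ) ^ j ≤ 2 ^ (j₀ + 1) := pow_le_pow_right₀ (by norm_num) hj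
    have := sub_nonneg.2 this
    positivity
  have hstep : ∀ j ≤ j₀, U j = τ + (U (j + 1) + errorBound ε k θ D (j₀ - j) +
      (A * 2 ^ j - 1) * τ) := fun j hj => by
    simp only [U]
    rw [show j₀ + 1 - j = (j₀ + 1 - (j + 1)) + 1 by omega, Finset.sum_range_succ,
      show j₀ + 1 - (j + 1) = j₀ - j by omega, pow_succ 2 j]
    ring
  -- States outside the admissible rates get the value 1, which the truncation makes an invariant;
  -- the logarithm recovers j from the rate.
  let I : State → ℝ≥0∞ := fun s =>
    if s.reg 7 = 0 then ENNReal.ofReal τ + wrong ε R.out s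
    else if ∃ j ≤ j₀, Running R (2 ^ j) s then ENNReal.ofReal (U (Nat.log 2 (s.reg 3))) else 1
  have hIrun : ∀ j ≤ j₀, ∀ s, Running R (2 ^ j) s → I s = ENNReal.ofReal (U j) := by
    intro j hj s hs
    simp only [I, hs.reg7, one_ne_zero, if_false]
    rw [if_pos ⟨j, hj, hs⟩, hs.reg3, Nat.log_pow (by norm_num)]
  have hI : wp w R L (ENNReal.ofReal τ) (.loop 7 (stage (θ * 2 ^ (k + 1)) θ)) (wrong ε R.out) s ≤
      I s := by
    refine wp_loop_le I (fun s hs => ?_) (fun s hs => ?_) s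
    · by_cases hrun : ∃ j ≤ j₀, Running R (2 ^ j) s
      · obtain ⟨j, hj, hr⟩ := hrun
        rw [hIrun j hj s hr, hstep j hj]
        refine (min_le_right _ _).trans ?_
        have hst := wp_stage_le_errorBound (L := L) hA hτ hθ hD hC hε hε1 hj₀ hj hr
          (V := U (j + 1)) (hU _ (by omega)) (I := I)
          (fun hlt s' hs' => (hIrun (j + 1) hlt s' hs').le)
          (fun s' hs' => by
            simp only [I, hs'.reg7, one_ne_zero, if_false]
            rw [if_neg]
            rintro ⟨i, hi, hri⟩
            have := Nat.pow_right_injective (le_refl 2) (hri.reg3.symm.trans hs'.reg3)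
            omega)
          (fun s' h7 hg => by
            simp only [I, h7, if_true, wrong, if_pos hg, add_zero]
            exact le_rfl)
          (fun s' h7 => by
            simp only [I, h7, if_true, wrong]
            rw [add_comm, ENNReal.ofReal_add zero_le_one hτ, ENNReal.ofReal_one]
            refine add_le_add ?_ le_rfl
            split_ifs <;> simp)
        refine (add_le_add le_rfl hst).trans ?_
        by_cases hneg : 0 ≤ U (j + 1) + errorBound ε k θ D (j₀ - j) + (A * 2 ^ j - 1) * τ
        · rw [← ENNReal.ofReal_add hτ hneg]
        · exfalso
          refine hneg (add_nonneg (add_nonneg (hU _ (by omega)) (errorBound_nonneg _ _ _ _ _))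
            (mul_nonneg ?_ hτ))
          have h1 : (1 : ℝ) ≤ A := by
            rw [hAdef]
            exact_mod_cast (by rw [rateCost]; omega : 1 ≤ rateCost k (θ * 2 ^ (k + 1)) θ)
          have h2 : (1 : ℝ) ≤ 2 ^ j := one_le_pow₀ (by norm_num)
          linarith [one_le_mul_of_one_le_of_one_le h1 h2]
      · simp only [I, hs, if_false, if_neg hrun]
        exact min_le_left _ _
    · simp only [I, hs, if_true]
      exact min_le_right _ _
  refine hI.trans ?_
  rw [hIrun 0 (Nat.zero_le _) s (by rwa [pow_zero])]
  refine ENNReal.ofReal_le_ofReal ?_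
  have h1 := sum_errorBound_le ε k θ D (j₀ + 1)
  have h2 : A * (2 ^ (j₀ + 1) - 2 ^ 0) * τ ≤ 2 * A * 2 ^ j₀ * τ := by
    rw [pow_succ]
    have : 0 ≤ A * τ := by positivity
    linarith
  simp only [U, Nat.sub_zero]
  linarith

theorem wp_estimate_le (hA : Admissible w R) {τ : ℝ} (hτ : 0 ≤ τ) {θ D : ℕ} (hθ : 1 ≤ θ)
    (hD : 1 ≤ D) (hC : 4 * (θ * 2 ^ (k + 1)) * R.size ^ (k + 1) < 2 ^ w)
    {ε : ℝ} (hε : 0 < ε) (hε1 : ε < 1) {j₀ : ℕ} (hj₀ : IsMaxRate R j₀) :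
    wp w R L (ENNReal.ofReal τ) (estimate (θ * 2 ^ (k + 1)) θ) (wrong ε R.out) State.start ≤
      ENNReal.ofReal (D * (4 * 2 ^ (k * D) / (ε ^ 2 * θ)) + 2 * 2 ^ (k + 1) / 2 ^ D +
        (2 * rateCost k (θ * 2 ^ (k + 1)) θ + (Program.init : Program k).len + 1) * 2 ^ j₀ * τ) := by
  have hloop := wp_loop_stage_le (L := L) hA hτ hθ hD hC hε hε1 hj₀ (running_eval_init (L := L) hA)
  have hlen := wp_le_len_mul_add (w := w) (L := L) (τ := ENNReal.ofReal τ) det_init.loopFree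
    (wp w R L (ENNReal.ofReal τ) (.loop 7 (stage (θ * 2 ^ (k + 1)) θ)) (wrong ε R.out))
    State.start
  rw [wp_zero_of_det det_init, natCast_mul_ofReal] at hlen
  change ENNReal.ofReal τ + _ ≤ _
  refine (add_le_add le_rfl (hlen.trans (add_le_add le_rfl hloop))).trans ?_
  set l : ℝ := ((Program.init : Program k).len : ℝ) with hl
  have hl0 : 0 ≤ l := Nat.cast_nonneg _
  set A : ℝ := ((rateCost k (θ * 2 ^ (k + 1)) θ : ℕ) : ℝ) with hAdef
  have hA0 : 0 ≤ A := Nat.cast_nonneg _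
  clear_value A l
  rw [← ENNReal.ofReal_add (by positivity) (by positivity),
    ← ENNReal.ofReal_add hτ (by positivity)]
  refine ENNReal.ofReal_le_ofReal ?_
  have h1 : (1 : ℝ) ≤ 2 ^ j₀ := one_le_pow₀ (by norm_num)
  have h2 := mul_le_mul_of_nonneg_left h1 (by positivity : 0 ≤ (l + 1) * τ)
  linarith

theorem IsMaxRate.pow_le_div {j₀ : ℕ} (h : IsMaxRate R j₀) (hk : 1 ≤ k) :
    (2 : ℝ) ^ j₀ ≤ (R.size : ℝ) / ((max 1 R.out : ℕ) : ℝ) ^ (1 / (k : ℝ)) := by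
  have hM : (0 : ℝ) < (max 1 R.out : ℕ) := by positivity
  have h2 : (0 : ℝ) < 2 ^ j₀ := by positivity
  rw [le_div_iff₀ (Real.rpow_pos_of_pos hM _), mul_comm, ← le_div_iff₀ h2]
  have h1 : ((max 1 R.out : ℕ) : ℝ) ≤ ((R.size : ℝ) / 2 ^ j₀) ^ k := by
    rw [div_pow, le_div_iff₀ (by positivity), mul_comm]
    exact_mod_cast h.le
  have h3 := Real.rpow_le_rpow hM.le h1 (by positivity : (0 : ℝ) ≤ 1 / k)
  rw [one_div] at h3 ⊢
  rwa [Real.pow_rpow_inv_natCast (by positivity) (by omega)] at h3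

/-- With l the bit length of N, N^(2k) needs 2kl bits, and 4C N^(k+1) needs at most 4C + (k+1)l bits
because 4C < 2^(4C). -/
theorem admissible_of_le (hk : 1 ≤ k) (hN : 1 ≤ R.size) (hfit : R.FitsIn w) {C : ℕ}
    (hw : (2 * k + 1 + 4 * C) * (Nat.log 2 R.size + 1) ≤ w) :
    Admissible w R ∧ 4 * C * R.size ^ (k + 1) < 2 ^ w := by
  set l := Nat.log 2 R.size + 1 with hl
  have hNl : R.size < 2 ^ l := Nat.lt_pow_succ_log_self (by norm_num) _
  have hl1 : 1 ≤ l := by omega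
  have h1 : 2 ^ (l * (2 * k)) ≤ 2 ^ w := Nat.pow_le_pow_right (by norm_num) (by nlinarith)
  have h2 : 2 ^ (4 * C) * 2 ^ (l * (k + 1)) ≤ 2 ^ w := by
    rw [← pow_add]
    exact Nat.pow_le_pow_right (by norm_num) (by nlinarith)
  refine ⟨⟨hk, hN, hfit, lt_of_lt_of_le ?_ h1⟩, lt_of_lt_of_le ?_ h2⟩
  · rw [pow_mul 2 l]
    exact Nat.pow_lt_pow_left hNl (by omega)
  · rw [pow_mul 2 l]
    exact Nat.mul_lt_mul_of_lt_of_le Nat.lt_two_pow_self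
      (Nat.pow_le_pow_left hNl.le _) (by positivity)

end WordRAM

open WordRAM in
theorem mainTheorem6 (k : ℕ) (hk : 1 ≤ k) (ε : ℝ) (hε0 : 0 < ε) (hε1 : ε < 1)
    (δ : ℝ) (hδ0 : 0 < δ) (hδ1 : δ < 1) :
    ∃ (P : WordRAM.Program k) (C : ℝ) (c : ℕ),
      ∀ (R : StarInstance k) (L : R.Ordering) (w : ℕ),
        1 ≤ R.size → c * (Nat.log 2 R.size + 1) ≤ w → R.FitsIn w →
        ∃ t : ℕ,
          (t : ℝ) ≤ C * ((R.size : ℝ) / ((max 1 R.out : ℕ) : ℝ) ^ (1 / (k : ℝ))) ∧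
          ENNReal.ofReal (1 - δ) ≤
            WordRAM.haltProb w R L P t (fun v => IsApproximation ε (R.out : ℝ) (v : ℝ)) := by
  -- The failure budget δ is split into δ/4 for stopping too early, δ/4 for inaccurate estimates and
  -- δ/2 for the running time. D is fixed first, as θ depends on it.
  obtain ⟨D, hD1, hD⟩ : ∃ D : ℕ, 1 ≤ D ∧ 2 * 2 ^ (k + 1) / (2 : ℝ) ^ D ≤ δ / 4 := by
    obtain ⟨n, hn⟩ := pow_unbounded_of_one_lt (2 * 2 ^ (k + 1) / (δ / 4)) (one_lt_two (α := ℝ))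
    refine ⟨n + 1, by omega, ?_⟩
    rw [div_lt_iff₀ (by positivity)] at hn
    rw [div_le_iff₀ (by positivity), pow_succ 2 n]
    have : 0 ≤ δ / 4 * 2 ^ n := by positivity
    linarith
  obtain ⟨θ, hθ1, hθ⟩ : ∃ θ : ℕ, 1 ≤ θ ∧ (D : ℝ) * (4 * 2 ^ (k * D) / (ε ^ 2 * θ)) ≤ δ / 4 := by
    obtain ⟨n, hn⟩ := exists_nat_gt ((D : ℝ) * (4 * 2 ^ (k * D)) / (ε ^ 2 * (δ / 4)))
    have hn0 : (0 : ℝ) < n := lt_of_le_of_lt (by positivity) hn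
    refine ⟨n, by exact_mod_cast hn0, ?_⟩
    rw [div_lt_iff₀ (by positivity)] at hn
    rw [← mul_div_assoc, div_le_iff₀ (by positivity)]
    linarith
  set A : ℝ := 2 * rateCost k (θ * 2 ^ (k + 1)) θ + (Program.init : Program k).len + 1 with hAdef
  have hA0 : 0 ≤ A := by positivity
  -- With time limit t = T · 2^j₀ and τ = 1/t, the expected time costs at most A/T ≤ δ/2.
  obtain ⟨T, hT⟩ := exists_nat_gt (A / (δ / 2))
  have hT0 : (0 : ℝ) < T := lt_of_le_of_lt (by positivity) hT
  have hT1 : 1 ≤ T := by exact_mod_cast hT0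
  rw [div_lt_iff₀ (by positivity)] at hT
  refine ⟨Program.estimate (θ * 2 ^ (k + 1)) θ, T, 2 * k + 1 + 4 * (θ * 2 ^ (k + 1)), ?_⟩
  intro R L w hN hw hfit
  obtain ⟨hA, hC⟩ := admissible_of_le hk hN hfit hw
  obtain ⟨j₀, hj₀⟩ := exists_isMaxRate hA
  have ht0 : (0 : ℝ) < (T * 2 ^ j₀ : ℕ) := by positivity
  refine ⟨T * 2 ^ j₀, ?_, ?_⟩
  · rw [Nat.cast_mul, Nat.cast_pow, Nat.cast_ofNat]
    exact mul_le_mul_of_nonneg_left (hj₀.pow_le_div hk) hT0.le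
  · rw [ENNReal.ofReal_sub 1 hδ0.le, ENNReal.ofReal_one]
    refine le_haltProb_of_wp_le _ _ (wrong ε R.out) (fun s => ?_) _
      (Nat.mul_pos hT1 (by positivity)) ?_
    · unfold wrong
      split_ifs with h
      · exact Or.inl h
      · exact Or.inr le_rfl
    · have e : (((T * 2 ^ j₀ : ℕ) : ENNReal))⁻¹ = ENNReal.ofReal ((T * 2 ^ j₀ : ℕ) : ℝ)⁻¹ := by
        rw [ENNReal.ofReal_inv_of_pos ht0, ENNReal.ofReal_natCast]
      rw [e]
      refine (wp_estimate_le (L := L) hA (inv_nonneg.2 ht0.le) hθ1 hD1 hC hε0 hε1 hj₀).trans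
        (ENNReal.ofReal_le_ofReal ?_)
      rw [← hAdef]
      have h1 : A * 2 ^ j₀ * ((T * 2 ^ j₀ : ℕ) : ℝ)⁻¹ = A / T := by
        push_cast
        field_simp
      have h2 : A / T ≤ δ / 2 := by
        rw [div_le_iff₀ hT0]
        linarith
      rw [h1]
      linarith
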